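/- Let $n,d\in\mathbb N$ and let $X=(X_1,\dots,X_n)$ be a random vector with $\mathbb R^d$-valued components on a probability space, with $\mathbb E|X_i|^2<\infty$ for all $i$, and let $\lambda_1,\dots,\lambda_n\in(0,1)$ with $\sum_{i=1}^n\lambda_i^2=1$. For a random vector $U$ with density $f$ write $h(U)=-\int f\log f$, and let $h(U|V)=h(U,V)-h(V)$. Assume that $(X_1,\dots,X_n)$, $(X_j)_{j\neq i}$ (for every $i$) and $\sum_i\lambda_iX_i$ have densities $f$ with $f\log f$ integrable. Let $Z_1,\dots,Z_n\sim N(0,\mathrm{Id}_{\mathbb R^d})$ be standard Gaussian vectors, independent of one another and jointly independent of $X$, and set $$Y_i(t)=e^{-t}X_i+\sqrt{1-e^{-2t}}\,Z_i,\qquad t\ge 0,\ i=1,\dots,n .$$ For a random vector $U=(U_k)_{k\in K}$ ($K$ finite, $U_k\in\mathbb R^d$) with nonnegative continuously differentiable density $p$, let $\rho_k=-\nabla_k p/p$ be its scores, where $\nabla_k$ is the gradient in the $k$-th block of variables, and set $I_{kl}(U)=\mathbb E\langle\rho_k(U),\rho_l(U)\rangle$ and $I(U)=\int|\nabla p|^2/p=\int\sum_k|\nabla_kp|^2/p$.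 Then for every $t\ge 0$ the vectors $(Y_1(t),\dots,Y_n(t))$, $(Y_j(t))_{j\ne i}$ and $\sum_i\lambda_iY_i(t)$ have densities $f$ with $f\log f$ integrable; for every $s>0$ the vectors $(Y_1(s),\dots,Y_n(s))$ and $(Y_j(s))_{j\neq i}$ have continuously differentiable densities, and the integrals defining $I_{ij}(Y_1(s),\dots,Y_n(s))$ and $I(Y_j(s),j\ne i)$ converge absolutely; the function $$\mathcal S_s=\sum_{i,j=1}^n\lambda_i\lambda_jI_{ij}(Y_1(s),\dots,Y_n(s))-\sum_{i=1}^nI_{ii}(Y_1(s),\dots,Y_n(s))+\sum_{i=1}^n\lambda_i^2I(Y_j(s),j\ne i)$$ is integrable on $(0,t]$ for every $t\ge0$; and with $S_t=\int_0^t\mathcal S_s\,ds$, for all $t\ge 0$, $$h\Big(\sum_i\lambda_iY_i(t)\Big)-\sum_i\lambda_i^2h(Y_i(t)\,|\,Y_j(t),j\ne i)\le h\Big(\sum_i\lambda_iX_i\Big)-\sum_i\lambda_i^2h(X_i\,|\,X_j,j\neq i)+S_t .$$ In particular, $$h\Big(\sum_i\lambda_iX_i\Big)\ge\sum_i\lambda_i^2h(X_i\,|\,X_j,j\ne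 i)-\limsup_{t\to\infty}S_t ,$$ where the $\limsup$ and the right-hand side are taken in the extended reals $[-\infty,\infty]$. -/

import Mathlib

namespace CondEPI

open MeasureTheory ProbabilityTheory

noncomputable section

/-! ### Shannon entropy of random vectors -/

section Entropy

variable {Ω : Type*} [MeasurableSpace Ω] {E F : Type*} [MeasureSpace E] [MeasureSpace F]

/-- The (a.e. defined) Lebesgue density `f` of the law of `X`. -/
def density (P : Measure Ω) (X : Ω → E) (x : E) : ℝ :=
  ((P.map X).rnDeriv volume x).toReal

/-- `X` has a density `f`, and `f log f` is Lebesgue integrable. -/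
def HasFiniteEntropy (P : Measure Ω) (X : Ω → E) : Prop :=
  P.map X ≪ volume ∧
    Integrable (fun x => density P X x * Real.log (density P X x)) volume

/-- The entropy `h(X) = - ∫ f log f`, where `f` is the density of `X`. -/
def entropy (P : Measure Ω) (X : Ω → E) : ℝ :=
  - ∫ x, density P X x * Real.log (density P X x)

/-- The conditional entropy `h(X | Y) = h(X, Y) - h(Y)`. -/
def condEntropy (P : Measure Ω) (X : Ω → E) (Y : Ω → F) : ℝ :=
  entropy P (fun ω => (X ω, Y ω)) - entropy P Y

end Entropy

/-! ### Classical densities, scores and Fisher information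

Random vectors `X = (X_i)_{i ∈ ι}` have blocks `X_i` with values in `ℝ^d`. The space of values
`ι → ℝ^d` carries the product Lebesgue measure. -/

section Fisher

variable {Ω : Type*} [MeasurableSpace Ω] {ι : Type*} [Fintype ι] {d : ℕ}

/-- `p` is a classical (nonnegative, continuously differentiable) density of the law of `X`. -/
def IsC1Density (P : Measure Ω) (X : Ω → ι → EuclideanSpace ℝ (Fin d))
    (p : (ι → EuclideanSpace ℝ (Fin d)) → ℝ) : Prop :=
  ContDiff ℝ 1 p ∧ (∀ x, 0 ≤ p x) ∧
    P.map X = volume.withDensity (fun x => ENNReal.ofReal (p x))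

/-- There is at most one classical density. -/
theorem IsC1Density.unique {P : Measure Ω} {X : Ω → ι → EuclideanSpace ℝ (Fin d)}
    {p q : (ι → EuclideanSpace ℝ (Fin d)) → ℝ}
    (hp : IsC1Density P X p) (hq : IsC1Density P X q) : p = q := by
  obtain ⟨hp1, hp0, hpm⟩ := hp
  obtain ⟨hq1, hq0, hqm⟩ := hq
  have h1 : Measurable (fun x => ENNReal.ofReal (p x)) :=
    ENNReal.measurable_ofReal.comp hp1.continuous.measurable
  have h2 : Measurable (fun x => ENNReal.ofReal (q x)) :=
    ENNReal.measurable_ofReal.comp hq1.continuous.measurable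
  have h3 := (withDensity_eq_iff_of_sigmaFinite h1.aemeasurable h2.aemeasurable).1
    (hpm.symm.trans hqm)
  refine Measure.eq_of_ae_eq (μ := volume) ?_ hp1.continuous hq1.continuous
  filter_upwards [h3] with x hx
  exact (ENNReal.ofReal_eq_ofReal_iff (hp0 x) (hq0 x)).1 hx

/-- The law of `X` has a classical density. -/
def HasC1Density (P : Measure Ω) (X : Ω → ι → EuclideanSpace ℝ (Fin d)) : Prop :=
  ∃ p, IsC1Density P X p

open Classical in
/-- The classical density of `X` (and `0` if there is none). -/
def c1Density (P : Measure Ω) (X : Ω → ι → EuclideanSpace ℝ (Fin d)) :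
    (ι → EuclideanSpace ℝ (Fin d)) → ℝ :=
  if h : HasC1Density P X then h.choose else 0

theorem c1Density_eq {P : Measure Ω} {X : Ω → ι → EuclideanSpace ℝ (Fin d)}
    {p : (ι → EuclideanSpace ℝ (Fin d)) → ℝ} (hp : IsC1Density P X p) :
    c1Density P X = p := by
  have h : HasC1Density P X := ⟨p, hp⟩
  rw [c1Density, dif_pos h]
  exact h.choose_spec.unique hp

variable [DecidableEq ι]

/-- The gradient `∇_i p (x) ∈ ℝ^d` of `p` in the `i`-th block of variables. -/
def blockGrad (p : (ι → EuclideanSpace ℝ (Fin d)) → ℝ) (i : ι)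
    (x : ι → EuclideanSpace ℝ (Fin d)) : EuclideanSpace ℝ (Fin d) :=
  gradient (fun u => p (Function.update x i u)) (x i)

/-- The `i`-th block `ρ_i = - ∇_i p / p` of the score of `X`, where `p` is the density of `X`. -/
def score (P : Measure Ω) (X : Ω → ι → EuclideanSpace ℝ (Fin d)) (i : ι)
    (x : ι → EuclideanSpace ℝ (Fin d)) : EuclideanSpace ℝ (Fin d) :=
  -((c1Density P X x)⁻¹ • blockGrad (c1Density P X) i x)

/-- The entry `I_ij(X) = 𝔼 ⟨ρ_i(X), ρ_j(X)⟩` of the Fisher information matrix. -/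
def fisherMatrix (P : Measure Ω) (X : Ω → ι → EuclideanSpace ℝ (Fin d)) (i j : ι) : ℝ :=
  ∫ ω, inner ℝ (score P X i (X ω)) (score P X j (X ω)) ∂P

/-- The Fisher information matrix of `X` is well defined, with finite entries. -/
def HasFisherMatrix (P : Measure Ω) (X : Ω → ι → EuclideanSpace ℝ (Fin d)) : Prop :=
  HasC1Density P X ∧
    ∀ i j, Integrable (fun ω => inner ℝ (score P X i (X ω)) (score P X j (X ω))) P

/-- The Fisher information `I(X) = ∫ |∇p|² / p`, where `p` is the density of `X` and
`|∇p|² = ∑_i |∇_i p|²`. -/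
def fisherInfo (P : Measure Ω) (X : Ω → ι → EuclideanSpace ℝ (Fin d)) : ℝ :=
  ∫ x, (∑ i, ‖blockGrad (c1Density P X) i x‖ ^ 2) / c1Density P X x

/-- The Fisher information of `X` is well defined and finite. -/
def HasFisherInfo (P : Measure Ω) (X : Ω → ι → EuclideanSpace ℝ (Fin d)) : Prop :=
  HasC1Density P X ∧
    Integrable
      (fun x => (∑ i, ‖blockGrad (c1Density P X) i x‖ ^ 2) / c1Density P X x) volume

end Fisher

/-! ### The Ornstein-Uhlenbeck flow and the error term -/

section Flow

variable {Ω : Type*} {n d : ℕ}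

/-- `Y_i(t) = e^{-t} X_i + √(1 - e^{-2t}) Z_i`. -/
def ouFlow (X Z : Fin n → Ω → EuclideanSpace ℝ (Fin d)) (t : ℝ) (i : Fin n) (ω : Ω) :
    EuclideanSpace ℝ (Fin d) :=
  Real.exp (-t) • X i ω + √(1 - Real.exp (-2 * t)) • Z i ω

/-- The random vector `(X_1, …, X_n)`. -/
def joint (X : Fin n → Ω → EuclideanSpace ℝ (Fin d)) (ω : Ω) :
    Fin n → EuclideanSpace ℝ (Fin d) :=
  fun i => X i ω

/-- The random vector `(X_j)_{j ≠ i}`. -/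
def others (X : Fin n → Ω → EuclideanSpace ℝ (Fin d)) (i : Fin n) (ω : Ω) :
    {j : Fin n // j ≠ i} → EuclideanSpace ℝ (Fin d) :=
  fun j => X j ω

/-- The weighted sum `∑ λ_i X_i`. -/
def weightedSum (lam : Fin n → ℝ) (X : Fin n → Ω → EuclideanSpace ℝ (Fin d)) (ω : Ω) :
    EuclideanSpace ℝ (Fin d) :=
  ∑ i, lam i • X i ω

variable [MeasurableSpace Ω]

/-- `h(∑ λ_i X_i) - ∑ λ_i² h(X_i | X_j, j ≠ i)`. -/
def entropyGap (P : Measure Ω) (lam : Fin n → ℝ) (X : Fin n → Ω → EuclideanSpace ℝ (Fin d)) : ℝ :=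
  entropy P (weightedSum lam X) - ∑ i, lam i ^ 2 * condEntropy P (X i) (others X i)

/-- `∑_{i,j} λ_i λ_j I_ij(Y) - ∑_i I_ii(Y) + ∑_i λ_i² I(Y_j, j ≠ i)`. -/
def errorRate (P : Measure Ω) (lam : Fin n → ℝ) (Y : Fin n → Ω → EuclideanSpace ℝ (Fin d)) : ℝ :=
  ∑ i, ∑ j, lam i * lam j * fisherMatrix P (joint Y) i j
    - ∑ i, fisherMatrix P (joint Y) i i
    + ∑ i, lam i ^ 2 * fisherInfo P (others Y i)

/-- `S_t`, the integral over `[0, t]` of the error rate of `Y(s)`. -/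
def errorTerm (P : Measure Ω) (lam : Fin n → ℝ) (X Z : Fin n → Ω → EuclideanSpace ℝ (Fin d))
    (t : ℝ) : ℝ :=
  ∫ s in (0 : ℝ)..t, errorRate P lam (ouFlow X Z s)

end Flow

end

end CondEPI

/-! Let μ be the law of a block vector with N real coordinates. The density of μ ∗ N(0, s·Id) is
`heatFlow μ s`, with entropy `heatEntropy μ s` and Fisher information `heatFisher μ s`. Since Y(t) =
e^{-t}(X + √(e^{2t} − 1) Z), each vector along the Ornstein-Uhlenbeck flow is a rescaled heat flow
vector. De Bruijn's identity (`hasDerivAt_heatEntropy`) therefore becomes d/dt h(Y(t)) = I(Y(t)) − N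
for t > 0.

Because ∑ λ_i² = 1, the entropy gap equals h(∑ λ_i X_i) − h(X_1, …, X_n) + ∑ λ_i² h(X_j, j ≠ i)
(`entropyGap_eq`). Along the flow the dimensional terms cancel, as d − nd + (n − 1)d = 0, and the
derivative of the gap is I(∑ λ_i Y_i) − ∑ I_ii + ∑ λ_i² I(Y_j, j ≠ i). This differs from the error
rate only in its first term. The Blachman-Stam inequality (`heatFisher_blockSum_le`) gives I(∑ λ_i
Y_i) ≤ ∑ λ_i λ_j I_ij, because the score of the sum is the conditional expectation of ∑ λ_i ρ_i
given the sum. Here ∑ λ_i² = 1 is used again: it makes ∑ λ_i Z_i standard Gaussian, so the sum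
follows the same flow. Integration over [0, t] yields `entropyGap_ouFlow_le`.

The delicate point is t = 0, where only f log f integrable and a finite second moment are available.
Continuity of the entropy there (`tendsto_heatEntropy_zero`) has two halves. Adding independent
noise does not decrease entropy, by Jensen's inequality; the opposite bound comes from Gibbs'
inequality with a test function whose variational value is almost optimal (`exists_variational_ge`),
together with weak continuity of the flow. Integrability of the Fisher information up to time 0 is
then automatic, since it is the nonnegative derivative of a function that is continuous up to 0
(`integral_heatFisher_exp`).

As t → ∞ every entropy tends to that of the standard Gaussian of its dimension
(`tendsto_entropy_blockOU`), so the gap tends to 0 by the same cancellation. Letting t → ∞ in the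
integrated inequality gives the final bound. -/

namespace CondEPI

open MeasureTheory ProbabilityTheory Filter Topology
open scoped ENNReal

/-! ### Densities of product measures and images -/

section Densities

/-- A product of measures with densities has the product density. -/
theorem pi_withDensity_ofReal {ι : Type*} [Fintype ι] {E : ι → Type*}
    [∀ i, MeasurableSpace (E i)] (μ : ∀ i, Measure (E i)) [∀ i, SigmaFinite (μ i)]
    (f : ∀ i, E i → ℝ) (hf : ∀ i x, 0 ≤ f i x) (hint : ∀ i, Integrable (f i) (μ i)) :
    Measure.pi (fun i => (μ i).withDensity fun x => ENNReal.ofReal (f i x)) =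
      (Measure.pi μ).withDensity fun x => ENNReal.ofReal (∏ i, f i (x i)) := by
  have hσ : ∀ i, SigmaFinite ((μ i).withDensity fun x => ENNReal.ofReal (f i x)) := fun i =>
    have := isFiniteMeasure_withDensity_ofReal (hint i).2
    inferInstance
  refine Measure.pi_eq fun s hs => ?_
  rw [withDensity_apply _ (MeasurableSet.univ_pi hs), Measure.restrict_pi_pi]
  have h1 : ∀ i, ((μ i).withDensity fun x => ENNReal.ofReal (f i x)) (s i) =
      ENNReal.ofReal (∫ x, f i x ∂((μ i).restrict (s i))) := fun i => by
    rw [withDensity_apply _ (hs i), ofReal_integral_eq_lintegral_ofReal (hint i).restrict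
      (ae_of_all _ (hf i))]
  rw [← ofReal_integral_eq_lintegral_ofReal
    (Integrable.fintype_prod_dep fun i => (hint i).restrict)
    (ae_of_all _ fun x => Finset.prod_nonneg fun i _ => hf i _),
    integral_fintype_prod_eq_prod, ENNReal.ofReal_prod_of_nonneg
      (fun i _ => integral_nonneg (hf i))]
  exact Finset.prod_congr rfl fun i _ => (h1 i).symm

/-- The image of a measure with a density under a measure preserving equivalence. -/
theorem map_withDensity_of_measurePreserving {α β : Type*} [MeasurableSpace α] [MeasurableSpace β]
    {μ : Measure α} {ν : Measure β} (e : α ≃ᵐ β) (he : MeasurePreserving e μ ν)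
    (f : α → ℝ≥0∞) :
    (μ.withDensity f).map e = ν.withDensity (f ∘ e.symm) := by
  ext s hs
  rw [e.map_apply, withDensity_apply _ (e.measurable hs), withDensity_apply _ hs, ← he.map_eq,
    e.restrict_map, lintegral_map_equiv]
  simp

end Densities

/-! ### The Gaussian kernel -/

section Kernel

variable {ι : Type*} [Fintype ι] {d : ℕ}

/-- The square of the Euclidean norm of a block vector. -/
noncomputable def normSq (x : ι → EuclideanSpace ℝ (Fin d)) : ℝ := ∑ i, ‖x i‖ ^ 2

/-- The number of real coordinates of a block vector. -/
def blockDim (ι : Type*) [Fintype ι] (d : ℕ) : ℕ := Fintype.card ι * d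

/-- The density of the centered Gaussian law with covariance `s • Id`. -/
noncomputable def heatKernel (s : ℝ) (x : ι → EuclideanSpace ℝ (Fin d)) : ℝ :=
  -- The normalising constant is kept inside the exponential: the logarithm is then explicit, and
  -- scaling or differentiating in `s` only changes an exponent.
  Real.exp (-(blockDim ι d / 2 * Real.log (2 * Real.pi * s)) - normSq x / (2 * s))

theorem normSq_eq_sum (x : ι → EuclideanSpace ℝ (Fin d)) :
    normSq x = ∑ i, ∑ k, x i k ^ 2 := by
  simp [normSq, EuclideanSpace.real_norm_sq_eq]

theorem normSq_nonneg (x : ι → EuclideanSpace ℝ (Fin d)) : 0 ≤ normSq x :=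
  Finset.sum_nonneg fun _ _ => sq_nonneg _

theorem normSq_smul (c : ℝ) (x : ι → EuclideanSpace ℝ (Fin d)) :
    normSq (c • x) = c ^ 2 * normSq x := by
  simp [normSq, norm_smul, mul_pow, Finset.mul_sum]

theorem normSq_add_le (x y : ι → EuclideanSpace ℝ (Fin d)) :
    normSq (x + y) ≤ 2 * normSq x + 2 * normSq y := by
  simp only [normSq_eq_sum, Finset.mul_sum, ← Finset.sum_add_distrib]
  refine Finset.sum_le_sum fun i _ => Finset.sum_le_sum fun k _ => ?_
  simp only [Pi.add_apply, PiLp.add_apply]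
  nlinarith [sq_nonneg (x i k - y i k)]

theorem normSq_neg (x : ι → EuclideanSpace ℝ (Fin d)) : normSq (-x) = normSq x := by
  simp [normSq]

theorem normSq_sub_le (x y : ι → EuclideanSpace ℝ (Fin d)) :
    normSq (x - y) ≤ 2 * normSq x + 2 * normSq y := by
  simpa [sub_eq_add_neg, normSq_neg] using normSq_add_le x (-y)

theorem sq_coord_le_normSq (x : ι → EuclideanSpace ℝ (Fin d)) (i : ι) (k : Fin d) :
    x i k ^ 2 ≤ normSq x := by
  rw [normSq_eq_sum]
  calc x i k ^ 2 ≤ ∑ k, x i k ^ 2 :=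
        Finset.single_le_sum (f := fun k => x i k ^ 2) (fun _ _ => sq_nonneg _) (Finset.mem_univ k)
    _ ≤ _ := Finset.single_le_sum (f := fun i => ∑ k, x i k ^ 2)
        (fun _ _ => Finset.sum_nonneg fun _ _ => sq_nonneg _) (Finset.mem_univ i)

theorem abs_coord_le (x : ι → EuclideanSpace ℝ (Fin d)) (i : ι) (k : Fin d) :
    |x i k| ≤ 1 + normSq x := by
  have h := sq_coord_le_normSq x i k
  rw [← sq_abs] at h
  nlinarith [sq_nonneg (|x i k| - 1), normSq_nonneg x]

theorem contDiff_normSq : ContDiff ℝ 1 (normSq : (ι → EuclideanSpace ℝ (Fin d)) → ℝ) := by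
  unfold normSq
  refine ContDiff.sum fun i _ => ?_
  exact (contDiff_apply ℝ (EuclideanSpace ℝ (Fin d)) i).norm_sq ℝ

theorem continuous_normSq : Continuous (normSq : (ι → EuclideanSpace ℝ (Fin d)) → ℝ) :=
  contDiff_normSq.continuous

@[fun_prop]
theorem measurable_normSq : Measurable (normSq : (ι → EuclideanSpace ℝ (Fin d)) → ℝ) :=
  continuous_normSq.measurable

theorem heatKernel_pos (s : ℝ) (x : ι → EuclideanSpace ℝ (Fin d)) : 0 < heatKernel s x :=
  Real.exp_pos _

theorem measurable_heatKernel_uncurry :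
    Measurable fun z : ℝ × (ι → EuclideanSpace ℝ (Fin d)) => heatKernel z.1 z.2 := by
  unfold heatKernel
  fun_prop

@[fun_prop]
theorem measurable_heatKernel (s : ℝ) :
    Measurable (heatKernel s : (ι → EuclideanSpace ℝ (Fin d)) → ℝ) := by
  unfold heatKernel
  fun_prop

theorem continuous_heatKernel (s : ℝ) :
    Continuous (heatKernel s : (ι → EuclideanSpace ℝ (Fin d)) → ℝ) := by
  unfold heatKernel
  have := continuous_normSq (ι := ι) (d := d)
  fun_prop

theorem log_heatKernel (s : ℝ) (x : ι → EuclideanSpace ℝ (Fin d)) :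
    Real.log (heatKernel s x) =
      -(blockDim ι d / 2 * Real.log (2 * Real.pi * s)) - normSq x / (2 * s) :=
  Real.log_exp _

/-- Gaussian scaling, with the Jacobian `c ^ blockDim` coming from the normalising constant. It
reduces integrals to variance 1 and later converts the heat flow into the Ornstein-Uhlenbeck flow.
-/
theorem heatKernel_smul {c s : ℝ} (hc : 0 < c) (hs : 0 < s)
    (x : ι → EuclideanSpace ℝ (Fin d)) :
    heatKernel (c ^ 2 * s) (c • x) = (c ^ blockDim ι d)⁻¹ * heatKernel s x := by
  have h : (c ^ blockDim ι d)⁻¹ = Real.exp (-(blockDim ι d * Real.log c)) := by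
    rw [Real.exp_neg, ← Real.log_pow, Real.exp_log (by positivity)]
  rw [h, heatKernel, heatKernel, ← Real.exp_add, normSq_smul,
    show 2 * Real.pi * (c ^ 2 * s) = c ^ 2 * (2 * Real.pi * s) by ring,
    Real.log_mul (by positivity) (by positivity), Real.log_pow]
  congr 1
  field_simp
  push_cast
  ring

/-- The standard Gaussian is the image of a product of one-dimensional Gaussians under `toLp`, which
preserves Lebesgue measure. -/
theorem stdGaussian_eq_withDensity :
    stdGaussian (EuclideanSpace ℝ (Fin d)) = volume.withDensity fun x =>
      ENNReal.ofReal (∏ k, gaussianPDFReal 0 1 (x k)) := by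
  rw [← map_pi_eq_stdGaussian]
  have h1 : gaussianReal 0 1 = volume.withDensity fun x => ENNReal.ofReal (gaussianPDFReal 0 1 x) :=
    gaussianReal_of_var_ne_zero 0 one_ne_zero
  rw [h1, pi_withDensity_ofReal (fun _ : Fin d => (volume : Measure ℝ))
    (fun _ => gaussianPDFReal 0 1) (fun _ => gaussianPDFReal_nonneg _ _)
    (fun _ => integrable_gaussianPDFReal _ _)]
  have h2 := map_withDensity_of_measurePreserving (MeasurableEquiv.toLp 2 (Fin d → ℝ))
    (PiLp.volume_preserving_toLp (Fin d)) fun x : Fin d → ℝ =>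
      ENNReal.ofReal (∏ k, gaussianPDFReal 0 1 (x k))
  exact h2

theorem integrable_prod_gaussianPDFReal :
    Integrable fun x : EuclideanSpace ℝ (Fin d) => ∏ k, gaussianPDFReal 0 1 (x k) := by
  have h := Integrable.fintype_prod (ι := Fin d) (μ := fun _ => (volume : Measure ℝ))
    (f := fun _ : Fin d => gaussianPDFReal 0 1) (fun _ => integrable_gaussianPDFReal _ _)
  exact ((PiLp.volume_preserving_ofLp (Fin d)).integrable_comp_emb
    (MeasurableEquiv.toLp 2 (Fin d → ℝ)).symm.measurableEmbedding).2 h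

theorem heatKernel_one_eq_prod (x : ι → EuclideanSpace ℝ (Fin d)) :
    heatKernel 1 x = ∏ i, ∏ k, gaussianPDFReal 0 1 (x i k) := by
  have h : ∀ z : ℝ, gaussianPDFReal 0 1 z =
      Real.exp (-(1 / 2 * Real.log (2 * Real.pi)) - z ^ 2 / 2) := fun z => by
    rw [sub_eq_add_neg, Real.exp_add, Real.exp_neg, show (1 : ℝ) / 2 * Real.log (2 * Real.pi)
      = Real.log (√(2 * Real.pi)) by rw [Real.log_sqrt (by positivity)]; ring,
      Real.exp_log (by positivity)]
    simp [gaussianPDFReal, neg_div]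
  simp only [h, ← Real.exp_sum, heatKernel, normSq_eq_sum, Finset.sum_sub_distrib,
    Finset.sum_const, Finset.card_univ, Fintype.card_fin, blockDim, Finset.sum_div]
  simp
  ring_nf

/-- The joint law of independent standard Gaussian vectors. -/
theorem pi_stdGaussian_eq_withDensity :
    Measure.pi (fun _ : ι => stdGaussian (EuclideanSpace ℝ (Fin d))) =
      volume.withDensity fun x => ENNReal.ofReal (heatKernel 1 x) := by
  rw [stdGaussian_eq_withDensity, pi_withDensity_ofReal
    (fun _ : ι => (volume : Measure (EuclideanSpace ℝ (Fin d))))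
    (fun _ x => ∏ k, gaussianPDFReal 0 1 (x k))
    (fun _ x => Finset.prod_nonneg fun _ _ => gaussianPDFReal_nonneg _ _ _)
    (fun _ => integrable_prod_gaussianPDFReal)]
  simp only [heatKernel_one_eq_prod]
  rfl

theorem finrank_block : Module.finrank ℝ (ι → EuclideanSpace ℝ (Fin d)) = blockDim ι d := by
  simp [Module.finrank_pi_fintype, blockDim]

theorem integrable_heatKernel_one :
    Integrable (heatKernel 1 : (ι → EuclideanSpace ℝ (Fin d)) → ℝ) := by
  have h := Integrable.fintype_prod (ι := ι)
    (μ := fun _ => (volume : Measure (EuclideanSpace ℝ (Fin d))))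
    (fun _ => integrable_prod_gaussianPDFReal)
  exact h.congr (ae_of_all _ fun x => (heatKernel_one_eq_prod x).symm)

theorem integral_heatKernel_one :
    ∫ x : ι → EuclideanSpace ℝ (Fin d), heatKernel 1 x = 1 := by
  have h : (Measure.pi (fun _ : ι => stdGaussian (EuclideanSpace ℝ (Fin d)))) Set.univ = 1 :=
    measure_univ
  rw [pi_stdGaussian_eq_withDensity, withDensity_apply _ MeasurableSet.univ, setLIntegral_univ,
    ← ofReal_integral_eq_lintegral_ofReal integrable_heatKernel_one
      (ae_of_all _ fun x => (heatKernel_pos _ _).le)] at h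
  simpa using h

theorem heatKernel_eq_smul {s : ℝ} (hs : 0 < s) :
    (heatKernel s : (ι → EuclideanSpace ℝ (Fin d)) → ℝ) =
      fun x => ((√s) ^ blockDim ι d)⁻¹ * heatKernel 1 ((√s)⁻¹ • x) := by
  ext x
  have h := heatKernel_smul (Real.sqrt_pos.2 hs) one_pos ((√s)⁻¹ • x)
  rw [← h, smul_smul, mul_inv_cancel₀ (Real.sqrt_pos.2 hs).ne', one_smul, Real.sq_sqrt hs.le,
    mul_one]

theorem integrable_heatKernel {s : ℝ} (hs : 0 < s) :
    Integrable (heatKernel s : (ι → EuclideanSpace ℝ (Fin d)) → ℝ) := by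
  rw [heatKernel_eq_smul hs]
  exact (integrable_heatKernel_one.comp_smul (inv_ne_zero (Real.sqrt_pos.2 hs).ne')).const_mul _

theorem integral_heatKernel {s : ℝ} (hs : 0 < s) :
    ∫ x : ι → EuclideanSpace ℝ (Fin d), heatKernel s x = 1 := by
  have h := Real.sqrt_pos.2 hs
  rw [heatKernel_eq_smul hs, integral_const_mul, Measure.integral_comp_inv_smul,
    integral_heatKernel_one, finrank_block]
  simp [abs_of_pos h, h.ne']

/-- The law of a scaled standard Gaussian vector. -/
theorem map_smul_pi_stdGaussian {c : ℝ} (hc : 0 < c) :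
    (Measure.pi (fun _ : ι => stdGaussian (EuclideanSpace ℝ (Fin d)))).map (fun x => c • x) =
      volume.withDensity fun x => ENNReal.ofReal (heatKernel (c ^ 2) x) := by
  rw [pi_stdGaussian_eq_withDensity]
  ext s hs
  have hm : Measurable fun x : ι → EuclideanSpace ℝ (Fin d) => c • x := by fun_prop
  have hc2 : 0 < c ^ 2 := by positivity
  rw [Measure.map_apply hm hs, withDensity_apply _ (hm hs), withDensity_apply _ hs,
    ← ofReal_integral_eq_lintegral_ofReal integrable_heatKernel_one.restrict
      (ae_of_all _ fun x => (heatKernel_pos _ _).le),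
    ← ofReal_integral_eq_lintegral_ofReal (integrable_heatKernel hc2).restrict
      (ae_of_all _ fun x => (heatKernel_pos _ _).le),
    ← integral_indicator (hm hs), ← integral_indicator hs]
  congr 1
  -- Written with indicators, the two integrals over sets become integrals over the whole space, to
  -- which the change of variables for homotheties applies.
  have h := Measure.integral_comp_smul (volume : Measure (ι → EuclideanSpace ℝ (Fin d)))
    (s.indicator (heatKernel (c ^ 2))) c
  rw [finrank_block, abs_of_pos (by positivity : 0 < (c ^ blockDim ι d)⁻¹), smul_eq_mul] at h
  have h3 : ∀ x : ι → EuclideanSpace ℝ (Fin d), s.indicator (heatKernel (c ^ 2)) (c • x) =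
      (c ^ blockDim ι d)⁻¹ * ((fun x => c • x) ⁻¹' s).indicator (heatKernel 1) x := fun x => by
    have := heatKernel_smul hc one_pos x
    rw [mul_one] at this
    by_cases hx : c • x ∈ s
    · rw [Set.indicator_of_mem hx, Set.indicator_of_mem (show x ∈ (fun x => c • x) ⁻¹' s from hx),
        this]
    · rw [Set.indicator_of_notMem hx,
        Set.indicator_of_notMem (show x ∉ (fun x => c • x) ⁻¹' s from hx), mul_zero]
  simp only [h3, integral_const_mul] at h
  exact mul_left_cancel₀ (by positivity) h

end Kernel

/-! ### Derivatives and bounds of the Gaussian kernel -/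

section KernelDerivatives

variable {ι : Type*} [Fintype ι] {d : ℕ}

/-- The derivative of `heatKernel s` in the `k`-th coordinate of the `i`-th block. -/
noncomputable def gradKernel (s : ℝ) (i : ι) (k : Fin d) (x : ι → EuclideanSpace ℝ (Fin d)) : ℝ :=
  -(x i k / s) * heatKernel s x

/-- The second derivative of `heatKernel s` in the `k`-th coordinate of the `i`-th block. -/
noncomputable def hessKernel (s : ℝ) (i : ι) (k : Fin d) (x : ι → EuclideanSpace ℝ (Fin d)) : ℝ :=
  (x i k ^ 2 / s ^ 2 - 1 / s) * heatKernel s x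

theorem measurable_gradKernel_uncurry (i : ι) (k : Fin d) :
    Measurable fun z : ℝ × (ι → EuclideanSpace ℝ (Fin d)) => gradKernel z.1 i k z.2 := by
  have := measurable_heatKernel_uncurry (ι := ι) (d := d)
  unfold gradKernel
  fun_prop

@[fun_prop]
theorem measurable_gradKernel (s : ℝ) (i : ι) (k : Fin d) :
    Measurable (gradKernel s i k) := by
  unfold gradKernel
  fun_prop

@[fun_prop]
theorem measurable_hessKernel (s : ℝ) (i : ι) (k : Fin d) :
    Measurable (hessKernel s i k) := by
  unfold hessKernel
  fun_prop

/-- Closed form of half the Laplacian of the kernel, to be matched with its derivative in the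
variance. -/
theorem sum_hessKernel {s : ℝ} (hs : s ≠ 0) (x : ι → EuclideanSpace ℝ (Fin d)) :
    (1 / 2 : ℝ) * ∑ i, ∑ k, hessKernel s i k x =
      heatKernel s x * (normSq x / (2 * s ^ 2) - blockDim ι d / (2 * s)) := by
  simp only [hessKernel, ← Finset.sum_mul, Finset.sum_sub_distrib, ← Finset.sum_div,
    ← normSq_eq_sum]
  simp [blockDim]
  field_simp

/-- The heat equation for the Gaussian kernel. -/
theorem hasDerivAt_heatKernel {s : ℝ} (hs : 0 < s) (x : ι → EuclideanSpace ℝ (Fin d)) :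
    HasDerivAt (fun s => heatKernel s x) ((1 / 2 : ℝ) * ∑ i, ∑ k, hessKernel s i k x) s := by
  rw [sum_hessKernel hs.ne']
  unfold heatKernel
  have h1 : HasDerivAt (fun s : ℝ => 2 * Real.pi * s) (2 * Real.pi) s := by
    simpa using (hasDerivAt_id s).const_mul (2 * Real.pi)
  have h2 := (h1.log (by positivity)).const_mul ((blockDim ι d : ℝ) / 2)
  have h3 : HasDerivAt (fun s : ℝ => 2 * s) 2 s := by simpa using (hasDerivAt_id s).const_mul 2
  have h4 := (h3.inv (by positivity)).const_mul (normSq x)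
  have h5 := (h2.neg.sub h4).exp
  refine h5.congr_deriv ?_
  simp only [Pi.sub_apply, Pi.neg_apply, Pi.inv_apply, div_eq_mul_inv]
  congr 1
  have := Real.pi_ne_zero
  field_simp
  ring

theorem contDiff_heatKernel (s : ℝ) :
    ContDiff ℝ 1 (heatKernel s : (ι → EuclideanSpace ℝ (Fin d)) → ℝ) := by
  unfold heatKernel
  exact (contDiff_const.sub (contDiff_normSq.div_const _)).exp

/-- Gaussian kernels with variance in a compact set, times polynomials, are bounded by a
Gaussian kernel. -/
theorem exists_heatKernel_bound (ι : Type*) [Fintype ι] (d : ℕ) {a b : ℝ} (ha : 0 < a) (hab : a ≤ b) :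
    ∃ C, 0 < C ∧ ∀ s ∈ Set.Icc a b, ∀ x : ι → EuclideanSpace ℝ (Fin d),
      (1 + normSq x) * heatKernel s x ≤ C * heatKernel (2 * b) x := by
  have hb : 0 < b := ha.trans_le hab
  set N : ℝ := blockDim ι d / 2
  have hN : 0 ≤ N := by positivity
  -- With u = |x|²/(4b) one has 1 + 4bu ≤ (1 + 4b)eᵘ, so the polynomial costs half of the decay
  -- exp(−|x|²/(2b)). What remains is exp(−|x|²/(4b)), the profile of variance 2b. The second factor
  -- compares the normalisations at variances a and 2b.
  refine ⟨(1 + 4 * b) * Real.exp (N * Real.log (2 * Real.pi * (2 * b)) - N * Real.log (2 * Real.pi * a)),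
    by positivity, fun s hs x => ?_⟩
  have hs0 : 0 < s := ha.trans_le hs.1
  have hq := normSq_nonneg x
  have h1 : 1 + normSq x ≤ (1 + 4 * b) * Real.exp (normSq x / (4 * b)) := by
    have h := Real.add_one_le_exp (normSq x / (4 * b))
    have h' : normSq x = 4 * b * (normSq x / (4 * b)) := by field_simp
    have h3 : 0 ≤ normSq x / (4 * b) := by positivity
    nlinarith
  have h2 : heatKernel s x ≤ Real.exp (-(N * Real.log (2 * Real.pi * a)) - normSq x / (2 * b)) := by
    refine Real.exp_le_exp.2 ?_
    have h3 : Real.log (2 * Real.pi * a) ≤ Real.log (2 * Real.pi * s) :=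
      Real.log_le_log (by positivity) (by gcongr; exact hs.1)
    have h4 : normSq x / (2 * b) ≤ normSq x / (2 * s) := by
      gcongr
      exact hs.2
    have := mul_le_mul_of_nonneg_left h3 hN
    change -(N * Real.log (2 * Real.pi * s)) - _ ≤ _
    linarith
  calc (1 + normSq x) * heatKernel s x
      ≤ ((1 + 4 * b) * Real.exp (normSq x / (4 * b))) *
        Real.exp (-(N * Real.log (2 * Real.pi * a)) - normSq x / (2 * b)) :=
        mul_le_mul h1 h2 (heatKernel_pos _ _).le (by positivity)
    _ = _ := by
        rw [heatKernel, mul_assoc, mul_assoc (1 + 4 * b), ← Real.exp_add, ← Real.exp_add]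
        congr 2
        change _ = _ + (-(N * _) - _)
        field_simp
        ring

theorem heatKernel_le_const {a s : ℝ} (ha : 0 < a) (has : a ≤ s)
    (x : ι → EuclideanSpace ℝ (Fin d)) :
    heatKernel s x ≤ Real.exp (-(blockDim ι d / 2 * Real.log (2 * Real.pi * a))) := by
  refine Real.exp_le_exp.2 ?_
  have h3 : Real.log (2 * Real.pi * a) ≤ Real.log (2 * Real.pi * s) :=
    Real.log_le_log (by positivity) (by gcongr)
  have h4 : 0 ≤ normSq x / (2 * s) := div_nonneg (normSq_nonneg x) (by linarith)
  have := mul_le_mul_of_nonneg_left h3 (by positivity : 0 ≤ (blockDim ι d : ℝ) / 2)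
  linarith

theorem abs_gradKernel_le {a s : ℝ} (ha : 0 < a) (has : a ≤ s) (i : ι) (k : Fin d)
    (x : ι → EuclideanSpace ℝ (Fin d)) :
    |gradKernel s i k x| ≤ 1 / a * ((1 + normSq x) * heatKernel s x) := by
  have hs : 0 < s := ha.trans_le has
  rw [gradKernel, abs_mul, abs_neg, abs_div, abs_of_pos hs, abs_of_pos (heatKernel_pos s x),
    ← mul_assoc]
  refine mul_le_mul_of_nonneg_right ?_ (heatKernel_pos s x).le
  have h := abs_coord_le x i k
  rw [div_eq_mul_one_div, mul_comm]
  exact mul_le_mul (one_div_le_one_div_of_le ha has) h (abs_nonneg _) (by positivity)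

theorem abs_hessKernel_le {a s : ℝ} (ha : 0 < a) (has : a ≤ s) (i : ι) (k : Fin d)
    (x : ι → EuclideanSpace ℝ (Fin d)) :
    |hessKernel s i k x| ≤ (1 / a ^ 2 + 1 / a) * ((1 + normSq x) * heatKernel s x) := by
  have hs : 0 < s := ha.trans_le has
  rw [hessKernel, abs_mul, abs_of_pos (heatKernel_pos s x), ← mul_assoc]
  refine mul_le_mul_of_nonneg_right ?_ (heatKernel_pos s x).le
  have h := sq_coord_le_normSq x i k
  have hq := normSq_nonneg x
  have h1 : 1 / s ≤ 1 / a := one_div_le_one_div_of_le ha has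
  have h2 : 1 / s ^ 2 ≤ 1 / a ^ 2 := one_div_le_one_div_of_le (by positivity) (by gcongr)
  have h3 : x i k ^ 2 / s ^ 2 ≤ normSq x * (1 / a ^ 2) := by
    rw [div_eq_mul_one_div]
    exact mul_le_mul h h2 (by positivity) hq
  have h4 : 0 ≤ x i k ^ 2 / s ^ 2 := by positivity
  have h5 : 0 < 1 / s := by positivity
  have h6 : 0 < 1 / a := by positivity
  have h7 : 0 < 1 / a ^ 2 := by positivity
  rw [abs_le]
  constructor <;> nlinarith [mul_nonneg hq h6.le, mul_nonneg hq h7.le]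

variable [DecidableEq ι]

/-- The unit vector in the direction of the `k`-th coordinate of the `i`-th block. -/
noncomputable def blockBasis {ι : Type*} [DecidableEq ι] {d : ℕ} (i : ι) (k : Fin d) : ι → EuclideanSpace ℝ (Fin d) :=
  Pi.single i (EuclideanSpace.single k 1)

theorem blockBasis_apply_self {ι : Type*} [DecidableEq ι] {d : ℕ} (i : ι) (k : Fin d) :
    (blockBasis i k : ι → EuclideanSpace ℝ (Fin d)) i k = 1 := by
  simp [blockBasis]

theorem blockBasis_apply {ι : Type*} [DecidableEq ι] {d : ℕ} (i j : ι) (k l : Fin d) :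
    (blockBasis i k : ι → EuclideanSpace ℝ (Fin d)) j l = if j = i ∧ l = k then 1 else 0 := by
  by_cases h : j = i
  · subst h
    simp [blockBasis]
  · simp [blockBasis, h]

theorem normSq_add_smul_blockBasis (x : ι → EuclideanSpace ℝ (Fin d)) (t : ℝ) (i : ι) (k : Fin d) :
    normSq (x + t • blockBasis i k) = normSq x + (2 * t * x i k + t ^ 2) := by
  simp only [normSq_eq_sum, Pi.add_apply, Pi.smul_apply, PiLp.add_apply, PiLp.smul_apply,
    blockBasis_apply, smul_eq_mul]
  have : ∀ j l, (x j l + t * if j = i ∧ l = k then 1 else 0) ^ 2 =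
      x j l ^ 2 + if j = i then (if l = k then 2 * t * x i k + t ^ 2 else 0) else 0 := by
    intro j l
    split_ifs with h1 h2 h3 h3
    · obtain ⟨rfl, rfl⟩ := h1; ring
    · tauto
    · tauto
    · tauto
    · ring
    · ring
  simp only [this, Finset.sum_add_distrib]
  simp

theorem hasLineDerivAt_heatKernel (s : ℝ) (x : ι → EuclideanSpace ℝ (Fin d)) (i : ι)
    (k : Fin d) :
    HasLineDerivAt ℝ (heatKernel s) (gradKernel s i k x) x (blockBasis i k) := by
  unfold HasLineDerivAt heatKernel
  simp only [normSq_add_smul_blockBasis]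
  have h1 : HasDerivAt (fun t : ℝ => normSq x + (2 * t * x i k + t ^ 2)) (2 * x i k) 0 := by
    have := ((((hasDerivAt_id (0 : ℝ)).const_mul 2).mul_const (x i k)).add
      ((hasDerivAt_id (0 : ℝ)).pow 2)).const_add (normSq x)
    simpa using this
  have h2 := ((h1.div_const (2 * s)).const_sub
    (-((blockDim ι d : ℝ) / 2 * Real.log (2 * Real.pi * s)))).exp
  refine h2.congr_deriv ?_
  simp only [gradKernel, heatKernel]
  rw [mul_comm]
  simp only [mul_zero, zero_mul, add_zero, ne_eq, OfNat.ofNat_ne_zero, not_false_eq_true, zero_pow,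
    mul_div_mul_left]

theorem hasLineDerivAt_gradKernel (s : ℝ) (x : ι → EuclideanSpace ℝ (Fin d)) (i : ι)
    (k : Fin d) :
    HasLineDerivAt ℝ (gradKernel s i k) (hessKernel s i k x) x (blockBasis i k) := by
  have h0 := hasLineDerivAt_heatKernel s x i k
  unfold HasLineDerivAt at h0 ⊢
  have h1 : HasDerivAt (fun t : ℝ => -((x + t • blockBasis i k) i k / s)) (-(1 / s)) 0 := by
    simp only [Pi.add_apply, Pi.smul_apply, PiLp.add_apply, PiLp.smul_apply,
      blockBasis_apply_self, smul_eq_mul, mul_one]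
    exact (((hasDerivAt_id (0 : ℝ)).const_add (x i k)).div_const s).neg
  refine (h1.mul h0).congr_deriv ?_
  simp only [gradKernel, hessKernel, zero_smul, add_zero]
  ring

end KernelDerivatives

/-! ### Coordinates of block vectors and block gradients -/

section Coordinates

/-- The `k`-th coordinate of the `i`-th block, as a continuous linear form. -/
noncomputable def coordCLM {ι : Type*} {d : ℕ} (i : ι) (k : Fin d) : (ι → EuclideanSpace ℝ (Fin d)) →L[ℝ] ℝ :=
  (EuclideanSpace.proj k).comp (ContinuousLinearMap.proj i)

@[simp]
theorem coordCLM_apply {ι : Type*} {d : ℕ} (i : ι) (k : Fin d) (x : ι → EuclideanSpace ℝ (Fin d)) :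
    coordCLM i k x = x i k := rfl

variable {ι : Type*} [Fintype ι] [DecidableEq ι] {d : ℕ}

theorem sum_coord_smul_blockBasis (x : ι → EuclideanSpace ℝ (Fin d)) :
    ∑ i, ∑ k, x i k • blockBasis i k = x := by
  ext j l
  simp only [Finset.sum_apply, WithLp.ofLp_sum, Pi.smul_apply, PiLp.smul_apply, blockBasis_apply,
    smul_eq_mul]
  simp [ite_and]

/-- A continuous linear form is determined by its values on the coordinate vectors. -/
theorem eq_sum_smul_coordCLM (L : (ι → EuclideanSpace ℝ (Fin d)) →L[ℝ] ℝ) :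
    L = ∑ i, ∑ k, L (blockBasis i k) • coordCLM i k := by
  ext x
  conv_lhs => rw [← sum_coord_smul_blockBasis x]
  simp only [map_sum, map_smul, smul_eq_mul, FunLike.coe_sum, Finset.sum_apply,
    coordCLM_apply, FunLike.coe_smul, Pi.smul_apply]
  exact Finset.sum_congr rfl fun i _ => Finset.sum_congr rfl fun k _ => mul_comm _ _

/-- Smoothness supplies some differential; its values on coordinate vectors are line derivatives,
which are already known. -/
theorem hasFDerivAt_heatKernel (s : ℝ) (x : ι → EuclideanSpace ℝ (Fin d)) :
    HasFDerivAt (heatKernel s) (∑ i, ∑ k, gradKernel s i k x • coordCLM i k) x := by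
  have h := ((contDiff_heatKernel s).differentiable one_ne_zero x).hasFDerivAt
  have h2 := eq_sum_smul_coordCLM (fderiv ℝ (heatKernel s) x)
  rw [h2] at h
  refine h.congr_fderiv (Finset.sum_congr rfl fun i _ => Finset.sum_congr rfl fun k _ => ?_)
  rw [((contDiff_heatKernel s).differentiable one_ne_zero x).hasFDerivAt.hasLineDerivAt
    (blockBasis i k) |>.unique (hasLineDerivAt_heatKernel s x i k)]

/-- The coordinates of the block gradients are the partial derivatives. -/
theorem blockGrad_apply {p : (ι → EuclideanSpace ℝ (Fin d)) → ℝ}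
    {x : ι → EuclideanSpace ℝ (Fin d)} {g : ι → Fin d → ℝ}
    (h : HasFDerivAt p (∑ i, ∑ k, g i k • coordCLM i k) x) (i : ι) (k : Fin d) :
    blockGrad p i x k = g i k := by
  -- A block gradient is the gradient of `p` composed with the affine map that replaces the block
  -- `i`; its differential is the restriction of that of `p` to this block.
  have h1 : HasFDerivAt (fun u => p (Function.update x i u))
      ((∑ i, ∑ k, g i k • coordCLM i k).comp (ContinuousLinearMap.pi
        (Pi.single i (ContinuousLinearMap.id ℝ (EuclideanSpace ℝ (Fin d)))))) (x i) := by
    refine HasFDerivAt.comp _ ?_ (hasFDerivAt_update x (x i))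
    rwa [Function.update_eq_self]
  have h2 := h1.hasGradientAt.gradient
  rw [blockGrad, h2]
  have h3 : ∀ v : EuclideanSpace ℝ (Fin d), v k = inner ℝ (EuclideanSpace.single k (1 : ℝ)) v := by
    intro v
    simp [EuclideanSpace.inner_single_left]
  rw [h3, real_inner_comm, InnerProductSpace.toDual_symm_apply]
  have h4 : (ContinuousLinearMap.pi (Pi.single i (ContinuousLinearMap.id ℝ
      (EuclideanSpace ℝ (Fin d))))) (EuclideanSpace.single k (1 : ℝ)) =
      (blockBasis i k : ι → EuclideanSpace ℝ (Fin d)) := by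
    ext j l
    by_cases hj : j = i
    · subst hj
      simp [blockBasis]
    · simp [blockBasis, hj]
  rw [ContinuousLinearMap.comp_apply, h4]
  simp [coordCLM_apply, blockBasis_apply, ite_and]

end Coordinates

/-! ### Bounds and integrals of finite linear combinations -/

section FiniteSums

variable {ι κ α F : Type*} [Fintype ι] [Fintype κ] [MeasurableSpace α] {μ : Measure α}
  [NormedAddCommGroup F] [NormedSpace ℝ F]

theorem norm_sum_sum_smul_le (f : ι → κ → ℝ) (L : ι → κ → F) {C : ℝ} (h : ∀ i k, |f i k| ≤ C) :
    ‖∑ i, ∑ k, f i k • L i k‖ ≤ ∑ i, ∑ k, C * ‖L i k‖ := by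
  refine (norm_sum_le _ _).trans (Finset.sum_le_sum fun i _ => (norm_sum_le _ _).trans
    (Finset.sum_le_sum fun k _ => ?_))
  rw [norm_smul]
  exact mul_le_mul_of_nonneg_right (h i k) (norm_nonneg _)

theorem integrable_sum_sum_smul (f : ι → κ → α → ℝ) (L : ι → κ → F)
    (h : ∀ i k, Integrable (f i k) μ) :
    Integrable (fun x => ∑ i, ∑ k, f i k x • L i k) μ :=
  integrable_finsetSum _ fun i _ => integrable_finsetSum _ fun k _ => (h i k).smul_const _

theorem integral_sum_sum_smul [CompleteSpace F] (f : ι → κ → α → ℝ) (L : ι → κ → F)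
    (h : ∀ i k, Integrable (f i k) μ) :
    ∫ x, ∑ i, ∑ k, f i k x • L i k ∂μ = ∑ i, ∑ k, (∫ x, f i k x ∂μ) • L i k := by
  rw [integral_finsetSum _ fun i _ => integrable_finsetSum _ fun k _ => (h i k).smul_const _]
  refine Finset.sum_congr rfl fun i _ => ?_
  rw [integral_finsetSum _ fun k _ => (h i k).smul_const _]
  exact Finset.sum_congr rfl fun k _ => integral_smul_const _ _

end FiniteSums

/-! ### Translation mixtures -/

section Mixture

variable {E : Type*} [NormedAddCommGroup E] [MeasurableSpace E] [BorelSpace E]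

theorem stronglyMeasurable_mixture [SecondCountableTopology E] (μ : Measure E)
    [IsProbabilityMeasure μ] {φ : E → ℝ} (hφ : Measurable φ) :
    StronglyMeasurable fun y => ∫ x, φ (y - x) ∂μ := by
  have h : Measurable fun z : E × E => φ (z.1 - z.2) := by fun_prop
  exact h.stronglyMeasurable.integral_prod_right

variable {μ : Measure E} [IsProbabilityMeasure μ]

theorem integrable_translate {φ : E → ℝ} (hφ : Measurable φ) {C : ℝ} (hC : ∀ z, |φ z| ≤ C)
    (y : E) : Integrable (fun x => φ (y - x)) μ := by
  have h : Measurable fun x => φ (y - x) := by fun_prop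
  exact Integrable.of_bound h.aestronglyMeasurable C (ae_of_all _ fun x => hC _)

theorem continuous_mixture {φ : E → ℝ} (hφ : Continuous φ) {C : ℝ} (hC : ∀ z, |φ z| ≤ C) :
    Continuous fun y => ∫ x, φ (y - x) ∂μ := by
  refine continuous_of_dominated (bound := fun _ => C) (fun y => ?_)
    (fun y => ae_of_all _ fun x => hC _) (integrable_const C) (ae_of_all _ fun x => ?_)
  · have h : Continuous fun x => φ (y - x) := by fun_prop
    exact h.aestronglyMeasurable
  · fun_prop

/-- Differentiation under the integral sign. Constants are admissible dominating functions because μ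
is a probability measure. -/
theorem hasLineDerivAt_mixture [NormedSpace ℝ E] {φ φ' : E → ℝ} {v : E} (hφ : Measurable φ) (hφ' : Measurable φ')
    {C C' : ℝ} (hC : ∀ z, |φ z| ≤ C) (hC' : ∀ z, |φ' z| ≤ C')
    (h : ∀ z, HasLineDerivAt ℝ φ (φ' z) z v) (y : E) :
    HasLineDerivAt ℝ (fun y => ∫ x, φ (y - x) ∂μ) (∫ x, φ' (y - x) ∂μ) y v := by
  have hm : ∀ (ψ : E → ℝ), Measurable ψ → ∀ t : ℝ,
      AEStronglyMeasurable (fun x => ψ (y + t • v - x)) μ := fun ψ hψ t => by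
    have : Measurable fun x => ψ (y + t • v - x) := by fun_prop
    exact this.aestronglyMeasurable
  have := (hasDerivAt_integral_of_dominated_loc_of_deriv_le (μ := μ) (x₀ := (0 : ℝ)) (s := Set.univ)
    (F := fun t x => φ (y + t • v - x)) (F' := fun t x => φ' (y + t • v - x)) (bound := fun _ => C')
    univ_mem (Eventually.of_forall fun t => hm φ hφ t)
    (integrable_translate hφ hC _) (hm φ' hφ' 0) (ae_of_all _ fun x t _ => hC' _)
    (integrable_const C') (ae_of_all _ fun x t _ => ?_)).2
  · simpa [HasLineDerivAt] using this
  -- The derivative at a parameter `t` is the line derivative at the shifted base point, taken at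
  -- the line parameter 0 = t − t.
  · have h1 : HasDerivAt (fun u : ℝ => φ ((y + t • v - x) + u • v)) (φ' (y + t • v - x)) (t - t) := by
      rw [sub_self]
      exact h (y + t • v - x)
    have h2 := h1.comp_sub_const t t
    refine h2.congr_of_eventuallyEq (Eventually.of_forall fun u => ?_)
    simp only
    congr 1
    rw [sub_smul]
    abel

end Mixture

/-! ### The heat flow of a probability measure -/

section HeatFlow

variable {ι : Type*} [Fintype ι] {d : ℕ} (μ : Measure (ι → EuclideanSpace ℝ (Fin d)))

/-- The density at time `s` of the heat flow started at `μ`. -/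
noncomputable def heatFlow (s : ℝ) (y : ι → EuclideanSpace ℝ (Fin d)) : ℝ :=
  ∫ x, heatKernel s (y - x) ∂μ

/-- The partial derivatives of the heat flow. -/
noncomputable def heatGrad (s : ℝ) (i : ι) (k : Fin d) (y : ι → EuclideanSpace ℝ (Fin d)) : ℝ :=
  ∫ x, gradKernel s i k (y - x) ∂μ

/-- The second partial derivatives of the heat flow. -/
noncomputable def heatHess (s : ℝ) (i : ι) (k : Fin d) (y : ι → EuclideanSpace ℝ (Fin d)) : ℝ :=
  ∫ x, hessKernel s i k (y - x) ∂μ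

/-- One Gaussian of variance 2b dominates the kernel and its derivatives for all variances in [a, b]
at once. This local uniformity in time is what differentiation in `s` needs. -/
theorem exists_kernel_bounds (ι : Type*) [Fintype ι] (d : ℕ) {a b : ℝ} (ha : 0 < a) (hab : a ≤ b) :
    ∃ C, 0 < C ∧ ∀ s ∈ Set.Icc a b, ∀ x : ι → EuclideanSpace ℝ (Fin d),
      (1 + normSq x) * heatKernel s x ≤ C * heatKernel (2 * b) x ∧
      heatKernel s x ≤ C * heatKernel (2 * b) x ∧
      (∀ i k, |gradKernel s i k x| ≤ C * heatKernel (2 * b) x) ∧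
      (∀ i k, |hessKernel s i k x| ≤ C * heatKernel (2 * b) x) := by
  obtain ⟨C, hC, h⟩ := exists_heatKernel_bound ι d ha hab
  have h1 : 0 < 1 / a := by positivity
  have h2 : 0 < 1 / a ^ 2 := by positivity
  refine ⟨(1 + 1 / a ^ 2 + 1 / a) * C, by positivity, fun s hs x => ?_⟩
  have hg := heatKernel_pos (2 * b) x
  have hx := h s hs x
  have hk := heatKernel_pos s x
  have hq := normSq_nonneg x
  have h3 : 0 ≤ (1 + normSq x) * heatKernel s x := by positivity
  have key : ∀ c, c ≤ 1 + 1 / a ^ 2 + 1 / a → c * ((1 + normSq x) * heatKernel s x) ≤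
      (1 + 1 / a ^ 2 + 1 / a) * C * heatKernel (2 * b) x := fun c hc => by
    rw [mul_assoc]
    exact mul_le_mul hc hx h3 (by positivity)
  refine ⟨?_, ?_, fun i k => (abs_gradKernel_le ha hs.1 i k x).trans (key _ (by linarith)),
    fun i k => (abs_hessKernel_le ha hs.1 i k x).trans (key _ (by linarith))⟩
  · simpa using key 1 (by linarith)
  · refine le_trans ?_ (key 1 (by linarith))
    nlinarith [mul_nonneg hq hk.le]

/-- The dominating Gaussian is bounded by its value at the origin. Constant bounds suffice when
integrating against a probability measure. -/
theorem exists_kernel_const_bounds (ι : Type*) [Fintype ι] (d : ℕ) {a b : ℝ} (ha : 0 < a)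
    (hab : a ≤ b) :
    ∃ C, 0 < C ∧ ∀ s ∈ Set.Icc a b, ∀ x : ι → EuclideanSpace ℝ (Fin d),
      |heatKernel s x| ≤ C ∧ (∀ i k, |gradKernel s i k x| ≤ C) ∧
      (∀ i k, |hessKernel s i k x| ≤ C) := by
  obtain ⟨C, hC, h⟩ := exists_kernel_bounds ι d ha hab
  have hb : 0 < b := ha.trans_le hab
  set D := Real.exp (-(blockDim ι d / 2 * Real.log (2 * Real.pi * (2 * b))))
  refine ⟨C * D, by positivity, fun s hs x => ?_⟩
  obtain ⟨-, h2, h3, h4⟩ := h s hs x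
  have hD : C * heatKernel (2 * b) x ≤ C * D :=
    mul_le_mul_of_nonneg_left (heatKernel_le_const (by positivity) le_rfl x) hC.le
  exact ⟨by rw [abs_of_pos (heatKernel_pos _ _)]; exact h2.trans hD,
    fun i k => (h3 i k).trans hD, fun i k => (h4 i k).trans hD⟩

theorem stronglyMeasurable_heatFlow [IsProbabilityMeasure μ] (s : ℝ) :
    StronglyMeasurable (heatFlow μ s) :=
  stronglyMeasurable_mixture μ (measurable_heatKernel s)

theorem stronglyMeasurable_heatGrad [IsProbabilityMeasure μ] (s : ℝ) (i : ι) (k : Fin d) :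
    StronglyMeasurable (heatGrad μ s i k) :=
  stronglyMeasurable_mixture μ (measurable_gradKernel s i k)

theorem stronglyMeasurable_heatHess [IsProbabilityMeasure μ] (s : ℝ) (i : ι) (k : Fin d) :
    StronglyMeasurable (heatHess μ s i k) :=
  stronglyMeasurable_mixture μ (measurable_hessKernel s i k)

/-- Joint measurability in time and space serves to make the Fisher information matrix measurable in
time. -/
theorem stronglyMeasurable_heatFlow_uncurry [IsProbabilityMeasure μ] :
    StronglyMeasurable fun z : ℝ × (ι → EuclideanSpace ℝ (Fin d)) => heatFlow μ z.1 z.2 := by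
  have h : Measurable fun w : (ℝ × (ι → EuclideanSpace ℝ (Fin d))) ×
      (ι → EuclideanSpace ℝ (Fin d)) => heatKernel w.1.1 (w.1.2 - w.2) :=
    measurable_heatKernel_uncurry.comp
      (f := fun w : (ℝ × (ι → EuclideanSpace ℝ (Fin d))) × (ι → EuclideanSpace ℝ (Fin d)) =>
        (w.1.1, w.1.2 - w.2)) (by fun_prop)
  exact h.stronglyMeasurable.integral_prod_right

theorem stronglyMeasurable_heatGrad_uncurry [IsProbabilityMeasure μ] (i : ι) (k : Fin d) :
    StronglyMeasurable fun z : ℝ × (ι → EuclideanSpace ℝ (Fin d)) => heatGrad μ z.1 i k z.2 := by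
  have h : Measurable fun w : (ℝ × (ι → EuclideanSpace ℝ (Fin d))) ×
      (ι → EuclideanSpace ℝ (Fin d)) => gradKernel w.1.1 i k (w.1.2 - w.2) :=
    (measurable_gradKernel_uncurry i k).comp
      (f := fun w : (ℝ × (ι → EuclideanSpace ℝ (Fin d))) × (ι → EuclideanSpace ℝ (Fin d)) =>
        (w.1.1, w.1.2 - w.2)) (by fun_prop)
  exact h.stronglyMeasurable.integral_prod_right

variable {μ} [IsProbabilityMeasure μ]

theorem integrable_heatKernel_translate {s : ℝ} (hs : 0 < s) (y : ι → EuclideanSpace ℝ (Fin d)) :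
    Integrable (fun x => heatKernel s (y - x)) μ := by
  obtain ⟨C, -, h⟩ := exists_kernel_const_bounds ι d hs le_rfl
  exact integrable_translate (measurable_heatKernel s) (fun z => (h s ⟨le_rfl, le_rfl⟩ z).1) y

theorem integrable_gradKernel_translate {s : ℝ} (hs : 0 < s) (i : ι) (k : Fin d)
    (y : ι → EuclideanSpace ℝ (Fin d)) :
    Integrable (fun x => gradKernel s i k (y - x)) μ := by
  obtain ⟨C, -, h⟩ := exists_kernel_const_bounds ι d hs le_rfl
  exact integrable_translate (measurable_gradKernel s i k)
    (fun z => (h s ⟨le_rfl, le_rfl⟩ z).2.1 i k) y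

theorem integrable_hessKernel_translate {s : ℝ} (hs : 0 < s) (i : ι) (k : Fin d)
    (y : ι → EuclideanSpace ℝ (Fin d)) :
    Integrable (fun x => hessKernel s i k (y - x)) μ := by
  obtain ⟨C, -, h⟩ := exists_kernel_const_bounds ι d hs le_rfl
  exact integrable_translate (measurable_hessKernel s i k)
    (fun z => (h s ⟨le_rfl, le_rfl⟩ z).2.2 i k) y

theorem heatFlow_pos {s : ℝ} (hs : 0 < s) (y : ι → EuclideanSpace ℝ (Fin d)) :
    0 < heatFlow μ s y :=
  integral_exp_pos (integrable_heatKernel_translate hs y)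

theorem heatFlow_le_const {a s : ℝ} (ha : 0 < a) (has : a ≤ s)
    (y : ι → EuclideanSpace ℝ (Fin d)) :
    heatFlow μ s y ≤ Real.exp (-(blockDim ι d / 2 * Real.log (2 * Real.pi * a))) := by
  calc heatFlow μ s y ≤ ∫ _x, Real.exp (-(blockDim ι d / 2 * Real.log (2 * Real.pi * a))) ∂μ :=
        integral_mono (integrable_heatKernel_translate (ha.trans_le has) y) (integrable_const _)
          fun x => heatKernel_le_const ha has _
    _ = _ := by simp

/-- Domination of the heat flow and its derivatives, locally uniformly in time. -/
theorem exists_heatFlow_bounds (μ : Measure (ι → EuclideanSpace ℝ (Fin d)))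
    [IsProbabilityMeasure μ] {a b : ℝ} (ha : 0 < a) (hab : a ≤ b) :
    ∃ C, 0 < C ∧ ∀ s ∈ Set.Icc a b, ∀ y,
      heatFlow μ s y ≤ C * heatFlow μ (2 * b) y ∧
      (∀ i k, |heatGrad μ s i k y| ≤ C * heatFlow μ (2 * b) y) ∧
      (∀ i k, |heatHess μ s i k y| ≤ C * heatFlow μ (2 * b) y) := by
  obtain ⟨C, hC, h⟩ := exists_kernel_bounds ι d ha hab
  refine ⟨C, hC, fun s hs y => ?_⟩
  have hb : 0 < 2 * b := by linarith [ha.trans_le hab]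
  have hi : Integrable (fun x => C * heatKernel (2 * b) (y - x)) μ :=
    (integrable_heatKernel_translate hb y).const_mul C
  have key : ∀ φ : (ι → EuclideanSpace ℝ (Fin d)) → ℝ,
      (∀ z, |φ z| ≤ C * heatKernel (2 * b) z) →
      |∫ x, φ (y - x) ∂μ| ≤ C * heatFlow μ (2 * b) y := fun φ hφ => by
    rw [heatFlow, ← integral_const_mul]
    exact norm_integral_le_of_norm_le (f := fun x => φ (y - x)) hi (ae_of_all _ fun x => hφ (y - x))
  exact ⟨(le_abs_self _).trans (key (heatKernel s) fun z => by
      rw [abs_of_pos (heatKernel_pos _ _)]; exact (h s hs z).2.1),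
    fun i k => key _ fun z => (h s hs z).2.2.1 i k, fun i k => key _ fun z => (h s hs z).2.2.2 i k⟩

/-- The heat equation. -/
theorem hasDerivAt_heatFlow {s : ℝ} (hs : 0 < s) (y : ι → EuclideanSpace ℝ (Fin d)) :
    HasDerivAt (fun s => heatFlow μ s y) ((1 / 2 : ℝ) * ∑ i, ∑ k, heatHess μ s i k y) s := by
  obtain ⟨C, hC, h⟩ := exists_kernel_const_bounds ι d (half_pos hs) (by linarith : s / 2 ≤ 2 * s)
  have hm : ∀ r, AEStronglyMeasurable (fun x => heatKernel r (y - x)) μ := fun r => by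
    have : Measurable fun x => heatKernel r (y - x) := by fun_prop
    exact this.aestronglyMeasurable
  have hm' : AEStronglyMeasurable
      (fun x => (1 / 2 : ℝ) * ∑ i, ∑ k, hessKernel s i k (y - x)) μ := by
    have : Measurable fun x => (1 / 2 : ℝ) * ∑ i, ∑ k, hessKernel s i k (y - x) := by fun_prop
    exact this.aestronglyMeasurable
  have h1 := (hasDerivAt_integral_of_dominated_loc_of_deriv_le (μ := μ) (x₀ := s)
    (s := Set.Icc (s / 2) (2 * s))
    (F := fun r x => heatKernel r (y - x))
    (F' := fun r x => (1 / 2 : ℝ) * ∑ i, ∑ k, hessKernel r i k (y - x))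
    (bound := fun _ => (1 / 2 : ℝ) * ∑ _i : ι, ∑ _k : Fin d, C)
    (Icc_mem_nhds (by linarith) (by linarith)) (Eventually.of_forall hm)
    (integrable_heatKernel_translate hs y) hm' (ae_of_all _ fun x r hr => ?_)
    (integrable_const _) (ae_of_all _ fun x r hr => ?_)).2
  · refine h1.congr_deriv ?_
    rw [integral_const_mul, integral_finsetSum _ fun i _ =>
      integrable_finsetSum _ fun k _ => integrable_hessKernel_translate hs i k y]
    congr 1
    refine Finset.sum_congr rfl fun i _ => ?_
    rw [integral_finsetSum _ fun k _ => integrable_hessKernel_translate hs i k y]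
    rfl
  · rw [norm_mul, Real.norm_of_nonneg (by norm_num)]
    gcongr
    refine (norm_sum_le _ _).trans (Finset.sum_le_sum fun i _ => (norm_sum_le _ _).trans
      (Finset.sum_le_sum fun k _ => (h r hr _).2.2 i k))
  · exact hasDerivAt_heatKernel ((half_pos hs).trans_le hr.1) _

theorem integral_gradKernel_smul_coordCLM {s : ℝ} (hs : 0 < s) (y : ι → EuclideanSpace ℝ (Fin d)) :
    ∫ x, ∑ i, ∑ k, gradKernel s i k (y - x) • (coordCLM i k :
      (ι → EuclideanSpace ℝ (Fin d)) →L[ℝ] ℝ) ∂μ =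
      ∑ i, ∑ k, heatGrad μ s i k y • coordCLM i k :=
  integral_sum_sum_smul (fun i k x => gradKernel s i k (y - x)) _ fun i k =>
    integrable_gradKernel_translate hs i k y

variable [DecidableEq ι]

theorem hasLineDerivAt_heatFlow {s : ℝ} (hs : 0 < s) (y : ι → EuclideanSpace ℝ (Fin d)) (i : ι)
    (k : Fin d) :
    HasLineDerivAt ℝ (heatFlow μ s) (heatGrad μ s i k y) y (blockBasis i k) := by
  obtain ⟨C, -, h⟩ := exists_kernel_const_bounds ι d hs le_rfl
  exact hasLineDerivAt_mixture (measurable_heatKernel s) (measurable_gradKernel s i k)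
    (fun z => (h s ⟨le_rfl, le_rfl⟩ z).1) (fun z => (h s ⟨le_rfl, le_rfl⟩ z).2.1 i k)
    (fun z => hasLineDerivAt_heatKernel s z i k) y

theorem hasLineDerivAt_heatGrad {s : ℝ} (hs : 0 < s) (y : ι → EuclideanSpace ℝ (Fin d)) (i : ι)
    (k : Fin d) :
    HasLineDerivAt ℝ (heatGrad μ s i k) (heatHess μ s i k y) y (blockBasis i k) := by
  obtain ⟨C, -, h⟩ := exists_kernel_const_bounds ι d hs le_rfl
  exact hasLineDerivAt_mixture (measurable_gradKernel s i k) (measurable_hessKernel s i k)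
    (fun z => (h s ⟨le_rfl, le_rfl⟩ z).2.1 i k) (fun z => (h s ⟨le_rfl, le_rfl⟩ z).2.2 i k)
    (fun z => hasLineDerivAt_gradKernel s z i k) y

theorem hasFDerivAt_heatKernel_translate (s : ℝ) (x y : ι → EuclideanSpace ℝ (Fin d)) :
    HasFDerivAt (fun y => heatKernel s (y - x))
      (∑ i, ∑ k, gradKernel s i k (y - x) • coordCLM i k) y := by
  have := (hasFDerivAt_heatKernel s (y - x)).comp y ((hasFDerivAt_id y).sub_const x)
  rw [ContinuousLinearMap.comp_id] at this
  exact this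

theorem hasFDerivAt_heatFlow {s : ℝ} (hs : 0 < s) (y : ι → EuclideanSpace ℝ (Fin d)) :
    HasFDerivAt (heatFlow μ s) (∑ i, ∑ k, heatGrad μ s i k y • coordCLM i k) y := by
  obtain ⟨C, hC, h⟩ := exists_kernel_const_bounds ι d hs le_rfl
  have hm : ∀ r, AEStronglyMeasurable (fun x => heatKernel s (r - x)) μ := fun r => by
    have : Measurable fun x => heatKernel s (r - x) := by fun_prop
    exact this.aestronglyMeasurable
  rw [← integral_gradKernel_smul_coordCLM hs]
  refine hasFDerivAt_integral_of_dominated_of_fderiv_le (𝕜 := ℝ) (μ := μ) (x₀ := y)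
    (s := Set.univ) (F := fun y x => heatKernel s (y - x))
    (F' := fun y x => ∑ i, ∑ k, gradKernel s i k (y - x) • coordCLM i k)
    (bound := fun _ => ∑ i : ι, ∑ k : Fin d,
      C * ‖(coordCLM i k : (ι → EuclideanSpace ℝ (Fin d)) →L[ℝ] ℝ)‖)
    univ_mem (Eventually.of_forall hm)
    (integrable_heatKernel_translate hs y) ?_ (ae_of_all _ fun x r hr => ?_) (integrable_const _)
    (ae_of_all _ fun x r hr => hasFDerivAt_heatKernel_translate s x r)
  · exact (integrable_sum_sum_smul (fun i k x => gradKernel s i k (y - x)) _ fun i k =>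
      integrable_gradKernel_translate hs i k y).1
  · exact norm_sum_sum_smul_le (fun i k => gradKernel s i k (r - x)) _
      fun i k => (h s ⟨le_rfl, le_rfl⟩ _).2.1 i k

theorem contDiff_heatFlow {s : ℝ} (hs : 0 < s) : ContDiff ℝ 1 (heatFlow μ s) := by
  obtain ⟨C, hC, h⟩ := exists_kernel_const_bounds ι d hs le_rfl
  rw [contDiff_one_iff_fderiv]
  refine ⟨fun y => (hasFDerivAt_heatFlow hs y).differentiableAt, ?_⟩
  rw [funext fun y => (hasFDerivAt_heatFlow (μ := μ) hs y).fderiv]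
  have hc : ∀ i k, Continuous (heatGrad μ s i k) := fun i k => by
    refine continuous_mixture (C := C) ?_ fun z => (h s ⟨le_rfl, le_rfl⟩ z).2.1 i k
    unfold gradKernel
    have := continuous_heatKernel (ι := ι) (d := d) s
    fun_prop
  fun_prop

end HeatFlow

/-! ### Integrability along the heat flow -/

section Integrability

variable {ι : Type*} [Fintype ι] {d : ℕ} {μ : Measure (ι → EuclideanSpace ℝ (Fin d))}
  [IsProbabilityMeasure μ]

/-- By translation invariance, (x, z) ↦ (x, x + z) preserves the product of μ with Lebesgue measure.
This decouples the starting point from the increment in mixtures. -/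
theorem integrable_prod_shear {f : (ι → EuclideanSpace ℝ (Fin d)) × (ι → EuclideanSpace ℝ (Fin d)) → ℝ} :
    Integrable (fun z => f (z.1, z.1 + z.2)) (μ.prod volume) ↔ Integrable f (μ.prod volume) :=
  (measurePreserving_prod_add μ volume).integrable_comp_emb
    (MeasurableEquiv.shearAddRight (ι → EuclideanSpace ℝ (Fin d))).measurableEmbedding

theorem integral_prod_shear (f : (ι → EuclideanSpace ℝ (Fin d)) × (ι → EuclideanSpace ℝ (Fin d)) → ℝ) :
    ∫ z, f (z.1, z.1 + z.2) ∂(μ.prod volume) = ∫ z, f z ∂(μ.prod volume) :=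
  (measurePreserving_prod_add μ volume).integral_comp
    (MeasurableEquiv.shearAddRight (ι → EuclideanSpace ℝ (Fin d))).measurableEmbedding f

theorem integrable_prod_translate {ψ : (ι → EuclideanSpace ℝ (Fin d)) → ℝ} (hψ : Integrable ψ) :
    Integrable (fun z : (ι → EuclideanSpace ℝ (Fin d)) × (ι → EuclideanSpace ℝ (Fin d)) =>
      ψ (z.2 - z.1)) (μ.prod volume) := by
  rw [← integrable_prod_shear]
  simpa using hψ.comp_snd μ

theorem integral_mixture {ψ : (ι → EuclideanSpace ℝ (Fin d)) → ℝ} (hψ : Integrable ψ) :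
    ∫ y, ∫ x, ψ (y - x) ∂μ = ∫ z, ψ z := by
  have h := integrable_prod_translate (μ := μ) hψ
  rw [← integral_prod_symm _ h, integral_prod _ h]
  simp [integral_sub_right_eq_self]

theorem integrable_mixture {ψ : (ι → EuclideanSpace ℝ (Fin d)) → ℝ} (hψ : Integrable ψ) :
    Integrable fun y => ∫ x, ψ (y - x) ∂μ :=
  (integrable_prod_translate (μ := μ) hψ).integral_prod_right

theorem integrable_heatFlow {s : ℝ} (hs : 0 < s) : Integrable (heatFlow μ s) :=
  integrable_mixture (integrable_heatKernel hs)

theorem integral_heatFlow {s : ℝ} (hs : 0 < s) : ∫ y, heatFlow μ s y = 1 := by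
  rw [← integral_heatKernel (ι := ι) (d := d) hs]
  exact integral_mixture (integrable_heatKernel hs)

theorem integrable_moment_heatKernel {s : ℝ} (hs : 0 < s) :
    Integrable fun x : ι → EuclideanSpace ℝ (Fin d) => (1 + normSq x) * heatKernel s x := by
  obtain ⟨C, -, h⟩ := exists_kernel_bounds ι d hs le_rfl
  have hm : Measurable fun x : ι → EuclideanSpace ℝ (Fin d) => (1 + normSq x) * heatKernel s x := by
    fun_prop
  refine ((integrable_heatKernel (by positivity : 0 < 2 * s)).const_mul C).mono'
    hm.aestronglyMeasurable (ae_of_all _ fun x => ?_)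
  have := heatKernel_pos s x
  have := normSq_nonneg x
  rw [Real.norm_of_nonneg (by positivity)]
  exact (h s ⟨le_rfl, le_rfl⟩ x).1

/-- After the shear y = x + z, the weight 1 + |x + z|² is at most 2(1 + |x|²)(1 + |z|²), and the
majorant factorises. -/
theorem integrable_prod_moment_heatKernel {s : ℝ} (hs : 0 < s) (hμ : Integrable normSq μ) :
    Integrable (fun z : (ι → EuclideanSpace ℝ (Fin d)) × (ι → EuclideanSpace ℝ (Fin d)) =>
      (1 + normSq z.2) * heatKernel s (z.2 - z.1)) (μ.prod volume) := by
  rw [← integrable_prod_shear]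
  have h : Integrable (fun z : (ι → EuclideanSpace ℝ (Fin d)) × (ι → EuclideanSpace ℝ (Fin d)) =>
      (2 * (1 + normSq z.1)) * ((1 + normSq z.2) * heatKernel s z.2)) (μ.prod volume) :=
    (((integrable_const (1 : ℝ)).add hμ).const_mul 2).mul_prod (integrable_moment_heatKernel hs)
  have hm : Measurable fun z : (ι → EuclideanSpace ℝ (Fin d)) × (ι → EuclideanSpace ℝ (Fin d)) =>
      (1 + normSq (z.1 + z.2)) * heatKernel s (z.1 + z.2 - z.1) := by fun_prop
  refine h.mono' hm.aestronglyMeasurable (ae_of_all _ fun z => ?_)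
  have h1 := heatKernel_pos s z.2
  have h2 := normSq_nonneg z.1
  have h3 := normSq_nonneg z.2
  have h4 := normSq_nonneg (z.1 + z.2)
  rw [add_sub_cancel_left, Real.norm_of_nonneg (by positivity), ← mul_assoc]
  refine mul_le_mul_of_nonneg_right ?_ h1.le
  nlinarith [normSq_add_le z.1 z.2, mul_nonneg h2 h3]

theorem integrable_moment_heatFlow {s : ℝ} (hs : 0 < s) (hμ : Integrable normSq μ) :
    Integrable fun y => (1 + normSq y) * heatFlow μ s y := by
  have h := (integrable_prod_moment_heatKernel hs hμ).integral_prod_right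
  simp only [integral_const_mul] at h
  exact h

/-- Quadratic bounds for the logarithm of the heat flow. -/
theorem exists_log_heatFlow_bound {a b : ℝ} (ha : 0 < a) (hμ : Integrable normSq μ) :
    ∃ C, 0 < C ∧ ∀ s ∈ Set.Icc a b, ∀ y, |Real.log (heatFlow μ s y)| ≤ C * (1 + normSq y) := by
  obtain ⟨m, hm_def⟩ : ∃ m, m = ∫ x, normSq x ∂μ := ⟨_, rfl⟩
  have hm : 0 ≤ m := hm_def ▸ integral_nonneg fun x => normSq_nonneg x
  obtain ⟨N, hN_def⟩ : ∃ N : ℝ, N = blockDim ι d / 2 := ⟨_, rfl⟩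
  have hN : 0 ≤ N := by rw [hN_def]; positivity
  obtain ⟨A, hA_def⟩ : ∃ A, A = |N * Real.log (2 * Real.pi * a)| := ⟨_, rfl⟩
  obtain ⟨B, hB_def⟩ : ∃ B, B = |N * Real.log (2 * Real.pi * b)| := ⟨_, rfl⟩
  have hA : 0 ≤ A := hA_def ▸ abs_nonneg _
  have hB : 0 ≤ B := hB_def ▸ abs_nonneg _
  refine ⟨A + B + m / a + 1 / a, by positivity, fun s hs y => ?_⟩
  have hs0 : 0 < s := ha.trans_le hs.1
  have hF := heatFlow_pos (μ := μ) hs0 y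
  have hq := normSq_nonneg y
  have hma : 0 ≤ m / a := by positivity
  have ha1 : 0 < 1 / a := by positivity
  have hrhs : A + B + m / a + normSq y / a ≤ (A + B + m / a + 1 / a) * (1 + normSq y) := by
    have : normSq y / a = 1 / a * normSq y := by ring
    nlinarith [mul_nonneg (by positivity : 0 ≤ A + B + m / a) hq]
  refine le_trans (abs_le.2 ⟨?_, ?_⟩) hrhs
  · have hi : Integrable (fun x => -(N * Real.log (2 * Real.pi * s)) - normSq (y - x) / (2 * s)) μ := by
      refine (integrable_const _).sub (Integrable.div_const ?_ _)
      have hmeas : Measurable fun x => normSq (y - x) := by fun_prop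
      refine (((integrable_const (2 * normSq y)).add (hμ.const_mul 2))).mono'
        hmeas.aestronglyMeasurable (ae_of_all _ fun x => ?_)
      rw [Real.norm_of_nonneg (normSq_nonneg _)]
      exact normSq_sub_le y x
    -- Jensen's inequality for `exp`: the average of the kernel is at least the exponential of the
    -- averaged logarithm, which the second moment of μ makes finite and quadratic in y.
    have hj : Real.exp (∫ x, (-(N * Real.log (2 * Real.pi * s)) - normSq (y - x) / (2 * s)) ∂μ) ≤
        heatFlow μ s y := by
      have hi' := hi
      rw [hN_def] at hi' ⊢
      exact convexOn_exp.map_integral_le Real.continuous_exp.continuousOn isClosed_univ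
        (ae_of_all _ fun _ => Set.mem_univ _) hi' (integrable_heatKernel_translate hs0 y)
    have hlow : ∫ _x, (-(N * Real.log (2 * Real.pi * b)) - normSq y / a) ∂μ - m / a ≤
        ∫ x, (-(N * Real.log (2 * Real.pi * s)) - normSq (y - x) / (2 * s)) ∂μ := by
      rw [hm_def, ← integral_div, ← integral_sub (integrable_const _) (hμ.div_const _)]
      refine integral_mono ((integrable_const _).sub (hμ.div_const _)) hi fun x => ?_
      have h3 : Real.log (2 * Real.pi * s) ≤ Real.log (2 * Real.pi * b) :=
        Real.log_le_log (by positivity) (by gcongr; exact hs.2)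
      have h4 : normSq (y - x) / (2 * s) ≤ (normSq y + normSq x) / a := by
        rw [div_le_div_iff₀ (by positivity) ha]
        have h5 := normSq_sub_le y x
        have h6 := normSq_nonneg x
        nlinarith [mul_le_mul_of_nonneg_left hs.1 (add_nonneg hq h6), mul_le_mul_of_nonneg_right h5 ha.le]
      have := mul_le_mul_of_nonneg_left h3 hN
      simp only [add_div] at h4
      simp only
      linarith
    have hlog := Real.log_le_log (Real.exp_pos _) hj
    rw [Real.log_exp] at hlog
    simp only [integral_const, probReal_univ, one_smul] at hlow
    have := neg_abs_le (-(N * Real.log (2 * Real.pi * b)))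
    rw [abs_neg, ← hB_def] at this
    linarith
  -- The upper bound needs no moments: the flow never exceeds the maximum of the kernel of variance
  -- a.
  · have h1 := Real.log_le_log hF (heatFlow_le_const ha hs.1 y)
    rw [Real.log_exp] at h1
    have := neg_le_abs (N * Real.log (2 * Real.pi * a))
    rw [← hA_def] at this
    have : 0 ≤ normSq y / a := by positivity
    rw [← hN_def] at h1
    linarith

theorem integrable_of_le_heatFlow {f : (ι → EuclideanSpace ℝ (Fin d)) → ℝ}
    (hf : AEStronglyMeasurable f) {b C : ℝ} (hb : 0 < b) (h : ∀ y, |f y| ≤ C * heatFlow μ b y) :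
    Integrable f :=
  ((integrable_heatFlow hb).const_mul C).mono' hf (ae_of_all _ h)

/-- The logarithm of the flow grows at most quadratically, and the flow at time b has a finite
second moment. -/
theorem integrable_mul_log_heatFlow {f : (ι → EuclideanSpace ℝ (Fin d)) → ℝ}
    (hf : AEStronglyMeasurable f) {b C s : ℝ} (hb : 0 < b) (h : ∀ y, |f y| ≤ C * heatFlow μ b y)
    (hμ : Integrable normSq μ) (hs : 0 < s) :
    Integrable fun y => f y * Real.log (heatFlow μ s y) := by
  obtain ⟨D, hD, hlog⟩ := exists_log_heatFlow_bound (b := s) hs hμ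
  have hm : AEStronglyMeasurable fun y => Real.log (heatFlow μ s y) :=
    (Real.measurable_log.comp (stronglyMeasurable_heatFlow μ s).measurable).aestronglyMeasurable
  refine ((integrable_moment_heatFlow hb hμ).const_mul (C * D)).mono' (hf.mul hm)
    (ae_of_all _ fun y => ?_)
  rw [norm_mul]
  calc _ ≤ (C * heatFlow μ b y) * (D * (1 + normSq y)) :=
        mul_le_mul (h y) (hlog s ⟨le_rfl, le_rfl⟩ y) (abs_nonneg _) ((abs_nonneg _).trans (h y))
    _ = _ := by ring

theorem integrable_heatFlow_mul_log {s : ℝ} (hs : 0 < s) (hμ : Integrable normSq μ) :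
    Integrable fun y => heatFlow μ s y * Real.log (heatFlow μ s y) :=
  integrable_mul_log_heatFlow (stronglyMeasurable_heatFlow μ s).aestronglyMeasurable (C := 1) hs
    (fun y => by rw [abs_of_pos (heatFlow_pos hs y), one_mul]) hμ hs

theorem integrable_heatHess {s : ℝ} (hs : 0 < s) (i : ι) (k : Fin d) :
    Integrable (heatHess μ s i k) := by
  obtain ⟨C, -, h⟩ := exists_heatFlow_bounds μ hs le_rfl
  exact integrable_of_le_heatFlow (stronglyMeasurable_heatHess μ s i k).aestronglyMeasurable
    (by positivity : 0 < 2 * s) fun y => (h s ⟨le_rfl, le_rfl⟩ y).2.2 i k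

/-- The logarithm of the heat flow is semiconvex. -/
theorem sq_heatGrad_div_le {s : ℝ} (hs : 0 < s) (i : ι) (k : Fin d)
    (y : ι → EuclideanSpace ℝ (Fin d)) :
    heatGrad μ s i k y ^ 2 / heatFlow μ s y ≤ heatHess μ s i k y + heatFlow μ s y / s := by
  set c := heatGrad μ s i k y / heatFlow μ s y with hc
  have hF := heatFlow_pos (μ := μ) hs y
  -- The kernel score −(y − x)/s has mean c under the weights proportional to the kernel. Expanding
  -- its nonnegative variance gives the claim.
  have h0 : 0 ≤ ∫ x, (-((y - x) i k / s) - c) ^ 2 * heatKernel s (y - x) ∂μ :=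
    integral_nonneg fun x => mul_nonneg (sq_nonneg _) (heatKernel_pos _ _).le
  have h1 : ∀ x : ι → EuclideanSpace ℝ (Fin d),
      (-((y - x) i k / s) - c) ^ 2 * heatKernel s (y - x) =
      hessKernel s i k (y - x) + 1 / s * heatKernel s (y - x) - 2 * c * gradKernel s i k (y - x)
        + c ^ 2 * heatKernel s (y - x) := fun x => by
    rw [hessKernel, gradKernel]
    ring
  have iK := integrable_heatKernel_translate (μ := μ) hs y
  have iG := integrable_gradKernel_translate (μ := μ) hs i k y
  have iH := integrable_hessKernel_translate (μ := μ) hs i k y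
  have i1 : Integrable (fun x => hessKernel s i k (y - x) + 1 / s * heatKernel s (y - x)) μ :=
    iH.add (iK.const_mul _)
  have i2 : Integrable (fun x => hessKernel s i k (y - x) + 1 / s * heatKernel s (y - x) -
      2 * c * gradKernel s i k (y - x)) μ := i1.sub (iG.const_mul _)
  simp only [h1] at h0
  rw [integral_add i2 (iK.const_mul _), integral_sub i1 (iG.const_mul _),
    integral_add iH (iK.const_mul _)] at h0
  simp only [integral_const_mul] at h0
  change 0 ≤ heatHess μ s i k y + 1 / s * heatFlow μ s y - 2 * c * heatGrad μ s i k y +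
    c ^ 2 * heatFlow μ s y at h0
  have h2 : heatGrad μ s i k y = c * heatFlow μ s y := by rw [hc]; field_simp
  have h3 : heatGrad μ s i k y ^ 2 / heatFlow μ s y = c ^ 2 * heatFlow μ s y := by
    rw [h2]; field_simp
  rw [h3]
  rw [h2] at h0
  have : heatFlow μ s y / s = 1 / s * heatFlow μ s y := by ring
  nlinarith

/-- Semiconvexity makes the Fisher information finite at every positive time: the right-hand side of
`sq_heatGrad_div_le` is integrable. -/
theorem integrable_sq_heatGrad_div {s : ℝ} (hs : 0 < s) (i : ι) (k : Fin d) :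
    Integrable fun y => heatGrad μ s i k y ^ 2 / heatFlow μ s y := by
  refine ((integrable_heatHess (μ := μ) hs i k).add ((integrable_heatFlow (μ := μ) hs).div_const s)).mono'
    ?_ (ae_of_all _ fun y => ?_)
  · exact (((stronglyMeasurable_heatGrad μ s i k).measurable.pow_const 2).div
      (stronglyMeasurable_heatFlow μ s).measurable).aestronglyMeasurable
  · rw [Real.norm_of_nonneg (div_nonneg (sq_nonneg _) (heatFlow_pos hs y).le)]
    exact sq_heatGrad_div_le hs i k y

end Integrability

/-! ### De Bruijn's identity -/

section DeBruijn

variable {ι : Type*} [Fintype ι] {d : ℕ} (μ : Measure (ι → EuclideanSpace ℝ (Fin d)))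

/-- The entropy of the heat flow. -/
noncomputable def heatEntropy (s : ℝ) : ℝ := -∫ y, heatFlow μ s y * Real.log (heatFlow μ s y)

/-- The Fisher information of the heat flow. -/
noncomputable def heatFisher (s : ℝ) : ℝ :=
  ∫ y, ∑ i, ∑ k, heatGrad μ s i k y ^ 2 / heatFlow μ s y

variable {μ} [IsProbabilityMeasure μ]

theorem heatFisher_nonneg {s : ℝ} (hs : 0 < s) : 0 ≤ heatFisher μ s :=
  integral_nonneg fun y => Finset.sum_nonneg fun _ _ => Finset.sum_nonneg fun _ _ =>
    div_nonneg (sq_nonneg _) (heatFlow_pos hs y).le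

/-- Integration by parts along one coordinate, the derivative of log F + 1 being ∂F/F. No boundary
term arises since all three products are integrable. The summand 1 comes from differentiating u log
u. -/
theorem integral_log_heatFlow_mul_heatHess [DecidableEq ι] {s : ℝ} (hs : 0 < s)
    (hμ : Integrable normSq μ) (i : ι) (k : Fin d) :
    ∫ y, (Real.log (heatFlow μ s y) + 1) * heatHess μ s i k y =
      -∫ y, heatGrad μ s i k y ^ 2 / heatFlow μ s y := by
  obtain ⟨C, -, h⟩ := exists_heatFlow_bounds μ hs le_rfl
  have h2s : 0 < 2 * s := by positivity
  have key : ∀ f : (ι → EuclideanSpace ℝ (Fin d)) → ℝ, StronglyMeasurable f →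
      (∀ y, |f y| ≤ C * heatFlow μ (2 * s) y) →
      Integrable fun y => (Real.log (heatFlow μ s y) + 1) * f y := fun f hf hb => by
    have h1 := integrable_mul_log_heatFlow hf.aestronglyMeasurable h2s hb hμ hs
    have h2 := integrable_of_le_heatFlow hf.aestronglyMeasurable h2s hb
    refine (h1.add h2).congr (ae_of_all _ fun y => ?_)
    simp only [Pi.add_apply]
    ring
  have hsq : ∀ y, heatGrad μ s i k y ^ 2 / heatFlow μ s y =
      heatGrad μ s i k y / heatFlow μ s y * heatGrad μ s i k y := fun y => by ring
  have hi := integrable_sq_heatGrad_div (μ := μ) hs i k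
  simp only [hsq] at hi ⊢
  refine integral_bilinear_hasLineDerivAt_right_eq_neg_left_of_integrable
    (B := ContinuousLinearMap.mul ℝ ℝ) (v := blockBasis i k) hi ?_ ?_ (fun y _ => ?_)
    (fun y _ => hasLineDerivAt_heatGrad hs y i k)
  · exact key _ (stronglyMeasurable_heatHess μ s i k) fun y => (h s ⟨le_rfl, le_rfl⟩ y).2.2 i k
  · exact key _ (stronglyMeasurable_heatGrad μ s i k) fun y => (h s ⟨le_rfl, le_rfl⟩ y).2.1 i k
  · have h1 := hasLineDerivAt_heatFlow (μ := μ) hs y i k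
    unfold HasLineDerivAt at h1 ⊢
    have := (h1.log (by simpa using (heatFlow_pos hs y).ne')).add_const 1
    simpa using this

/-- **De Bruijn's identity** for the heat flow. -/
theorem hasDerivAt_heatEntropy {s : ℝ} (hs : 0 < s) (hμ : Integrable normSq μ) :
    HasDerivAt (heatEntropy μ) (1 / 2 * heatFisher μ s) s := by
  classical
  have hs2 : 0 < s / 2 := half_pos hs
  obtain ⟨C, hC, hb⟩ := exists_heatFlow_bounds μ hs2 (by linarith : s / 2 ≤ 2 * s)
  obtain ⟨D, hD, hlog⟩ := exists_log_heatFlow_bound (b := 2 * s) hs2 hμ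
  -- By the heat equation, `G r` is the time derivative of the flow at time r.
  set G := fun r y => (1 / 2 : ℝ) * ∑ i, ∑ k, heatHess μ r i k y
  have hGb : ∀ r ∈ Set.Icc (s / 2) (2 * s), ∀ y,
      |G r y| ≤ (1 / 2 * ∑ _i : ι, ∑ _k : Fin d, C) * heatFlow μ (2 * (2 * s)) y := by
    intro r hr y
    rw [abs_mul, abs_of_pos (by norm_num : (0 : ℝ) < 1 / 2), mul_assoc, Finset.sum_mul]
    gcongr
    refine (Finset.abs_sum_le_sum_abs _ _).trans (Finset.sum_le_sum fun i _ => ?_)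
    rw [Finset.sum_mul]
    exact (Finset.abs_sum_le_sum_abs _ _).trans
      (Finset.sum_le_sum fun k _ => (hb r hr y).2.2 i k)
  set C' := (1 / 2 : ℝ) * ∑ _i : ι, ∑ _k : Fin d, C
  have hmF : ∀ r, AEStronglyMeasurable fun y => heatFlow μ r y * Real.log (heatFlow μ r y) :=
    fun r => by
      have := (stronglyMeasurable_heatFlow μ r).measurable
      exact (this.mul (Real.measurable_log.comp this)).aestronglyMeasurable
  have hmG : Measurable (G s) := by
    have := fun i k => (stronglyMeasurable_heatHess μ s i k).measurable
    fun_prop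
  have hmF' : AEStronglyMeasurable fun y => G s y * (Real.log (heatFlow μ s y) + 1) := by
    have h1 := (stronglyMeasurable_heatFlow μ s).measurable
    exact (hmG.mul ((Real.measurable_log.comp h1).add_const 1)).aestronglyMeasurable
  -- For times in [s/2, 2s], `G` is dominated by the flow at time 4s and the logarithm by a
  -- quadratic; the second moment of the flow at time 4s makes the product integrable.
  have hd := (hasDerivAt_integral_of_dominated_loc_of_deriv_le (μ := volume) (x₀ := s)
    (s := Set.Icc (s / 2) (2 * s))
    (F := fun r y => heatFlow μ r y * Real.log (heatFlow μ r y))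
    (F' := fun r y => G r y * (Real.log (heatFlow μ r y) + 1))
    (bound := fun y => C' * (D + 1) * ((1 + normSq y) * heatFlow μ (2 * (2 * s)) y))
    (Icc_mem_nhds (by linarith) (by linarith)) (Eventually.of_forall hmF)
    (integrable_heatFlow_mul_log hs hμ) hmF' (ae_of_all _ fun y r hr => ?_)
    ((integrable_moment_heatFlow (μ := μ) (by positivity) hμ).const_mul _)
    (ae_of_all _ fun y r hr => ?_)).2.neg
  · refine hd.congr_deriv ?_
    have hH : ∀ i k, Integrable fun y => (Real.log (heatFlow μ s y) + 1) * heatHess μ s i k y := by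
      intro i k
      obtain ⟨C, -, h⟩ := exists_heatFlow_bounds μ hs le_rfl
      have h1 := integrable_mul_log_heatFlow (stronglyMeasurable_heatHess μ s i k).aestronglyMeasurable
        (by positivity : 0 < 2 * s) (fun y => (h s ⟨le_rfl, le_rfl⟩ y).2.2 i k) hμ hs
      refine (h1.add (integrable_heatHess (μ := μ) hs i k)).congr (ae_of_all _ fun y => ?_)
      simp only [Pi.add_apply]
      ring
    have hG : ∀ y, G s y * (Real.log (heatFlow μ s y) + 1) =
        1 / 2 * ∑ i, ∑ k, (Real.log (heatFlow μ s y) + 1) * heatHess μ s i k y := fun y => by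
      simp only [G, ← Finset.mul_sum]
      ring
    simp only [hG]
    rw [integral_const_mul, heatFisher, integral_finsetSum _ fun i _ =>
      integrable_finsetSum _ fun k _ => hH i k, integral_finsetSum _ fun i _ =>
      integrable_finsetSum _ fun k _ => integrable_sq_heatGrad_div (μ := μ) hs i k, ← mul_neg,
      ← Finset.sum_neg_distrib]
    congr 1
    refine Finset.sum_congr rfl fun i _ => ?_
    rw [integral_finsetSum _ fun k _ => hH i k,
      integral_finsetSum _ fun k _ => integrable_sq_heatGrad_div (μ := μ) hs i k, ← Finset.sum_neg_distrib]
    refine Finset.sum_congr rfl fun k _ => ?_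
    rw [integral_log_heatFlow_mul_heatHess hs hμ, neg_neg]
  · have h1 := hGb r hr y
    have h2 := hlog r hr y
    have hq := normSq_nonneg y
    have h3 : |Real.log (heatFlow μ r y) + 1| ≤ (D + 1) * (1 + normSq y) := by
      refine (abs_add_le _ _).trans ?_
      rw [abs_one]
      nlinarith
    rw [norm_mul]
    calc _ ≤ (C' * heatFlow μ (2 * (2 * s)) y) * ((D + 1) * (1 + normSq y)) :=
          mul_le_mul h1 h3 (abs_nonneg _) ((abs_nonneg _).trans h1)
      _ = _ := by ring
  · have hr0 : 0 < r := hs2.trans_le hr.1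
    have h1 := hasDerivAt_heatFlow (μ := μ) hr0 y
    have h2 := (Real.hasDerivAt_mul_log (heatFlow_pos (μ := μ) hr0 y).ne').comp r h1
    refine h2.congr_deriv ?_
    simp only [G]
    ring

end DeBruijn

/-! ### Variational lower bounds for relative entropies -/

section Variational

variable {E : Type*} [MeasurableSpace E]

theorem integral_withDensity_ofReal {ν : Measure E} {p : E → ℝ} (hp : Measurable p)
    (hp0 : ∀ x, 0 ≤ p x) (f : E → ℝ) :
    ∫ x, f x ∂(ν.withDensity fun x => ENNReal.ofReal (p x)) = ∫ x, p x * f x ∂ν := by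
  rw [integral_withDensity_eq_integral_toReal_smul hp.ennreal_ofReal (by simp)]
  simp [ENNReal.toReal_ofReal (hp0 _)]

theorem integrable_withDensity_ofReal {ν : Measure E} {p : E → ℝ} (hp : Measurable p)
    (hp0 : ∀ x, 0 ≤ p x) {f : E → ℝ} :
    Integrable f (ν.withDensity fun x => ENNReal.ofReal (p x)) ↔
      Integrable (fun x => p x * f x) ν := by
  rw [integrable_withDensity_iff_integrable_smul' hp.ennreal_ofReal (by simp)]
  simp [ENNReal.toReal_ofReal (hp0 _)]

theorem ae_pos_withDensity_ofReal {ν : Measure E} {p : E → ℝ} (hp : Measurable p) :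
    ∀ᵐ x ∂(ν.withDensity fun x => ENNReal.ofReal (p x)), 0 < p x := by
  rw [ae_withDensity_iff hp.ennreal_ofReal]
  exact ae_of_all _ fun x hx => ENNReal.ofReal_pos.1 (pos_iff_ne_zero.2 hx)

/-- The truncated logarithm. -/
noncomputable def truncLog (M u : ℝ) : ℝ := min M (Real.log (max u (Real.exp (-M))))

theorem abs_truncLog_le {M : ℝ} (hM : 0 ≤ M) (u : ℝ) : |truncLog M u| ≤ M := by
  have h : -M ≤ Real.log (max u (Real.exp (-M))) := by
    rw [Real.le_log_iff_exp_le (lt_max_of_lt_right (Real.exp_pos _))]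
    exact le_max_right _ _
  exact abs_le.2 ⟨le_min (by linarith) h, min_le_left _ _⟩

/-- Makes |log u| a dominating function for all truncation levels. -/
theorem abs_truncLog_le_abs_log {M u : ℝ} (hM : 0 ≤ M) (hu : 0 < u) :
    |truncLog M u| ≤ |Real.log u| := by
  by_cases h : Real.exp (-M) ≤ u
  · rw [truncLog, max_eq_left h]
    have h1 : -M ≤ Real.log u := (Real.le_log_iff_exp_le hu).2 h
    rcases le_total M (Real.log u) with h2 | h2
    · rw [min_eq_left h2, abs_of_nonneg hM]
      exact h2.trans (le_abs_self _)
    · rw [min_eq_right h2]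
  · refine (abs_truncLog_le hM u).trans ?_
    have h1 : Real.log u < -M := (Real.log_lt_iff_lt_exp hu).2 (not_le.1 h)
    exact le_trans (by linarith) (neg_le_abs _)

theorem exp_truncLog (M u : ℝ) :
    Real.exp (truncLog M u) = min (Real.exp M) (max u (Real.exp (-M))) := by
  rw [truncLog, Real.exp_monotone.map_min, Real.exp_log (lt_max_of_lt_right (Real.exp_pos _))]

theorem tendsto_exp_truncLog {u : ℝ} (hu : 0 ≤ u) :
    Tendsto (fun M : ℕ => Real.exp (truncLog M u)) atTop (𝓝 u) := by
  have h1 : Tendsto (fun M : ℕ => max u (Real.exp (-(M : ℝ)))) atTop (𝓝 (max u 0)) :=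
    tendsto_const_nhds.max (Real.tendsto_exp_neg_atTop_nhds_zero.comp tendsto_natCast_atTop_atTop)
  rw [max_eq_left hu] at h1
  have h2 : Tendsto (fun M : ℕ => Real.exp (M : ℝ)) atTop atTop :=
    Real.tendsto_exp_atTop.comp tendsto_natCast_atTop_atTop
  refine h1.congr' ?_
  filter_upwards [h2.eventually_ge_atTop (max u 1)] with M hM
  rw [exp_truncLog, min_eq_right]
  refine max_le ((le_max_left _ _).trans hM) ?_
  exact Real.exp_le_exp.2 (by linarith [(Nat.cast_nonneg M : (0 : ℝ) ≤ M)])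

theorem tendsto_truncLog {u : ℝ} (hu : 0 < u) :
    Tendsto (fun M : ℕ => truncLog M u) atTop (𝓝 (Real.log u)) := by
  have h := (Real.continuousAt_log hu.ne').tendsto.comp (tendsto_exp_truncLog hu.le)
  simpa [Function.comp_def] using h

theorem measurable_truncLog (M : ℝ) : Measurable (truncLog M) := by
  unfold truncLog
  fun_prop

/-- The tangent line of `exp` at a gives this one-sided Lipschitz bound, for which only a needs an
upper bound. -/
theorem exp_le_exp_add_mul_abs_sub {M a b : ℝ} (ha : a ≤ M) :
    Real.exp a ≤ Real.exp b + Real.exp M * |a - b| := by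
  have h1 : Real.exp a * (b - a + 1) ≤ Real.exp b := by
    have h := Real.add_one_le_exp (b - a)
    calc _ ≤ Real.exp a * Real.exp (b - a) := mul_le_mul_of_nonneg_left h (Real.exp_pos _).le
      _ = _ := by rw [← Real.exp_add]; ring_nf
  have h2 : Real.exp a * (a - b) ≤ Real.exp M * |a - b| := by
    rcases le_total 0 (a - b) with h' | h'
    · exact mul_le_mul (Real.exp_le_exp.2 ha) (le_abs_self _) h' (Real.exp_pos _).le
    · exact (mul_nonpos_of_nonneg_of_nonpos (Real.exp_pos _).le h').trans (by positivity)
  linarith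

/-- The relative entropy is approximated from below by the variational formula with bounded
continuous test functions. -/
theorem exists_variational_ge [TopologicalSpace E] [BorelSpace E] [TopologicalSpace.PseudoMetrizableSpace E]
    {γ : Measure E} [IsFiniteMeasure γ] {u : E → ℝ} (hu : Measurable u) (hu0 : ∀ x, 0 ≤ u x)
    (hui : Integrable u γ)
    (hlog : Integrable (fun x => Real.log (u x)) (γ.withDensity fun x => ENNReal.ofReal (u x)))
    {δ : ℝ} (hδ : 0 < δ) :
    ∃ φ : E → ℝ, Continuous φ ∧ (∃ M, ∀ x, |φ x| ≤ M) ∧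
      ∫ x, Real.log (u x) ∂(γ.withDensity fun x => ENNReal.ofReal (u x)) - ∫ x, u x ∂γ - δ ≤
        ∫ x, φ x ∂(γ.withDensity fun x => ENNReal.ofReal (u x)) - ∫ x, Real.exp (φ x) ∂γ := by
  set μ := γ.withDensity fun x => ENNReal.ofReal (u x) with hμ
  have : IsFiniteMeasure μ := isFiniteMeasure_withDensity_ofReal hui.2
  let : PseudoMetricSpace E := TopologicalSpace.pseudoMetrizableSpacePseudoMetric E
  have hpos : ∀ᵐ x ∂μ, 0 < u x := ae_pos_withDensity_ofReal hu
  have hmt : ∀ M : ℝ, Measurable fun x => truncLog M (u x) := fun M =>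
    (measurable_truncLog M).comp hu
  have h1 : Tendsto (fun M : ℕ => ∫ x, truncLog M (u x) ∂μ) atTop
      (𝓝 (∫ x, Real.log (u x) ∂μ)) := by
    refine tendsto_integral_of_dominated_convergence (fun x => |Real.log (u x)|)
      (fun M => (hmt M).aestronglyMeasurable) hlog.abs (fun M => ?_) ?_
    · filter_upwards [hpos] with x hx
      exact abs_truncLog_le_abs_log (Nat.cast_nonneg M) hx
    · filter_upwards [hpos] with x hx
      exact tendsto_truncLog hx
  have h2 : Tendsto (fun M : ℕ => ∫ x, Real.exp (truncLog M (u x)) ∂γ) atTop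
      (𝓝 (∫ x, u x ∂γ)) := by
    refine tendsto_integral_of_dominated_convergence (fun x => u x + 1)
      (fun M => (hmt M).exp.aestronglyMeasurable) (hui.add (integrable_const _))
      (fun M => ae_of_all _ fun x => ?_) (ae_of_all _ fun x => tendsto_exp_truncLog (hu0 x))
    rw [Real.norm_of_nonneg (Real.exp_pos _).le, exp_truncLog]
    refine (min_le_right _ _).trans (max_le (by linarith) ?_)
    have : Real.exp (-(M : ℝ)) ≤ 1 := Real.exp_le_one_iff.2 (by simp)
    linarith [hu0 x]
  -- Half of δ is spent on truncating the logarithm; the other half is left for replacing the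
  -- truncation by a continuous function.
  obtain ⟨M, hM⟩ := ((h1.sub h2).eventually_const_lt
    (show ∫ x, Real.log (u x) ∂μ - ∫ x, u x ∂γ - δ / 2 < _ by linarith)).exists
  have hM0 : (0 : ℝ) ≤ M := Nat.cast_nonneg M
  have hib : ∀ (ν : Measure E) [IsFiniteMeasure ν] (f : E → ℝ), Measurable f →
      (∀ x, |f x| ≤ M) → Integrable f ν := fun ν _ f hf hb =>
    Integrable.of_bound hf.aestronglyMeasurable M (ae_of_all _ hb)
  -- An L¹ error ε costs at most ε in the linear term and e^M·ε in the exponential term, hence ε(1 +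
  -- e^M) = δ/2.
  set ε := δ / 2 / (1 + Real.exp M)
  have hε : 0 < ε := by positivity
  -- Approximating in L¹(μ + γ) yields a single function that is close for both measures.
  obtain ⟨f, hf, hfi⟩ := (hib (μ + γ) _ (hmt M) fun x => abs_truncLog_le hM0 _)
    |>.exists_boundedContinuous_integral_sub_le hε
  -- Clamping to [−M, M] supplies the bound needed for the exponential, and does not increase the
  -- distance to the truncated logarithm, which lies in this interval.
  set φ : E → ℝ := fun x => max (-(M : ℝ)) (min M (f x))
  have hφc : Continuous φ := by fun_prop
  have hφM : ∀ x, |φ x| ≤ M := fun x =>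
    abs_le.2 ⟨le_max_left _ _, max_le (by linarith) (min_le_left _ _)⟩
  have hψM : ∀ x, |truncLog M (u x)| ≤ M := fun x => abs_truncLog_le hM0 _
  have hclose : ∀ x, |φ x - truncLog M (u x)| ≤ ‖truncLog M (u x) - f x‖ := fun x => by
    have h3 : truncLog M (u x) = max (-(M : ℝ)) (min M (truncLog M (u x))) := by
      rw [min_eq_right (le_of_abs_le (hψM x)), max_eq_right (neg_le_of_abs_le (hψM x))]
    conv_lhs => rw [h3]
    refine (abs_max_sub_max_le_max _ _ _ _).trans ?_
    rw [sub_self, abs_zero]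
    refine max_le (norm_nonneg _) ((abs_min_sub_min_le_max _ _ _ _).trans ?_)
    rw [sub_self, abs_zero, abs_sub_comm]
    exact max_le (norm_nonneg _) le_rfl
  have hiφ : ∀ (ν : Measure E) [IsFiniteMeasure ν], Integrable φ ν := fun ν _ =>
    hib ν φ hφc.measurable hφM
  have hiψ : ∀ (ν : Measure E) [IsFiniteMeasure ν], Integrable (fun x => truncLog M (u x)) ν :=
    fun ν _ => hib ν _ (hmt M) hψM
  have hexp : ∀ (ν : Measure E) [IsFiniteMeasure ν] (f : E → ℝ), Measurable f →
      (∀ x, |f x| ≤ M) → Integrable (fun x => Real.exp (f x)) ν := fun ν _ f hf hb =>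
    Integrable.of_bound hf.exp.aestronglyMeasurable (Real.exp M) (ae_of_all _ fun x => by
      rw [Real.norm_of_nonneg (Real.exp_pos _).le]
      exact Real.exp_le_exp.2 (le_of_abs_le (hb x)))
  have hidiff : ∀ (ν : Measure E) [IsFiniteMeasure ν],
      Integrable (fun x => |φ x - truncLog M (u x)|) ν := fun ν _ => ((hiφ ν).sub (hiψ ν)).abs
  have hsum : ∫ x, |φ x - truncLog M (u x)| ∂μ + ∫ x, |φ x - truncLog M (u x)| ∂γ ≤ ε := by
    rw [← integral_add_measure (hidiff μ) (hidiff γ)]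
    exact (integral_mono (hidiff _) ((hiψ _).sub hfi).norm hclose).trans hf
  have e1 : ∫ x, truncLog M (u x) ∂μ - ∫ x, |φ x - truncLog M (u x)| ∂μ ≤ ∫ x, φ x ∂μ := by
    rw [← integral_sub (hiψ μ) (hidiff μ)]
    refine integral_mono ((hiψ μ).sub (hidiff μ)) (hiφ μ) fun x => ?_
    have := neg_abs_le (φ x - truncLog M (u x))
    simp only
    linarith
  have e2 : ∫ x, Real.exp (φ x) ∂γ ≤ ∫ x, Real.exp (truncLog M (u x)) ∂γ +
      Real.exp M * ∫ x, |φ x - truncLog M (u x)| ∂γ := by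
    rw [← integral_const_mul, ← integral_add (hexp γ _ (hmt M) hψM) ((hidiff γ).const_mul _)]
    exact integral_mono (hexp γ _ hφc.measurable hφM)
      ((hexp γ _ (hmt M) hψM).add ((hidiff γ).const_mul _))
      fun x => exp_le_exp_add_mul_abs_sub (le_of_abs_le (hφM x))
  refine ⟨φ, hφc, ⟨M, hφM⟩, ?_⟩
  have e3 : 0 ≤ ∫ x, |φ x - truncLog M (u x)| ∂μ := integral_nonneg fun x => abs_nonneg _
  have e4 : 0 ≤ ∫ x, |φ x - truncLog M (u x)| ∂γ := integral_nonneg fun x => abs_nonneg _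
  have e5 : ε * (1 + Real.exp M) = δ / 2 := by
    have : (1 + Real.exp M) ≠ 0 := by positivity
    simp only [ε]
    field_simp
  have e6 := mul_le_mul_of_nonneg_right hsum (Real.exp_pos (M : ℝ)).le
  nlinarith [mul_nonneg e3 (Real.exp_pos (M : ℝ)).le]

end Variational

/-! ### The law of a Gaussian perturbation -/

section Law

variable {ι : Type*} [Fintype ι] {d : ℕ}

/-- The law of independent standard Gaussian vectors. -/
noncomputable def blockGaussian (ι : Type*) [Fintype ι] (d : ℕ) :
    Measure (ι → EuclideanSpace ℝ (Fin d)) :=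
  Measure.pi fun _ => stdGaussian (EuclideanSpace ℝ (Fin d))

instance : IsProbabilityMeasure (blockGaussian ι d) := by
  unfold blockGaussian
  infer_instance

variable (μ : Measure (ι → EuclideanSpace ℝ (Fin d))) [IsProbabilityMeasure μ]

theorem conv_withDensity_heatKernel {s : ℝ} (hs : 0 < s) :
    μ.conv (volume.withDensity fun x => ENNReal.ofReal (heatKernel s x)) =
      volume.withDensity fun x => ENNReal.ofReal (heatFlow μ s x) := by
  have hk : Measurable fun x : ι → EuclideanSpace ℝ (Fin d) => ENNReal.ofReal (heatKernel s x) :=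
    (measurable_heatKernel s).ennreal_ofReal
  have := isFiniteMeasure_withDensity_ofReal (integrable_heatKernel (ι := ι) (d := d) hs).2
  ext A hA
  have hind : Measurable (A.indicator (1 : (ι → EuclideanSpace ℝ (Fin d)) → ℝ≥0∞)) :=
    measurable_one.indicator hA
  have hF : ∀ y, ENNReal.ofReal (heatFlow μ s y) = ∫⁻ x, ENNReal.ofReal (heatKernel s (y - x)) ∂μ :=
    fun y => ofReal_integral_eq_lintegral_ofReal (integrable_heatKernel_translate hs y)
      (ae_of_all _ fun x => (heatKernel_pos _ _).le)
  rw [← lintegral_indicator_one hA, Measure.lintegral_conv hind, withDensity_apply _ hA,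
    ← lintegral_indicator hA]
  have h1 : ∀ x, ∫⁻ y, A.indicator 1 (x + y)
      ∂(volume.withDensity fun x => ENNReal.ofReal (heatKernel s x)) =
      ∫⁻ y, A.indicator (fun y => ENNReal.ofReal (heatKernel s (y - x))) y := fun x => by
    rw [lintegral_withDensity_eq_lintegral_mul _ hk (by fun_prop),
      ← lintegral_add_left_eq_self (μ := volume)
        (A.indicator (fun y => ENNReal.ofReal (heatKernel s (y - x)))) x]
    refine lintegral_congr fun y => ?_
    by_cases hy : x + y ∈ A
    · simp [Set.indicator_of_mem hy]
    · simp [Set.indicator_of_notMem hy]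
  simp only [h1]
  -- Tonelli's theorem moves the average over μ inside, where it produces the mixture density.
  rw [lintegral_lintegral_swap]
  · refine lintegral_congr fun y => ?_
    by_cases hy : y ∈ A
    · simp only [Set.indicator_of_mem hy, hF]
    · simp [Set.indicator_of_notMem hy]
  · have : Measurable fun z : (ι → EuclideanSpace ℝ (Fin d)) × (ι → EuclideanSpace ℝ (Fin d)) =>
        (Prod.snd ⁻¹' A).indicator (fun z => ENNReal.ofReal (heatKernel s (z.2 - z.1))) z :=
      Measurable.indicator (by fun_prop) (measurable_snd hA)
    exact this.aemeasurable

/-- The law of `X + √s Z` has the density `heatFlow μ s`, if `X` has law `μ`. -/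
theorem map_add_sqrt_smul {s : ℝ} (hs : 0 < s) :
    (μ.prod (blockGaussian ι d)).map (fun z => z.1 + √s • z.2) =
      volume.withDensity fun x => ENNReal.ofReal (heatFlow μ s x) := by
  rw [← conv_withDensity_heatKernel μ hs]
  have h := map_smul_pi_stdGaussian (ι := ι) (d := d) (Real.sqrt_pos.2 hs)
  rw [Real.sq_sqrt hs.le] at h
  have hm : Measurable fun x : ι → EuclideanSpace ℝ (Fin d) => √s • x := by fun_prop
  have : IsProbabilityMeasure ((blockGaussian ι d).map fun x => √s • x) :=
    Measure.isProbabilityMeasure_map hm.aemeasurable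
  rw [← h]
  change _ = μ.conv ((blockGaussian ι d).map fun x => √s • x)
  rw [Measure.conv]
  conv_rhs => rw [← Measure.map_id (μ := μ)]
  rw [Measure.map_prod_map _ _ measurable_id hm, Measure.map_map (by fun_prop) (by fun_prop)]
  rfl

variable {μ}

theorem measurable_heatFlow (s : ℝ) : Measurable (heatFlow μ s) :=
  (stronglyMeasurable_heatFlow μ s).measurable

theorem integral_heatFlow_mul {s : ℝ} (hs : 0 < s) {ψ : (ι → EuclideanSpace ℝ (Fin d)) → ℝ}
    (hψ : Measurable ψ) :
    ∫ y, heatFlow μ s y * ψ y = ∫ z, ψ (z.1 + √s • z.2) ∂(μ.prod (blockGaussian ι d)) := by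
  rw [← integral_withDensity_ofReal (measurable_heatFlow s) (fun y => (heatFlow_pos hs y).le),
    ← map_add_sqrt_smul μ hs, integral_map (by fun_prop) hψ.aestronglyMeasurable]

theorem integrable_sq_coord_stdGaussian (k : Fin d) :
    Integrable (fun z => z k ^ 2) (stdGaussian (EuclideanSpace ℝ (Fin d))) := by
  have h : MemLp (EuclideanSpace.proj k : EuclideanSpace ℝ (Fin d) →L[ℝ] ℝ) 2
      (stdGaussian (EuclideanSpace ℝ (Fin d))) := IsGaussian.memLp_dual _ _ _ (by simp)
  exact h.integrable_sq

theorem integral_sq_coord_stdGaussian (k : Fin d) :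
    ∫ z, z k ^ 2 ∂(stdGaussian (EuclideanSpace ℝ (Fin d))) = 1 := by
  set L : StrongDual ℝ (EuclideanSpace ℝ (Fin d)) := innerSL ℝ (EuclideanSpace.single k (1 : ℝ))
  have hL : ∀ z, L z = z k := fun z => by simp [L, EuclideanSpace.inner_single_left]
  have h := variance_dual_stdGaussian L
  rw [variance_of_integral_eq_zero L.continuous.measurable.aemeasurable
    (integral_strongDual_stdGaussian L)] at h
  simp only [hL] at h
  rw [h]
  simp [L]

theorem integrable_normSq_blockGaussian : Integrable normSq (blockGaussian ι d) := by
  have : (normSq : (ι → EuclideanSpace ℝ (Fin d)) → ℝ) = fun x => ∑ i, ∑ k, x i k ^ 2 :=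
    funext normSq_eq_sum
  rw [this]
  exact integrable_finsetSum _ fun i _ => integrable_finsetSum _ fun k _ =>
    integrable_comp_eval (μ := fun _ : ι => stdGaussian (EuclideanSpace ℝ (Fin d))) (i := i)
      (integrable_sq_coord_stdGaussian k)

theorem integral_normSq_blockGaussian : ∫ x, normSq x ∂(blockGaussian ι d) = blockDim ι d := by
  have hi : ∀ i : ι, ∀ k : Fin d, Integrable
      (fun x : ι → EuclideanSpace ℝ (Fin d) => x i k ^ 2) (blockGaussian ι d) := fun i k =>
    integrable_comp_eval (μ := fun _ : ι => stdGaussian (EuclideanSpace ℝ (Fin d))) (i := i)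
      (integrable_sq_coord_stdGaussian k)
  simp only [normSq_eq_sum]
  rw [integral_finsetSum _ fun i _ => integrable_finsetSum _ fun k _ => hi i k]
  have h1 : ∀ i : ι, ∫ x, ∑ k, x i k ^ 2 ∂(blockGaussian ι d) = d := fun i => by
    rw [integral_finsetSum _ fun k _ => hi i k]
    have h2 : ∀ k : Fin d, ∫ x, x i k ^ 2 ∂(blockGaussian ι d) = 1 := fun k => by
      rw [← integral_sq_coord_stdGaussian k]
      exact integral_comp_eval (μ := fun _ : ι => stdGaussian (EuclideanSpace ℝ (Fin d))) (i := i)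
        (f := fun z => z k ^ 2) (integrable_sq_coord_stdGaussian k).1
    simp [h2]
  simp [h1, blockDim]

/-- The cross term is split as 2c⟨x, z⟩ ≤ c(|x|² + |z|²), so |z|² keeps the coefficient c² to
leading order. A factor 2 there would spoil the Gaussian limit of the entropy. -/
theorem normSq_add_smul_le (x z : ι → EuclideanSpace ℝ (Fin d)) {c : ℝ} (hc : 0 ≤ c) :
    normSq (x + c • z) ≤ normSq x + c * (normSq x + normSq z) + c ^ 2 * normSq z := by
  simp only [normSq_eq_sum, Finset.mul_sum, ← Finset.sum_add_distrib]
  refine Finset.sum_le_sum fun i _ => Finset.sum_le_sum fun k _ => ?_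
  simp only [Pi.add_apply, Pi.smul_apply, PiLp.add_apply, PiLp.smul_apply, smul_eq_mul]
  nlinarith [mul_nonneg hc (sq_nonneg (x i k - z i k))]

theorem integrable_heatFlow_mul {s C : ℝ} (hs : 0 < s) (hμ : Integrable normSq μ)
    {ψ : (ι → EuclideanSpace ℝ (Fin d)) → ℝ} (hψ : Measurable ψ)
    (hb : ∀ y, |ψ y| ≤ C * (1 + normSq y)) : Integrable fun y => heatFlow μ s y * ψ y := by
  refine ((integrable_moment_heatFlow hs hμ).const_mul C).mono'
    ((measurable_heatFlow s).mul hψ).aestronglyMeasurable (ae_of_all _ fun y => ?_)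
  have h := heatFlow_pos (μ := μ) hs y
  rw [norm_mul, Real.norm_of_nonneg h.le]
  calc _ ≤ heatFlow μ s y * (C * (1 + normSq y)) := mul_le_mul_of_nonneg_left (hb y) h.le
    _ = _ := by ring

theorem integral_heatFlow_mul_normSq_le {s : ℝ} (hs : 0 < s) (hμ : Integrable normSq μ) :
    ∫ y, heatFlow μ s y * normSq y ≤ ∫ x, normSq x ∂μ +
      √s * (∫ x, normSq x ∂μ + blockDim ι d) + s * blockDim ι d := by
  rw [integral_heatFlow_mul hs measurable_normSq, ← integral_normSq_blockGaussian]
  have h1 := hμ.comp_fst (blockGaussian ι d)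
  have h2 := (integrable_normSq_blockGaussian (ι := ι) (d := d)).comp_snd μ
  have hr : Integrable (fun z : (ι → EuclideanSpace ℝ (Fin d)) × (ι → EuclideanSpace ℝ (Fin d)) =>
      normSq z.1 + √s * (normSq z.1 + normSq z.2) + s * normSq z.2)
      (μ.prod (blockGaussian ι d)) := (h1.add ((h1.add h2).const_mul _)).add (h2.const_mul _)
  have hle : ∀ z : (ι → EuclideanSpace ℝ (Fin d)) × (ι → EuclideanSpace ℝ (Fin d)),
      normSq (z.1 + √s • z.2) ≤ normSq z.1 + √s * (normSq z.1 + normSq z.2) + s * normSq z.2 :=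
    fun z => by
      have := normSq_add_smul_le z.1 z.2 (Real.sqrt_nonneg s)
      rwa [Real.sq_sqrt hs.le] at this
  have hl : Integrable (fun z => normSq (z.1 + √s • z.2)) (μ.prod (blockGaussian ι d)) := by
    have hm : Measurable fun z : (ι → EuclideanSpace ℝ (Fin d)) × (ι → EuclideanSpace ℝ (Fin d)) =>
      normSq (z.1 + √s • z.2) := by fun_prop
    refine hr.mono' hm.aestronglyMeasurable (ae_of_all _ fun z => ?_)
    rw [Real.norm_of_nonneg (normSq_nonneg _)]
    exact hle z
  refine (integral_mono hl hr hle).trans_eq ?_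
  have h3 : Integrable (fun z : (ι → EuclideanSpace ℝ (Fin d)) × (ι → EuclideanSpace ℝ (Fin d)) =>
      √s * (normSq z.1 + normSq z.2)) (μ.prod (blockGaussian ι d)) := (h1.add h2).const_mul _
  have h4 : Integrable (fun z : (ι → EuclideanSpace ℝ (Fin d)) × (ι → EuclideanSpace ℝ (Fin d)) =>
      normSq z.1 + √s * (normSq z.1 + normSq z.2)) (μ.prod (blockGaussian ι d)) := h1.add h3
  rw [integral_add h4 (h2.const_mul _), integral_add h1 h3,
    integral_const_mul, integral_const_mul, integral_add h1 h2, integral_fun_fst, integral_fun_snd]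
  simp

/-- Weak continuity of the heat flow at the initial time. -/
theorem tendsto_integral_heatFlow_mul (hμ : Integrable normSq μ)
    {ψ : (ι → EuclideanSpace ℝ (Fin d)) → ℝ} (hψ : Continuous ψ) {C : ℝ}
    (hb : ∀ y, |ψ y| ≤ C * (1 + normSq y)) :
    Tendsto (fun s => ∫ y, heatFlow μ s y * ψ y) (𝓝[>] 0) (𝓝 (∫ x, ψ x ∂μ)) := by
  have h0 : ∫ x, ψ x ∂μ = ∫ z, ψ z.1 ∂(μ.prod (blockGaussian ι d)) := by
    rw [integral_fun_fst]
    simp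
  have hC : 0 ≤ C := by
    have h1 := (abs_nonneg _).trans (hb 0)
    have h2 : normSq (0 : ι → EuclideanSpace ℝ (Fin d)) = 0 := by simp [normSq]
    simpa [h2] using h1
  rw [h0]
  have h1 := hμ.comp_fst (blockGaussian ι d)
  have h2 := (integrable_normSq_blockGaussian (ι := ι) (d := d)).comp_snd μ
  have hlim : Tendsto (fun s => ∫ z, ψ (z.1 + √s • z.2) ∂(μ.prod (blockGaussian ι d))) (𝓝[>] 0)
      (𝓝 (∫ z, ψ z.1 ∂(μ.prod (blockGaussian ι d)))) := by
    refine tendsto_integral_filter_of_dominated_convergence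
      (fun z => C * (1 + (2 * normSq z.1 + 2 * normSq z.2))) (Eventually.of_forall fun s => ?_) ?_
      (((integrable_const _).add ((h1.const_mul 2).add (h2.const_mul 2))).const_mul C)
      (ae_of_all _ fun z => ?_)
    · have : Measurable fun z : (ι → EuclideanSpace ℝ (Fin d)) × (ι → EuclideanSpace ℝ (Fin d)) =>
        ψ (z.1 + √s • z.2) := hψ.measurable.comp (by fun_prop)
      exact this.aestronglyMeasurable
    · have : Set.Ioc (0 : ℝ) 1 ∈ 𝓝[>] (0 : ℝ) := Ioc_mem_nhdsGT one_pos
      filter_upwards [this] with s hs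
      refine ae_of_all _ fun z => (hb _).trans ?_
      gcongr
      refine (normSq_add_le _ _).trans ?_
      rw [normSq_smul, Real.sq_sqrt hs.1.le]
      nlinarith [mul_le_mul_of_nonneg_right hs.2 (normSq_nonneg z.2)]
    · have hc : Continuous fun s : ℝ => ψ (z.1 + √s • z.2) := by fun_prop
      have := (hc.tendsto 0).mono_left (nhdsWithin_le_nhds (s := Set.Ioi 0))
      simpa using this
  refine hlim.congr' ?_
  filter_upwards [self_mem_nhdsWithin] with s hs
  exact (integral_heatFlow_mul hs hψ.measurable).symm

end Law

/-! ### Bounds and continuity for the entropy of the heat flow -/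

section EntropyBounds

variable {ι : Type*} [Fintype ι] {d : ℕ} {μ : Measure (ι → EuclideanSpace ℝ (Fin d))}
  [IsProbabilityMeasure μ]

/-- Adding an independent random vector increases the entropy. -/
theorem integral_mul_log_mixture_le {p : (ι → EuclideanSpace ℝ (Fin d)) → ℝ}
    (hp0 : ∀ x, 0 ≤ p x) (hp : Integrable p)
    (hlog : Integrable fun x => p x * Real.log (p x))
    (hmix : Integrable fun y => (∫ x, p (y - x) ∂μ) * Real.log (∫ x, p (y - x) ∂μ)) :
    ∫ y, (∫ x, p (y - x) ∂μ) * Real.log (∫ x, p (y - x) ∂μ) ≤ ∫ x, p x * Real.log (p x) := by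
  -- Once the right-hand side is written as the integral of the mixture of p log p, the claim is
  -- Jensen's inequality for u log u at almost every point.
  rw [← integral_mixture (μ := μ) hlog]
  refine integral_mono_ae hmix (integrable_mixture hlog) ?_
  filter_upwards [(integrable_prod_translate (μ := μ) hp).prod_left_ae,
    (integrable_prod_translate (μ := μ) hlog).prod_left_ae] with y h1 h2
  exact Real.convexOn_mul_log.map_integral_le Real.continuous_mul_log.continuousOn isClosed_Ici
    (ae_of_all _ fun x => hp0 _) h1 h2

theorem integral_heatKernel_mul_normSq {s : ℝ} (hs : 0 < s) :
    ∫ x : ι → EuclideanSpace ℝ (Fin d), heatKernel s x * normSq x = s * blockDim ι d := by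
  rw [← integral_withDensity_ofReal (measurable_heatKernel s) (fun x => (heatKernel_pos s x).le)]
  have h := map_smul_pi_stdGaussian (ι := ι) (d := d) (Real.sqrt_pos.2 hs)
  rw [Real.sq_sqrt hs.le] at h
  rw [← h, integral_map (by fun_prop) (by fun_prop)]
  simp only [normSq_smul, Real.sq_sqrt hs.le, integral_const_mul]
  rw [← integral_normSq_blockGaussian]
  rfl

theorem integrable_heatKernel_mul_normSq {s : ℝ} (hs : 0 < s) :
    Integrable fun x : ι → EuclideanSpace ℝ (Fin d) => heatKernel s x * normSq x := by
  refine ((integrable_moment_heatKernel hs).sub (integrable_heatKernel hs)).congr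
    (ae_of_all _ fun x => ?_)
  simp only [Pi.sub_apply]
  ring

/-- The entropy of the heat flow is at least the entropy of the Gaussian kernel. -/
theorem le_heatEntropy {s : ℝ} (hs : 0 < s) (hμ : Integrable normSq μ) :
    blockDim ι d / 2 * Real.log (2 * Real.pi * s) + blockDim ι d / 2 ≤ heatEntropy μ s := by
  set c : ℝ := blockDim ι d / 2 * Real.log (2 * Real.pi * s)
  have h1 : ∀ x : ι → EuclideanSpace ℝ (Fin d), heatKernel s x * Real.log (heatKernel s x) =
      -c * heatKernel s x - 1 / (2 * s) * (heatKernel s x * normSq x) := fun x => by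
    rw [log_heatKernel]
    ring
  have i1 := (integrable_heatKernel (ι := ι) (d := d) hs).const_mul (-c)
  have i2 := (integrable_heatKernel_mul_normSq (ι := ι) (d := d) hs).const_mul (1 / (2 * s))
  -- Here the Gaussian kernel is the density and μ is the mixing measure.
  have h2 := integral_mul_log_mixture_le (μ := μ) (fun x => (heatKernel_pos s x).le)
    (integrable_heatKernel hs) (by simp only [h1]; exact i1.sub i2)
    (integrable_heatFlow_mul_log hs hμ)
  simp only [h1] at h2
  rw [integral_sub i1 i2, integral_const_mul, integral_const_mul, integral_heatKernel hs,
    integral_heatKernel_mul_normSq hs] at h2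
  have h3 : 1 / (2 * s) * (s * blockDim ι d) = blockDim ι d / 2 := by field_simp
  rw [h3] at h2
  change ∫ y, heatFlow μ s y * Real.log (heatFlow μ s y) ≤ _ at h2
  rw [heatEntropy]
  linarith

/-- Gibbs' inequality. -/
theorem heatEntropy_le {s : ℝ} (hs : 0 < s) (hμ : Integrable normSq μ)
    {ψ : (ι → EuclideanSpace ℝ (Fin d)) → ℝ} (hψ : Measurable ψ) {C : ℝ}
    (hb : ∀ y, |ψ y| ≤ C * (1 + normSq y)) (hexp : Integrable fun y => Real.exp (ψ y)) :
    heatEntropy μ s ≤ -(∫ y, heatFlow μ s y * ψ y) - 1 + ∫ y, Real.exp (ψ y) := by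
  have i1 := integrable_heatFlow_mul hs hμ hψ hb
  have i2 := integrable_heatFlow (μ := μ) hs
  have i3 : Integrable fun y => heatFlow μ s y * ψ y + heatFlow μ s y := i1.add i2
  have h : ∫ y, (heatFlow μ s y * ψ y + heatFlow μ s y - Real.exp (ψ y)) ≤
      ∫ y, heatFlow μ s y * Real.log (heatFlow μ s y) := by
    refine integral_mono (i3.sub hexp) (integrable_heatFlow_mul_log hs hμ) fun y => ?_
    have hF := heatFlow_pos (μ := μ) hs y
    -- The inequality 1 + v ≤ eᵛ at v = ψ − log F, multiplied by F, reads Fψ + F − e^ψ ≤ F log F.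
    have h1 := Real.add_one_le_exp (ψ y - Real.log (heatFlow μ s y))
    rw [Real.exp_sub, Real.exp_log hF, le_div_iff₀ hF] at h1
    simp only
    linarith
  rw [integral_sub i3 hexp, integral_add i1 i2, integral_heatFlow hs] at h
  rw [heatEntropy]
  linarith

/-- The entropy is bounded in terms of the second moment. -/
theorem heatEntropy_le_of_moment {s r : ℝ} (hs : 0 < s) (hr : 0 < r) (hμ : Integrable normSq μ) :
    heatEntropy μ s ≤ blockDim ι d / 2 * Real.log (2 * Real.pi * r) +
      (∫ x, normSq x ∂μ + √s * (∫ x, normSq x ∂μ + blockDim ι d) + s * blockDim ι d) / (2 * r) := by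
  set c : ℝ := blockDim ι d / 2 * Real.log (2 * Real.pi * r)
  have hexp : ∀ y : ι → EuclideanSpace ℝ (Fin d),
      Real.exp (-c - normSq y / (2 * r)) = heatKernel r y := fun y => rfl
  -- The test function is the logarithm of the Gaussian kernel of variance r, so that ∫ e^ψ = 1
  -- cancels the −1 in Gibbs' inequality.
  have h := heatEntropy_le hs hμ (ψ := fun y => -c - normSq y / (2 * r)) (by fun_prop)
    (C := |c| + 1 / (2 * r)) (fun y => ?_) (by simp only [hexp]; exact integrable_heatKernel hr)
  · simp only [hexp, integral_heatKernel hr] at h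
    have i1 := (integrable_heatFlow (μ := μ) hs).const_mul (-c)
    have i2 := integrable_heatFlow_mul hs hμ measurable_normSq (C := 1)
      (fun y => by rw [abs_of_nonneg (normSq_nonneg y)]; linarith)
    have h1 : ∀ y, heatFlow μ s y * (-c - normSq y / (2 * r)) =
        -c * heatFlow μ s y - heatFlow μ s y * normSq y / (2 * r) := fun y => by ring
    simp only [h1] at h
    rw [integral_sub i1 (i2.div_const (2 * r)), integral_const_mul, integral_heatFlow hs,
      integral_div] at h
    have h2 := div_le_div_of_nonneg_right (integral_heatFlow_mul_normSq_le hs hμ)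
      (by positivity : 0 ≤ 2 * r)
    linarith
  · have hq := normSq_nonneg y
    have h1 := abs_nonneg c
    have h2 : 0 < 1 / (2 * r) := by positivity
    calc |-c - normSq y / (2 * r)| ≤ |-c| + |normSq y / (2 * r)| := abs_sub _ _
      _ = |c| + 1 / (2 * r) * normSq y := by
        rw [abs_neg, abs_of_nonneg (by positivity : 0 ≤ normSq y / (2 * r))]; ring
      _ ≤ _ := by nlinarith [mul_nonneg h1 hq]

variable {p : (ι → EuclideanSpace ℝ (Fin d)) → ℝ}

theorem integral_density_eq_one (hp : Measurable p) (hp0 : ∀ x, 0 ≤ p x)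
    (hμp : μ = volume.withDensity fun x => ENNReal.ofReal (p x)) :
    Integrable p ∧ ∫ x, p x = 1 := by
  have h1 := integral_withDensity_ofReal (ν := volume) hp hp0 fun _ => (1 : ℝ)
  have h2 := (integrable_withDensity_ofReal (ν := volume) hp hp0 (f := fun _ => (1 : ℝ))).1
    (by rw [← hμp]; exact integrable_const _)
  rw [← hμp] at h1
  simp only [mul_one, integral_const, probReal_univ, one_smul] at h1 h2
  exact ⟨h2, h1.symm⟩

/-- Jensen's inequality as in `le_heatEntropy`, with the roles exchanged: p is the density and the
Gaussian law is the mixing measure. -/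
theorem integral_density_mul_log_ge {s : ℝ} (hs : 0 < s) (hμ : Integrable normSq μ)
    (hp : Measurable p) (hp0 : ∀ x, 0 ≤ p x)
    (hμp : μ = volume.withDensity fun x => ENNReal.ofReal (p x))
    (hlog : Integrable fun x => p x * Real.log (p x)) :
    -∫ x, p x * Real.log (p x) ≤ heatEntropy μ s := by
  have : (volume : Measure (ι → EuclideanSpace ℝ (Fin d))).IsNegInvariant :=
    Measure.pi.isNegInvariant (fun _ => (volume : Measure (EuclideanSpace ℝ (Fin d))))
  have hmix : ∀ y, ∫ x, p (y - x) ∂(volume.withDensity fun x => ENNReal.ofReal (heatKernel s x)) =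
      heatFlow μ s y := fun y => by
    rw [integral_withDensity_ofReal (measurable_heatKernel s) (fun x => (heatKernel_pos s x).le),
      heatFlow, hμp, integral_withDensity_ofReal hp hp0,
      ← integral_sub_left_eq_self (fun x => p x * heatKernel s (y - x)) volume y]
    refine integral_congr_ae (ae_of_all _ fun x => ?_)
    simp only [sub_sub_cancel]
    ring
  have : IsProbabilityMeasure (volume.withDensity fun x : ι → EuclideanSpace ℝ (Fin d) =>
      ENNReal.ofReal (heatKernel s x)) := by
    constructor
    rw [withDensity_apply _ MeasurableSet.univ, setLIntegral_univ,
      ← ofReal_integral_eq_lintegral_ofReal (integrable_heatKernel hs)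
      (ae_of_all _ fun x => (heatKernel_pos _ _).le), integral_heatKernel hs, ENNReal.ofReal_one]
  have h := integral_mul_log_mixture_le
    (μ := volume.withDensity fun x => ENNReal.ofReal (heatKernel s x)) hp0
    (integral_density_eq_one hp hp0 hμp).1 hlog
    (by simp only [hmix]; exact integrable_heatFlow_mul_log hs hμ)
  simp only [hmix] at h
  rw [heatEntropy]
  linarith

/-- Continuity of the entropy of the heat flow at the initial time. -/
theorem tendsto_heatEntropy_zero (hμ : Integrable normSq μ)
    (hp : Measurable p) (hp0 : ∀ x, 0 ≤ p x)
    (hμp : μ = volume.withDensity fun x => ENNReal.ofReal (p x))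
    (hlog : Integrable fun x => p x * Real.log (p x)) :
    Tendsto (heatEntropy μ) (𝓝[>] 0) (𝓝 (-∫ x, p x * Real.log (p x))) := by
  refine tendsto_order.2 ⟨fun a ha => ?_, fun a ha => ?_⟩
  -- Lower half: the entropy at positive times is at least the initial one.
  · filter_upwards [self_mem_nhdsWithin] with s hs
    exact ha.trans_le (integral_density_mul_log_ge hs hμ hp hp0 hμp hlog)
  obtain ⟨hpi, hp1⟩ := integral_density_eq_one hp hp0 hμp
  -- The variational formula needs a finite reference measure, so Lebesgue measure is replaced by
  -- the standard Gaussian γ with density g, and u = p/g is the relative density.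
  set g : (ι → EuclideanSpace ℝ (Fin d)) → ℝ := heatKernel 1
  have hg : ∀ x, 0 < g x := heatKernel_pos 1
  have hgm : Measurable g := measurable_heatKernel 1
  have hgi : Integrable g := integrable_heatKernel_one
  set γ := volume.withDensity fun x => ENNReal.ofReal (g x)
  have : IsFiniteMeasure γ := isFiniteMeasure_withDensity_ofReal hgi.2
  set u := fun x => p x / g x
  have hu : Measurable u := hp.div hgm
  have hu0 : ∀ x, 0 ≤ u x := fun x => div_nonneg (hp0 x) (hg x).le
  have hgu : ∀ x, g x * u x = p x := fun x => mul_div_cancel₀ _ (hg x).ne'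
  have hγ : γ.withDensity (fun x => ENNReal.ofReal (u x)) = μ := by
    rw [hμp, ← withDensity_mul _ hgm.ennreal_ofReal hu.ennreal_ofReal]
    congr 1
    ext x
    rw [Pi.mul_apply, ← ENNReal.ofReal_mul (hg x).le, hgu]
  have hui : Integrable u γ := by
    rw [integrable_withDensity_ofReal hgm fun x => (hg x).le]
    simpa only [hgu] using hpi
  have hu1 : ∫ x, u x ∂γ = 1 := by
    rw [integral_withDensity_ofReal hgm fun x => (hg x).le]
    simpa only [hgu] using hp1
  obtain ⟨C, hC0, hC⟩ : ∃ C, 0 ≤ C ∧ ∀ x, |Real.log (g x)| ≤ C * (1 + normSq x) := by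
    set c : ℝ := blockDim ι d / 2 * Real.log (2 * Real.pi * 1)
    refine ⟨|c| + 1, by positivity, fun x => ?_⟩
    have hq := normSq_nonneg x
    have h1 := abs_nonneg c
    rw [log_heatKernel]
    calc |-c - normSq x / (2 * 1)| ≤ |-c| + |normSq x / (2 * 1)| := abs_sub _ _
      _ = |c| + normSq x / 2 := by
        rw [abs_neg, mul_one, abs_of_nonneg (by positivity : 0 ≤ normSq x / 2)]
      _ ≤ _ := by nlinarith [mul_nonneg h1 hq]
  have hlg : Integrable (fun x => Real.log (g x)) μ := by
    refine (((integrable_const 1).add hμ).const_mul C).mono'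
      hgm.log.aestronglyMeasurable (ae_of_all _ hC)
  have hlp : Integrable (fun x => Real.log (p x)) μ := by
    rw [hμp, integrable_withDensity_ofReal hp hp0]
    exact hlog
  have hpos : ∀ᵐ x ∂μ, 0 < p x := by
    rw [hμp]
    exact ae_pos_withDensity_ofReal hp
  have hlu : (fun x => Real.log (u x)) =ᵐ[μ] fun x => Real.log (p x) - Real.log (g x) := by
    filter_upwards [hpos] with x hx
    exact Real.log_div hx.ne' (hg x).ne'
  have hlui : Integrable (fun x => Real.log (u x)) μ := (hlp.sub hlg).congr hlu.symm
  -- The accuracy is half the distance from a to the initial entropy, so that the limiting upper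
  -- bound stays strictly below a.
  have hδ : 0 < (a - -∫ x, p x * Real.log (p x)) / 2 := by linarith
  obtain ⟨φ, hφ, ⟨M, hM⟩, hvar⟩ := exists_variational_ge hu hu0 hui (by rwa [hγ]) hδ
  rw [hγ, hu1, integral_congr_ae hlu, integral_sub hlp hlg] at hvar
  have hlpμ : ∫ x, Real.log (p x) ∂μ = ∫ x, p x * Real.log (p x) := by
    rw [hμp, integral_withDensity_ofReal hp hp0]
  have hM0 : 0 ≤ M := (abs_nonneg _).trans (hM 0)
  -- Adding log g returns to Lebesgue measure: e^ψ dx = e^φ dγ. The growth of ψ is at most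
  -- quadratic, so its integral against the flow converges as s → 0.
  set ψ := fun x => Real.log (g x) + φ x
  have hψc : Continuous ψ := ((continuous_heatKernel 1).log fun x => (hg x).ne').add hφ
  have hψb : ∀ x, |ψ x| ≤ (C + M) * (1 + normSq x) := fun x => by
    have hq := normSq_nonneg x
    refine (abs_add_le _ _).trans ?_
    nlinarith [hC x, hM x, mul_nonneg hM0 hq]
  have hψe : ∀ x, Real.exp (ψ x) = g x * Real.exp (φ x) := fun x => by
    rw [Real.exp_add, Real.exp_log (hg x)]
  have hφe : Integrable (fun x => Real.exp (φ x)) γ :=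
    Integrable.of_bound hφ.measurable.exp.aestronglyMeasurable (Real.exp M)
      (ae_of_all _ fun x => by
        rw [Real.norm_of_nonneg (Real.exp_pos _).le]
        exact Real.exp_le_exp.2 (le_of_abs_le (hM x)))
  have hψi : Integrable fun x => Real.exp (ψ x) := by
    simp only [hψe]
    exact (integrable_withDensity_ofReal hgm fun x => (hg x).le).1 hφe
  have hψint : ∫ x, Real.exp (ψ x) = ∫ x, Real.exp (φ x) ∂γ := by
    rw [integral_withDensity_ofReal hgm fun x => (hg x).le]
    simp only [hψe]
  have hφi : Integrable φ μ :=
    Integrable.of_bound hφ.measurable.aestronglyMeasurable M (ae_of_all _ hM)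
  have hlim := ((tendsto_integral_heatFlow_mul hμ hψc hψb).neg.sub_const 1).add_const
    (∫ x, Real.exp (ψ x))
  rw [integral_add hlg hφi, hψint] at hlim
  have hlt := hlim.eventually_lt_const (show _ < a by linarith)
  filter_upwards [hlt, self_mem_nhdsWithin] with s h1 hs
  have h2 := heatEntropy_le hs hμ hψc.measurable hψb hψi
  rw [hψint] at h2
  exact h2.trans_lt h1

end EntropyBounds

/-! ### From the heat flow to the Ornstein-Uhlenbeck flow -/

section OrnsteinUhlenbeck

variable {ι : Type*} [Fintype ι] {d : ℕ} {μ : Measure (ι → EuclideanSpace ℝ (Fin d))}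

/-! ### Scaling -/

theorem heatFlow_map_smul {c s : ℝ} (hc : 0 < c) (hs : 0 < s) (y : ι → EuclideanSpace ℝ (Fin d)) :
    heatFlow (μ.map fun x => c • x) (c ^ 2 * s) (c • y) =
      (c ^ blockDim ι d)⁻¹ * heatFlow μ s y := by
  have hm : Measurable fun x => heatKernel (c ^ 2 * s) (c • y - x) := by fun_prop
  rw [heatFlow, integral_map (by fun_prop) hm.aestronglyMeasurable, heatFlow, ← integral_const_mul]
  simp only [← smul_sub, heatKernel_smul hc hs]

theorem heatGrad_map_smul {c s : ℝ} (hc : 0 < c) (hs : 0 < s) (i : ι) (k : Fin d)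
    (y : ι → EuclideanSpace ℝ (Fin d)) :
    heatGrad (μ.map fun x => c • x) (c ^ 2 * s) i k (c • y) =
      c⁻¹ * (c ^ blockDim ι d)⁻¹ * heatGrad μ s i k y := by
  have hm : Measurable fun x => gradKernel (c ^ 2 * s) i k (c • y - x) := by fun_prop
  rw [heatGrad, integral_map (by fun_prop) hm.aestronglyMeasurable, heatGrad, ← integral_const_mul]
  congr 1
  ext x
  rw [← smul_sub, gradKernel, gradKernel, heatKernel_smul hc hs]
  simp only [Pi.smul_apply, PiLp.smul_apply, smul_eq_mul]
  field_simp

variable [IsProbabilityMeasure μ]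

/-! ### Fisher information along the flow -/

/-- De Bruijn's identity in integrated form, in the time scale of the Ornstein-Uhlenbeck flow. -/
theorem integral_heatFisher_exp {p : (ι → EuclideanSpace ℝ (Fin d)) → ℝ}
    (hμ : Integrable normSq μ) (hp : Measurable p) (hp0 : ∀ x, 0 ≤ p x)
    (hμp : μ = volume.withDensity fun x => ENNReal.ofReal (p x))
    (hlog : Integrable fun x => p x * Real.log (p x)) {T : ℝ} (hT : 0 < T) :
    IntervalIntegrable (fun s => Real.exp (2 * s) * heatFisher μ (Real.exp (2 * s) - 1))
      volume 0 T ∧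
    ∫ s in (0 : ℝ)..T, Real.exp (2 * s) * heatFisher μ (Real.exp (2 * s) - 1) =
      heatEntropy μ (Real.exp (2 * T) - 1) + ∫ x, p x * Real.log (p x) := by
  have hpos : ∀ {s : ℝ}, 0 < s → 0 < Real.exp (2 * s) - 1 := fun {s} hs => by
    have := Real.one_lt_exp_iff.2 (by linarith : 0 < 2 * s)
    linarith
  set H0 := -∫ x, p x * Real.log (p x)
  -- At variance 0 the kernel formula has no meaning as a density, so the entropy is extended to s ≤
  -- 0 by the entropy of p, its limit.
  set g : ℝ → ℝ := fun s => if s ≤ 0 then H0 else heatEntropy μ (Real.exp (2 * s) - 1)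
  have hg : ∀ {s : ℝ}, 0 < s → g s = heatEntropy μ (Real.exp (2 * s) - 1) := fun hs =>
    if_neg (not_le.2 hs)
  have hg0 : g 0 = H0 := if_pos le_rfl
  have hderiv : ∀ s, 0 < s → HasDerivAt g
      (Real.exp (2 * s) * heatFisher μ (Real.exp (2 * s) - 1)) s := fun s hs => by
    have h1 : HasDerivAt (fun s => Real.exp (2 * s) - 1) (Real.exp (2 * s) * 2) s := by
      have := (((hasDerivAt_id s).const_mul 2).exp).sub_const 1
      simpa using this
    have h2 := (hasDerivAt_heatEntropy (hpos hs) hμ).comp s h1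
    have h3 : HasDerivAt (fun s => heatEntropy μ (Real.exp (2 * s) - 1))
        (Real.exp (2 * s) * heatFisher μ (Real.exp (2 * s) - 1)) s :=
      h2.congr_deriv (by ring)
    refine h3.congr_of_eventuallyEq ?_
    filter_upwards [lt_mem_nhds hs] with r hr
    exact hg hr
  have hcont : ContinuousOn g (Set.Icc 0 T) := by
    intro s hs
    rcases hs.1.eq_or_lt with h0 | h0
    · subst h0
      have hlim : Tendsto g (𝓝[>] 0) (𝓝 (g 0)) := by
        rw [hg0]
        have h1 : Tendsto (fun s : ℝ => Real.exp (2 * s) - 1) (𝓝[>] 0) (𝓝[>] 0) := by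
          refine tendsto_nhdsWithin_iff.2 ⟨?_, ?_⟩
          · have : Continuous fun s : ℝ => Real.exp (2 * s) - 1 := by fun_prop
            have := (this.tendsto 0).mono_left (nhdsWithin_le_nhds (s := Set.Ioi 0))
            simpa using this
          · filter_upwards [self_mem_nhdsWithin] with r hr
            exact hpos hr
        refine ((tendsto_heatEntropy_zero hμ hp hp0 hμp hlog).comp h1).congr' ?_
        filter_upwards [self_mem_nhdsWithin] with r hr
        exact (hg hr).symm
      have hci : ContinuousWithinAt g (Set.Ici 0) 0 := continuousWithinAt_Ioi_iff_Ici.1 hlim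
      exact hci.mono fun r hr => hr.1
    · exact (hderiv s h0).continuousAt.continuousWithinAt
  -- No bound on the Fisher information near time 0 is needed: a nonnegative derivative of a
  -- function continuous up to the endpoint is integrable.
  have hint : IntervalIntegrable (fun s => Real.exp (2 * s) * heatFisher μ (Real.exp (2 * s) - 1))
      volume 0 T := by
    rw [intervalIntegrable_iff_integrableOn_Ioc_of_le hT.le]
    exact intervalIntegral.integrableOn_deriv_of_nonneg hcont (fun s hs => hderiv s hs.1)
      fun s hs => mul_nonneg (Real.exp_pos _).le (heatFisher_nonneg (hpos hs.1))
  refine ⟨hint, ?_⟩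
  rw [intervalIntegral.integral_eq_sub_of_hasDerivAt_of_le hT.le hcont
    (fun s hs => hderiv s hs.1) hint, hg hT, hg0, sub_neg_eq_add]

variable (μ) in
/-- The entries of the Fisher information matrix of the heat flow. -/
noncomputable def heatFisherMatrix (s : ℝ) (i j : ι) : ℝ :=
  ∫ y, ∑ k, heatGrad μ s i k y * heatGrad μ s j k y / heatFlow μ s y

theorem integrable_heatGrad_mul_div {s : ℝ} (hs : 0 < s) (i j : ι) (k : Fin d) :
    Integrable fun y => heatGrad μ s i k y * heatGrad μ s j k y / heatFlow μ s y := by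
  refine (((integrable_sq_heatGrad_div (μ := μ) hs i k).add
    (integrable_sq_heatGrad_div (μ := μ) hs j k)).div_const 2).mono' ?_ (ae_of_all _ fun y => ?_)
  · exact (((stronglyMeasurable_heatGrad μ s i k).measurable.mul
      (stronglyMeasurable_heatGrad μ s j k).measurable).div
      (stronglyMeasurable_heatFlow μ s).measurable).aestronglyMeasurable
  · have hF := heatFlow_pos (μ := μ) hs y
    rw [norm_div, Real.norm_of_nonneg hF.le, Pi.add_apply, ← add_div, div_div, mul_comm _ (2 : ℝ),
      ← div_div]
    refine div_le_div_of_nonneg_right ?_ hF.le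
    rw [Real.norm_eq_abs, abs_le]
    constructor <;> nlinarith [sq_nonneg (heatGrad μ s i k y + heatGrad μ s j k y),
      sq_nonneg (heatGrad μ s i k y - heatGrad μ s j k y)]

theorem heatFisher_eq_sum {s : ℝ} (hs : 0 < s) :
    heatFisher μ s = ∑ i, heatFisherMatrix μ s i i := by
  simp only [heatFisher, heatFisherMatrix, ← sq]
  exact integral_finsetSum _ fun i _ => integrable_finsetSum _ fun k _ =>
    integrable_sq_heatGrad_div hs i k

theorem heatFisherMatrix_self_nonneg {s : ℝ} (hs : 0 < s) (i : ι) :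
    0 ≤ heatFisherMatrix μ s i i :=
  integral_nonneg fun y => Finset.sum_nonneg fun _ _ =>
    div_nonneg (mul_self_nonneg _) (heatFlow_pos hs y).le

/-- By 2|ab| ≤ a² + b², off-diagonal entries are controlled by diagonal ones, hence by the trace.
Integrability in time of the whole matrix then follows from that of `heatFisher`. -/
theorem abs_heatFisherMatrix_le {s : ℝ} (hs : 0 < s) (i j : ι) :
    |heatFisherMatrix μ s i j| ≤ heatFisher μ s := by
  have h1 : |heatFisherMatrix μ s i j| ≤
      (heatFisherMatrix μ s i i + heatFisherMatrix μ s j j) / 2 := by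
    have hi : ∀ i, Integrable fun y => ∑ k, heatGrad μ s i k y * heatGrad μ s i k y / heatFlow μ s y :=
      fun i => integrable_finsetSum _ fun k _ => integrable_heatGrad_mul_div hs i i k
    rw [heatFisherMatrix, heatFisherMatrix, heatFisherMatrix, ← integral_add (hi i) (hi j),
      ← integral_div]
    refine norm_integral_le_of_norm_le
      (f := fun y => ∑ k, heatGrad μ s i k y * heatGrad μ s j k y / heatFlow μ s y) (((hi i).add (hi j)).div_const 2) (ae_of_all _ fun y => ?_)
    rw [← Finset.sum_add_distrib, Finset.sum_div]
    refine (norm_sum_le _ _).trans (Finset.sum_le_sum fun k _ => ?_)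
    have hF := heatFlow_pos (μ := μ) hs y
    rw [norm_div, Real.norm_of_nonneg hF.le, ← add_div, div_div, mul_comm _ (2 : ℝ), ← div_div]
    refine div_le_div_of_nonneg_right ?_ hF.le
    rw [Real.norm_eq_abs, abs_le]
    constructor <;> nlinarith [sq_nonneg (heatGrad μ s i k y + heatGrad μ s j k y),
      sq_nonneg (heatGrad μ s i k y - heatGrad μ s j k y)]
  have h2 : ∀ i, heatFisherMatrix μ s i i ≤ heatFisher μ s := fun i => by
    rw [heatFisher_eq_sum hs]
    exact Finset.single_le_sum (f := fun i => heatFisherMatrix μ s i i)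
      (fun i _ => heatFisherMatrix_self_nonneg hs i) (Finset.mem_univ i)
  linarith [h2 i, h2 j]

theorem measurable_heatFisherMatrix (i j : ι) :
    Measurable fun s => heatFisherMatrix μ s i j := by
  have h : StronglyMeasurable fun z : ℝ × (ι → EuclideanSpace ℝ (Fin d)) =>
      ∑ k, heatGrad μ z.1 i k z.2 * heatGrad μ z.1 j k z.2 / heatFlow μ z.1 z.2 := by
    refine Finset.stronglyMeasurable_fun_sum _ fun k _ => ?_
    exact (((stronglyMeasurable_heatGrad_uncurry μ i k).measurable.mul
      (stronglyMeasurable_heatGrad_uncurry μ j k).measurable).div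
      (stronglyMeasurable_heatFlow_uncurry μ).measurable).stronglyMeasurable
  exact h.integral_prod_right.measurable

theorem integral_scaled {c : ℝ} (hc : 0 < c) (f : (ι → EuclideanSpace ℝ (Fin d)) → ℝ) :
    ∫ y, f y = c ^ blockDim ι d * ∫ y, f (c • y) := by
  rw [Measure.integral_comp_smul_of_nonneg _ _ _ (hR := hc.le), finrank_block, smul_eq_mul,
    ← mul_assoc, mul_inv_cancel₀ (by positivity), one_mul]

theorem heatFisherMatrix_map_smul {c s : ℝ} (hc : 0 < c) (hs : 0 < s) (i j : ι) :
    heatFisherMatrix (μ.map fun x => c • x) (c ^ 2 * s) i j =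
      (c ^ 2)⁻¹ * heatFisherMatrix μ s i j := by
  rw [heatFisherMatrix, integral_scaled hc, heatFisherMatrix, ← integral_const_mul,
    ← integral_const_mul]
  congr 1
  ext y
  rw [Finset.mul_sum, Finset.mul_sum]
  refine Finset.sum_congr rfl fun k _ => ?_
  rw [heatFlow_map_smul hc hs, heatGrad_map_smul hc hs, heatGrad_map_smul hc hs]
  have hF := heatFlow_pos (μ := μ) hs y
  field_simp

theorem heatEntropy_map_smul {c s : ℝ} (hc : 0 < c) (hs : 0 < s) (hμ : Integrable normSq μ) :
    heatEntropy (μ.map fun x => c • x) (c ^ 2 * s) =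
      heatEntropy μ s + blockDim ι d * Real.log c := by
  rw [heatEntropy, integral_scaled hc, heatEntropy, ← integral_const_mul]
  have h : ∀ y, c ^ blockDim ι d * (heatFlow (μ.map fun x => c • x) (c ^ 2 * s) (c • y) *
      Real.log (heatFlow (μ.map fun x => c • x) (c ^ 2 * s) (c • y))) =
      heatFlow μ s y * Real.log (heatFlow μ s y) -
        blockDim ι d * Real.log c * heatFlow μ s y := fun y => by
    have hF := heatFlow_pos (μ := μ) hs y
    rw [heatFlow_map_smul hc hs, Real.log_mul (by positivity) hF.ne', Real.log_inv, Real.log_pow]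
    field_simp
    ring
  simp only [h]
  rw [integral_sub (integrable_heatFlow_mul_log hs hμ) ((integrable_heatFlow hs).const_mul _),
    integral_const_mul, integral_heatFlow hs]
  ring

end OrnsteinUhlenbeck

/-! ### Densities and entropies of random vectors -/

theorem measurable_density {Ω E : Type*} [MeasurableSpace Ω] [MeasureSpace E] (P : Measure Ω)
    (Y : Ω → E) : Measurable (density P Y) :=
  (Measure.measurable_rnDeriv _ _).ennreal_toReal

section Density

variable {Ω : Type*} [MeasurableSpace Ω] {P : Measure Ω} {E : Type*} [MeasureSpace E]
  [SigmaFinite (volume : Measure E)]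

theorem density_ae_eq {Y : Ω → E} {p : E → ℝ} (hp : Measurable p) (hp0 : ∀ x, 0 ≤ p x)
    (hY : P.map Y = volume.withDensity fun x => ENNReal.ofReal (p x)) :
    density P Y =ᵐ[volume] p := by
  filter_upwards [Measure.rnDeriv_withDensity volume hp.ennreal_ofReal] with x hx
  rw [density, hY, hx, ENNReal.toReal_ofReal (hp0 x)]

theorem entropy_eq {Y : Ω → E} {p : E → ℝ} (hp : Measurable p) (hp0 : ∀ x, 0 ≤ p x)
    (hY : P.map Y = volume.withDensity fun x => ENNReal.ofReal (p x)) :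
    entropy P Y = -∫ x, p x * Real.log (p x) := by
  rw [entropy]
  congr 1
  exact integral_congr_ae ((density_ae_eq hp hp0 hY).mono fun x hx => by simp only [hx])

theorem hasFiniteEntropy_of_withDensity {Y : Ω → E} {p : E → ℝ} (hp : Measurable p)
    (hp0 : ∀ x, 0 ≤ p x) (hY : P.map Y = volume.withDensity fun x => ENNReal.ofReal (p x))
    (hlog : Integrable fun x => p x * Real.log (p x)) : HasFiniteEntropy P Y :=
  ⟨hY ▸ withDensity_absolutelyContinuous _ _,
    hlog.congr ((density_ae_eq hp hp0 hY).mono fun x hx => by simp only [hx])⟩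

theorem map_eq_withDensity_density [IsFiniteMeasure P] {Y : Ω → E} (hY : P.map Y ≪ volume) :
    P.map Y = volume.withDensity fun x => ENNReal.ofReal (density P Y x) := by
  conv_lhs => rw [← Measure.withDensity_rnDeriv_eq _ _ hY]
  refine withDensity_congr_ae ?_
  filter_upwards [Measure.rnDeriv_lt_top (P.map Y) volume] with x hx
  exact (ENNReal.ofReal_toReal hx.ne).symm

variable {F : Type*} [MeasureSpace F] [SigmaFinite (volume : Measure F)]

/-- Invariance of the entropy under volume preserving equivalences. -/
theorem entropy_comp_equiv [IsFiniteMeasure P] (e : E ≃ᵐ F) (he : MeasurePreserving e)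
    {Y : Ω → E} (hYm : Measurable Y) (hY : HasFiniteEntropy P Y) :
    HasFiniteEntropy P (fun ω => e (Y ω)) ∧ entropy P (fun ω => e (Y ω)) = entropy P Y := by
  have hm := measurable_density P Y
  have hlaw : P.map (fun ω => e (Y ω)) =
      volume.withDensity fun x => ENNReal.ofReal (density P Y (e.symm x)) := by
    change P.map (e ∘ Y) = _
    rw [← Measure.map_map e.measurable hYm, map_eq_withDensity_density hY.1,
      map_withDensity_of_measurePreserving e he]
    rfl
  have h0 : ∀ x, 0 ≤ density P Y (e.symm x) := fun x => ENNReal.toReal_nonneg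
  have he' := he.symm e
  refine ⟨hasFiniteEntropy_of_withDensity (hm.comp e.symm.measurable) h0 hlaw ?_, ?_⟩
  · exact (he'.integrable_comp_emb e.symm.measurableEmbedding).2 hY.2
  · rw [entropy_eq (hm.comp e.symm.measurable) h0 hlaw, entropy]
    congr 1
    exact he'.integral_comp e.symm.measurableEmbedding
      fun x => density P Y x * Real.log (density P Y x)

end Density

/-! ### Random vectors with heat flow densities -/

section HeatLaw

variable {Ω : Type*} [MeasurableSpace Ω] {P : Measure Ω} {ι : Type*} [Fintype ι] {d : ℕ}
  {Y : Ω → ι → EuclideanSpace ℝ (Fin d)} {μ : Measure (ι → EuclideanSpace ℝ (Fin d))}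
  [IsProbabilityMeasure μ] {s : ℝ}

theorem entropy_eq_heatEntropy (hs : 0 < s)
    (hY : P.map Y = volume.withDensity fun x => ENNReal.ofReal (heatFlow μ s x)) :
    entropy P Y = heatEntropy μ s :=
  entropy_eq (measurable_heatFlow s) (fun x => (heatFlow_pos hs x).le) hY

theorem hasFiniteEntropy_of_heatFlow (hs : 0 < s) (hμ : Integrable normSq μ)
    (hY : P.map Y = volume.withDensity fun x => ENNReal.ofReal (heatFlow μ s x)) :
    HasFiniteEntropy P Y :=
  hasFiniteEntropy_of_withDensity (measurable_heatFlow s) (fun x => (heatFlow_pos hs x).le) hY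
    (integrable_heatFlow_mul_log hs hμ)

theorem integral_comp_heatLaw (hYm : Measurable Y) (hs : 0 < s)
    (hY : P.map Y = volume.withDensity fun x => ENNReal.ofReal (heatFlow μ s x))
    {f : (ι → EuclideanSpace ℝ (Fin d)) → ℝ} (hf : Measurable f) :
    ∫ ω, f (Y ω) ∂P = ∫ y, heatFlow μ s y * f y := by
  rw [← integral_withDensity_ofReal (measurable_heatFlow s) (fun x => (heatFlow_pos hs x).le),
    ← hY, integral_map hYm.aemeasurable hf.aestronglyMeasurable]

theorem integrable_comp_heatLaw (hYm : Measurable Y) (hs : 0 < s)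
    (hY : P.map Y = volume.withDensity fun x => ENNReal.ofReal (heatFlow μ s x))
    {f : (ι → EuclideanSpace ℝ (Fin d)) → ℝ} (hf : Measurable f) :
    Integrable (fun ω => f (Y ω)) P ↔ Integrable fun y => heatFlow μ s y * f y := by
  rw [← integrable_withDensity_ofReal (measurable_heatFlow s) (fun x => (heatFlow_pos hs x).le),
    ← hY, integrable_map_measure hf.aestronglyMeasurable hYm.aemeasurable]
  rfl

theorem measurable_heatGrad (i : ι) (k : Fin d) : Measurable (heatGrad μ s i k) :=
  (stronglyMeasurable_heatGrad μ s i k).measurable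

theorem measurable_score_mul (i j : ι) (k : Fin d) : Measurable fun y =>
    heatGrad μ s i k y / heatFlow μ s y * (heatGrad μ s j k y / heatFlow μ s y) :=
  ((measurable_heatGrad i k).div (measurable_heatFlow s)).mul
    ((measurable_heatGrad j k).div (measurable_heatFlow s))

theorem heatFlow_mul_score_mul (hs : 0 < s) (i j : ι) (k : Fin d)
    (y : ι → EuclideanSpace ℝ (Fin d)) :
    heatFlow μ s y * (heatGrad μ s i k y / heatFlow μ s y *
      (heatGrad μ s j k y / heatFlow μ s y)) =
      heatGrad μ s i k y * heatGrad μ s j k y / heatFlow μ s y := by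
  have := (heatFlow_pos (μ := μ) hs y).ne'
  field_simp

theorem integrable_score_mul (hYm : Measurable Y) (hs : 0 < s)
    (hY : P.map Y = volume.withDensity fun x => ENNReal.ofReal (heatFlow μ s x)) (i j : ι)
    (k : Fin d) :
    Integrable (fun ω => heatGrad μ s i k (Y ω) / heatFlow μ s (Y ω) *
      (heatGrad μ s j k (Y ω) / heatFlow μ s (Y ω))) P := by
  refine (integrable_comp_heatLaw hYm hs hY (measurable_score_mul i j k)).2 ?_
  simp only [heatFlow_mul_score_mul hs]
  exact integrable_heatGrad_mul_div hs i j k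

variable [DecidableEq ι]

theorem isC1Density_heatFlow (hs : 0 < s)
    (hY : P.map Y = volume.withDensity fun x => ENNReal.ofReal (heatFlow μ s x)) :
    IsC1Density P Y (heatFlow μ s) :=
  ⟨contDiff_heatFlow hs, fun x => (heatFlow_pos hs x).le, hY⟩

theorem blockGrad_heatFlow (hs : 0 < s) (i : ι) (k : Fin d) (y : ι → EuclideanSpace ℝ (Fin d)) :
    blockGrad (heatFlow μ s) i y k = heatGrad μ s i k y :=
  blockGrad_apply (g := fun i k => heatGrad μ s i k y) (hasFDerivAt_heatFlow hs y) i k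

theorem inner_score_heatFlow (hs : 0 < s)
    (hY : P.map Y = volume.withDensity fun x => ENNReal.ofReal (heatFlow μ s x)) (i j : ι)
    (y : ι → EuclideanSpace ℝ (Fin d)) :
    inner ℝ (score P Y i y) (score P Y j y) =
      ∑ k, heatGrad μ s i k y / heatFlow μ s y * (heatGrad μ s j k y / heatFlow μ s y) := by
  rw [PiLp.inner_apply]
  refine Finset.sum_congr rfl fun k _ => ?_
  simp only [score, c1Density_eq (isC1Density_heatFlow hs hY), PiLp.neg_apply, PiLp.smul_apply,
    blockGrad_heatFlow hs, smul_eq_mul, RCLike.inner_apply, conj_trivial]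
  ring

theorem fisherMatrix_eq (hYm : Measurable Y) (hs : 0 < s)
    (hY : P.map Y = volume.withDensity fun x => ENNReal.ofReal (heatFlow μ s x)) (i j : ι) :
    fisherMatrix P Y i j = heatFisherMatrix μ s i j := by
  simp only [fisherMatrix, inner_score_heatFlow hs hY]
  have hm : Measurable fun y : ι → EuclideanSpace ℝ (Fin d) => ∑ k, heatGrad μ s i k y /
      heatFlow μ s y * (heatGrad μ s j k y / heatFlow μ s y) :=
    Finset.measurable_fun_sum _ fun k _ => measurable_score_mul i j k
  rw [integral_comp_heatLaw hYm hs hY hm, heatFisherMatrix]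
  simp only [Finset.mul_sum, heatFlow_mul_score_mul hs]

theorem hasFisherMatrix_of_heatFlow (hYm : Measurable Y) (hs : 0 < s)
    (hY : P.map Y = volume.withDensity fun x => ENNReal.ofReal (heatFlow μ s x)) :
    HasFisherMatrix P Y := by
  refine ⟨⟨_, isC1Density_heatFlow hs hY⟩, fun i j => ?_⟩
  simp only [inner_score_heatFlow hs hY]
  exact integrable_finsetSum _ fun k _ => integrable_score_mul hYm hs hY i j k

theorem fisherInfo_integrand_eq (hs : 0 < s)
    (hY : P.map Y = volume.withDensity fun x => ENNReal.ofReal (heatFlow μ s x))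
    (y : ι → EuclideanSpace ℝ (Fin d)) :
    (∑ i, ‖blockGrad (c1Density P Y) i y‖ ^ 2) / c1Density P Y y =
      ∑ i, ∑ k, heatGrad μ s i k y ^ 2 / heatFlow μ s y := by
  simp only [c1Density_eq (isC1Density_heatFlow hs hY), EuclideanSpace.real_norm_sq_eq,
    blockGrad_heatFlow hs, Finset.sum_div]

theorem fisherInfo_eq (hs : 0 < s)
    (hY : P.map Y = volume.withDensity fun x => ENNReal.ofReal (heatFlow μ s x)) :
    fisherInfo P Y = heatFisher μ s := by
  simp only [fisherInfo, fisherInfo_integrand_eq hs hY, heatFisher]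

theorem hasFisherInfo_of_heatFlow (hs : 0 < s)
    (hY : P.map Y = volume.withDensity fun x => ENNReal.ofReal (heatFlow μ s x)) :
    HasFisherInfo P Y := by
  refine ⟨⟨_, isC1Density_heatFlow hs hY⟩, ?_⟩
  simp only [fisherInfo_integrand_eq hs hY]
  exact integrable_finsetSum _ fun i _ => integrable_finsetSum _ fun k _ =>
    integrable_sq_heatGrad_div hs i k

end HeatLaw

/-! ### Gaussian perturbations -/

section Perturbation

variable {Ω : Type*} [MeasurableSpace Ω] {P : Measure Ω} {ι : Type*} [Fintype ι] {d : ℕ}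
  {X Z : Ω → ι → EuclideanSpace ℝ (Fin d)}

theorem memLp_coord_of_blockGaussian (hZ : Measurable Z) (hZ_law : P.map Z = blockGaussian ι d)
    (i : ι) (k : Fin d) : MemLp (fun ω => Z ω i k) 2 P := by
  have hm : Measurable fun ω => Z ω i k := by fun_prop
  refine (memLp_two_iff_integrable_sq hm.aestronglyMeasurable).2 ?_
  have h1 : Integrable (fun x : ι → EuclideanSpace ℝ (Fin d) => x i k ^ 2) (P.map Z) := by
    rw [hZ_law]
    exact integrable_comp_eval (μ := fun _ : ι => stdGaussian (EuclideanSpace ℝ (Fin d)))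
      (i := i) (integrable_sq_coord_stdGaussian k)
  exact h1.comp_measurable hZ

variable [IsProbabilityMeasure P]

theorem map_prod_eq (hX : Measurable X) (hZ : Measurable Z) (hXZ : IndepFun X Z P)
    (hZ_law : P.map Z = blockGaussian ι d) :
    P.map (fun ω => (X ω, Z ω)) = (P.map X).prod (blockGaussian ι d) := by
  rw [← hZ_law]
  exact (indepFun_iff_map_prod_eq_prod_map_map hX.aemeasurable hZ.aemeasurable).1 hXZ

theorem map_add_sqrt_smul_eq (hX : Measurable X) (hZ : Measurable Z) (hXZ : IndepFun X Z P)
    (hZ_law : P.map Z = blockGaussian ι d) {s : ℝ} (hs : 0 < s) :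
    P.map (fun ω => X ω + √s • Z ω) =
      volume.withDensity fun x => ENNReal.ofReal (heatFlow (P.map X) s x) := by
  have : IsProbabilityMeasure (P.map X) := Measure.isProbabilityMeasure_map hX.aemeasurable
  rw [← map_add_sqrt_smul _ hs, ← map_prod_eq hX hZ hXZ hZ_law, Measure.map_map (by fun_prop)
    (by fun_prop)]
  rfl

theorem map_prod_sqrt_smul_eq (hX : Measurable X) (hZ : Measurable Z) (hXZ : IndepFun X Z P)
    (hZ_law : P.map Z = blockGaussian ι d) {s : ℝ} (hs : 0 < s) :
    P.map (fun ω => (X ω, √s • Z ω)) =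
      ((P.map X).prod volume).withDensity fun z => ENNReal.ofReal (heatKernel s z.2) := by
  have hprob : IsProbabilityMeasure (P.map X) := Measure.isProbabilityMeasure_map hX.aemeasurable
  have hk : Measurable fun x : ι → EuclideanSpace ℝ (Fin d) => ENNReal.ofReal (heatKernel s x) :=
    (measurable_heatKernel s).ennreal_ofReal
  have hscale := map_smul_pi_stdGaussian (ι := ι) (d := d) (Real.sqrt_pos.2 hs)
  rw [Real.sq_sqrt hs.le] at hscale
  have h1 : P.map (fun ω => (X ω, √s • Z ω)) =
      (P.map fun ω => (X ω, Z ω)).map (Prod.map id fun x => √s • x) := by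
    rw [Measure.map_map (by fun_prop) (by fun_prop)]
    rfl
  have hm : Measurable fun x : ι → EuclideanSpace ℝ (Fin d) => √s • x := by fun_prop
  have : IsProbabilityMeasure ((blockGaussian ι d).map fun x => √s • x) :=
    Measure.isProbabilityMeasure_map hm.aemeasurable
  have h2 := Measure.map_prod_map (P.map X) (blockGaussian ι d) measurable_id hm
  rw [Measure.map_id] at h2
  rw [h1, map_prod_eq hX hZ hXZ hZ_law, ← h2, ← prod_withDensity_right hk, ← hscale]
  rfl

/-- Gaussian integration by parts in terms of the Gaussian kernel. -/
theorem integral_prod_heatKernel_mul {μ : Measure (ι → EuclideanSpace ℝ (Fin d))}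
    [IsProbabilityMeasure μ] {s : ℝ} (hs : 0 < s) (ψ : (ι → EuclideanSpace ℝ (Fin d)) → ℝ)
    (i : ι) (k : Fin d)
    (hi : Integrable (fun z => heatKernel s z.2 * (ψ (z.1 + z.2) * z.2 i k)) (μ.prod volume)) :
    ∫ z, heatKernel s z.2 * (ψ (z.1 + z.2) * z.2 i k) ∂(μ.prod volume) =
      -s * ∫ y, ψ y * heatGrad μ s i k y := by
  set g : (ι → EuclideanSpace ℝ (Fin d)) × (ι → EuclideanSpace ℝ (Fin d)) → ℝ :=
    fun z => -s * (ψ z.2 * gradKernel s i k (z.2 - z.1)) with hg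
  -- The Gaussian identity z·K(z) = −s·∂K(z) removes the coordinate of the noise, and the shear
  -- turns z₁ + z₂ into the free variable y.
  have hfg : ∀ z : (ι → EuclideanSpace ℝ (Fin d)) × (ι → EuclideanSpace ℝ (Fin d)),
      heatKernel s z.2 * (ψ (z.1 + z.2) * z.2 i k) = g (z.1, z.1 + z.2) := fun z => by
    simp only [hg, gradKernel, add_sub_cancel_left]
    field_simp
  simp only [hfg] at hi ⊢
  rw [integrable_prod_shear] at hi
  rw [integral_prod_shear g, integral_prod_symm _ hi]
  simp only [hg, integral_const_mul]
  rfl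

/-- The score of a Gaussian perturbation is a conditional expectation of the noise. -/
theorem integral_mul_score (hX : Measurable X) (hZ : Measurable Z) (hXZ : IndepFun X Z P)
    (hZ_law : P.map Z = blockGaussian ι d) {s : ℝ} (hs : 0 < s)
    {ψ : (ι → EuclideanSpace ℝ (Fin d)) → ℝ} (hψ : Measurable ψ)
    (hψ2 : MemLp (fun ω => ψ (X ω + √s • Z ω)) 2 P) (i : ι) (k : Fin d) :
    Integrable (fun ω => ψ (X ω + √s • Z ω) * Z ω i k) P ∧
    ∫ ω, ψ (X ω + √s • Z ω) * Z ω i k ∂P =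
      -√s * ∫ y, ψ y * heatGrad (P.map X) s i k y := by
  have hprob : IsProbabilityMeasure (P.map X) := Measure.isProbabilityMeasure_map hX.aemeasurable
  have hr : 0 < √s := Real.sqrt_pos.2 hs
  have hint : Integrable (fun ω => ψ (X ω + √s • Z ω) * Z ω i k) P :=
    hψ2.integrable_mul (memLp_coord_of_blockGaussian hZ hZ_law i k)
  refine ⟨hint, ?_⟩
  have hlaw := map_prod_sqrt_smul_eq hX hZ hXZ hZ_law hs
  have hf : Measurable fun z : (ι → EuclideanSpace ℝ (Fin d)) × (ι → EuclideanSpace ℝ (Fin d)) =>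
      ψ (z.1 + z.2) * z.2 i k := by fun_prop
  have hk : Measurable fun z : (ι → EuclideanSpace ℝ (Fin d)) × (ι → EuclideanSpace ℝ (Fin d)) =>
      heatKernel s z.2 := by fun_prop
  have hmap : Measurable fun ω => (X ω, √s • Z ω) := by fun_prop
  have hfω : ∀ ω, ψ (X ω + √s • Z ω) * (√s • Z ω) i k = √s * (ψ (X ω + √s • Z ω) * Z ω i k) :=
    fun ω => by
      simp only [Pi.smul_apply, PiLp.smul_apply, smul_eq_mul]
      ring
  have hi := (integrable_map_measure (μ := P) hf.aestronglyMeasurable hmap.aemeasurable).2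
    ((hint.const_mul √s).congr (ae_of_all _ fun ω => (hfω ω).symm))
  have he := integral_map (μ := P) hmap.aemeasurable hf.aestronglyMeasurable
  rw [hlaw, integrable_withDensity_ofReal hk (fun z => (heatKernel_pos s z.2).le)] at hi
  rw [hlaw, integral_withDensity_ofReal hk (fun z => (heatKernel_pos s z.2).le),
    integral_prod_heatKernel_mul hs ψ i k hi] at he
  simp only [hfω, integral_const_mul] at he
  -- The noise entered as √s·Z, so one factor √s is divided out and −s becomes −√s.
  have h2 : √s * (√s * ∫ y, ψ y * heatGrad (P.map X) s i k y) =
      s * ∫ y, ψ y * heatGrad (P.map X) s i k y := by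
    rw [← mul_assoc, Real.mul_self_sqrt hs.le]
  refine mul_left_cancel₀ hr.ne' ?_
  linarith

end Perturbation

/-! ### The Blachman-Stam inequality -/

section BlachmanStam

variable {ι : Type*} [Fintype ι] {d : ℕ}

/-- The weighted sum of the blocks, as a vector with one block. -/
noncomputable def blockSum (lam : ι → ℝ) (y : ι → EuclideanSpace ℝ (Fin d)) :
    Unit → EuclideanSpace ℝ (Fin d) :=
  fun _ => ∑ i, lam i • y i

theorem blockSum_add_smul (lam : ι → ℝ) (x z : ι → EuclideanSpace ℝ (Fin d)) (c : ℝ) :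
    blockSum lam (x + c • z) = blockSum lam x + c • blockSum lam z := by
  funext j
  simp only [blockSum, Pi.add_apply, Pi.smul_apply, smul_add, Finset.sum_add_distrib,
    Finset.smul_sum]
  congr 1
  exact Finset.sum_congr rfl fun i _ => smul_comm _ _ _

@[fun_prop]
theorem measurable_blockSum (lam : ι → ℝ) :
    Measurable (blockSum lam : (ι → EuclideanSpace ℝ (Fin d)) → _) := by
  unfold blockSum
  fun_prop

theorem blockSum_coord (lam : ι → ℝ) (y : ι → EuclideanSpace ℝ (Fin d)) (k : Fin d) :
    blockSum lam y () k = ∑ i, lam i * y i k := by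
  simp [blockSum, WithLp.ofLp_sum]

theorem sq_sum_heatGrad_div {μ : Measure (ι → EuclideanSpace ℝ (Fin d))} (lam : ι → ℝ) (s : ℝ)
    (k : Fin d) (y : ι → EuclideanSpace ℝ (Fin d)) :
    (∑ i, lam i * heatGrad μ s i k y) ^ 2 / heatFlow μ s y =
      ∑ i, ∑ j, lam i * lam j * (heatGrad μ s i k y * heatGrad μ s j k y / heatFlow μ s y) := by
  rw [sq, Finset.sum_mul_sum, Finset.sum_div]
  refine Finset.sum_congr rfl fun i _ => ?_
  rw [Finset.sum_div]
  exact Finset.sum_congr rfl fun j _ => by ring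

theorem integrable_sq_sum_heatGrad_div {μ : Measure (ι → EuclideanSpace ℝ (Fin d))}
    [IsProbabilityMeasure μ] (lam : ι → ℝ) {s : ℝ} (hs : 0 < s) (k : Fin d) :
    Integrable fun y => (∑ i, lam i * heatGrad μ s i k y) ^ 2 / heatFlow μ s y := by
  simp only [sq_sum_heatGrad_div]
  exact integrable_finsetSum _ fun i _ => integrable_finsetSum _ fun j _ =>
    (integrable_heatGrad_mul_div hs i j k).const_mul _

theorem sum_integral_sq_sum_heatGrad_div {μ : Measure (ι → EuclideanSpace ℝ (Fin d))}
    [IsProbabilityMeasure μ] (lam : ι → ℝ) {s : ℝ} (hs : 0 < s) :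
    ∑ k, ∫ y, (∑ i, lam i * heatGrad μ s i k y) ^ 2 / heatFlow μ s y =
      ∑ i, ∑ j, lam i * lam j * heatFisherMatrix μ s i j := by
  have hi := fun i j k => integrable_heatGrad_mul_div (μ := μ) (d := d) hs i j k
  simp only [sq_sum_heatGrad_div, heatFisherMatrix]
  have h : ∀ k : Fin d, ∫ y, ∑ i, ∑ j, lam i * lam j *
      (heatGrad μ s i k y * heatGrad μ s j k y / heatFlow μ s y) =
      ∑ i, ∑ j, lam i * lam j * ∫ y, heatGrad μ s i k y * heatGrad μ s j k y / heatFlow μ s y :=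
    fun k => by
      rw [integral_finsetSum _ fun i _ => integrable_finsetSum _ fun j _ =>
        (hi i j k).const_mul _]
      refine Finset.sum_congr rfl fun i _ => ?_
      rw [integral_finsetSum _ fun j _ => (hi i j k).const_mul _]
      exact Finset.sum_congr rfl fun j _ => integral_const_mul _ _
  simp only [h]
  rw [Finset.sum_comm]
  refine Finset.sum_congr rfl fun i _ => ?_
  rw [Finset.sum_comm]
  refine Finset.sum_congr rfl fun j _ => ?_
  rw [integral_finsetSum _ fun k _ => hi i j k, Finset.mul_sum]

variable {Ω : Type*} [MeasurableSpace Ω] {P : Measure Ω} [IsProbabilityMeasure P]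
  {X Z : Ω → ι → EuclideanSpace ℝ (Fin d)}

/-- A projection argument without conditional expectations. With a = ∂p_sum/p_sum, the score of the
sum up to sign, the expectation of a(sum)·∑ λ_i Z_i is computed by `integral_mul_score` on the space
of the sum and on the joint space. This gives A = ∫ ψ ∑ λ_i ∂_i p, where ψ is a composed with the
sum and A is the left-hand side. With B the right-hand side, 2|ab| ≤ a² + b² yields A ≤ (A + B)/2.
-/
theorem integral_sq_heatGrad_blockSum_le (lam : ι → ℝ) (hX : Measurable X) (hZ : Measurable Z)
    (hXZ : IndepFun X Z P) (hZ_law : P.map Z = blockGaussian ι d)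
    (hsum : P.map (fun ω => blockSum lam (Z ω)) = blockGaussian Unit d) {s : ℝ} (hs : 0 < s)
    (k : Fin d) :
    ∫ u, heatGrad (P.map fun ω => blockSum lam (X ω)) s () k u ^ 2 /
        heatFlow (P.map fun ω => blockSum lam (X ω)) s u ≤
      ∫ y, (∑ i, lam i * heatGrad (P.map X) s i k y) ^ 2 / heatFlow (P.map X) s y := by
  have hTX : Measurable fun ω => blockSum lam (X ω) := by fun_prop
  have hTZ : Measurable fun ω => blockSum lam (Z ω) := by fun_prop
  have hp1 : IsProbabilityMeasure (P.map X) := Measure.isProbabilityMeasure_map hX.aemeasurable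
  have hp2 : IsProbabilityMeasure (P.map fun ω => blockSum lam (X ω)) :=
    Measure.isProbabilityMeasure_map hTX.aemeasurable
  have hTind : IndepFun (fun ω => blockSum lam (X ω)) (fun ω => blockSum lam (Z ω)) P :=
    hXZ.comp (measurable_blockSum lam) (measurable_blockSum lam)
  generalize hν : P.map (fun ω => blockSum lam (X ω)) = ν at *
  generalize hμ : P.map X = μ at *
  have hr : 0 < √s := Real.sqrt_pos.2 hs
  set a : (Unit → EuclideanSpace ℝ (Fin d)) → ℝ := fun u => heatGrad ν s () k u / heatFlow ν s u
  have ha : Measurable a := (measurable_heatGrad () k).div (measurable_heatFlow s)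
  have hT := map_add_sqrt_smul_eq hTX hTZ hTind hsum hs
  have hY := map_add_sqrt_smul_eq hX hZ hXZ hZ_law hs
  rw [hν] at hT
  rw [hμ] at hY
  have hFa : ∀ u, heatFlow ν s u * a u ^ 2 = heatGrad ν s () k u ^ 2 / heatFlow ν s u := fun u => by
    have := (heatFlow_pos (μ := ν) hs u).ne'
    simp only [a]
    field_simp
  have haG : ∀ u, a u * heatGrad ν s () k u = heatGrad ν s () k u ^ 2 / heatFlow ν s u := fun u => by
    simp only [a]
    ring
  have hTm : Measurable fun ω => blockSum lam (X ω) + √s • blockSum lam (Z ω) := by fun_prop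
  have hYm : Measurable fun ω => X ω + √s • Z ω := by fun_prop
  have ha2 : Integrable (fun ω => a (blockSum lam (X ω) + √s • blockSum lam (Z ω)) ^ 2) P := by
    refine (integrable_comp_heatLaw hTm hs hT (f := fun u => a u ^ 2) (ha.pow_const 2)).2 ?_
    simp only [hFa]
    exact integrable_sq_heatGrad_div hs () k
  have haL : MemLp (fun ω => a (blockSum lam (X ω) + √s • blockSum lam (Z ω))) 2 P :=
    (memLp_two_iff_integrable_sq (ha.comp hTm).aestronglyMeasurable).2 ha2
  set ψ : (ι → EuclideanSpace ℝ (Fin d)) → ℝ := fun y => a (blockSum lam y)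
  have hψ : Measurable ψ := ha.comp (measurable_blockSum lam)
  have hψY : ∀ ω, ψ (X ω + √s • Z ω) = a (blockSum lam (X ω) + √s • blockSum lam (Z ω)) :=
    fun ω => by simp only [ψ, blockSum_add_smul]
  have hψL : MemLp (fun ω => ψ (X ω + √s • Z ω)) 2 P := by simpa only [hψY] using haL
  have hψ2 : Integrable fun y => heatFlow μ s y * ψ y ^ 2 := by
    refine (integrable_comp_heatLaw hYm hs hY (f := fun y => ψ y ^ 2) (hψ.pow_const 2)).1 ?_
    simpa only [hψY] using ha2
  -- The second moment of ψ under the joint law is that of a under the law of the sum, which is A.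
  have hA : ∫ y, heatFlow μ s y * ψ y ^ 2 = ∫ u, heatGrad ν s () k u ^ 2 / heatFlow ν s u := by
    rw [← integral_comp_heatLaw hYm hs hY (f := fun y => ψ y ^ 2) (hψ.pow_const 2)]
    simp only [hψY]
    rw [integral_comp_heatLaw hTm hs hT (f := fun u => a u ^ 2) (ha.pow_const 2)]
    simp only [hFa]
  have h1 := (integral_mul_score hTX hTZ hTind hsum hs ha haL () k).2
  have h2 := fun i => integral_mul_score hX hZ hXZ hZ_law hs hψ hψL i k
  rw [hν] at h1
  rw [hμ] at h2
  simp only [haG] at h1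
  have hle : ∀ (G : (ι → EuclideanSpace ℝ (Fin d)) → ℝ) y,
      |ψ y * G y| ≤ (heatFlow μ s y * ψ y ^ 2 + G y ^ 2 / heatFlow μ s y) / 2 := fun G y => by
    have hF := heatFlow_pos (μ := μ) hs y
    have h3 : G y ^ 2 / heatFlow μ s y = heatFlow μ s y * (G y / heatFlow μ s y) ^ 2 := by
      field_simp
    have h4 : ψ y * G y = heatFlow μ s y * (ψ y * (G y / heatFlow μ s y)) := by field_simp
    rw [h3, h4, abs_mul, abs_of_pos hF]
    have h5 : |ψ y * (G y / heatFlow μ s y)| ≤ (ψ y ^ 2 + (G y / heatFlow μ s y) ^ 2) / 2 := by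
      rw [abs_le]
      constructor <;> nlinarith [sq_nonneg (ψ y - G y / heatFlow μ s y),
        sq_nonneg (ψ y + G y / heatFlow μ s y)]
    calc _ ≤ heatFlow μ s y * ((ψ y ^ 2 + (G y / heatFlow μ s y) ^ 2) / 2) :=
          mul_le_mul_of_nonneg_left h5 hF.le
      _ = _ := by ring
  have hiG : ∀ i, Integrable fun y => ψ y * heatGrad μ s i k y := fun i =>
    ((hψ2.add (integrable_sq_heatGrad_div hs i k)).div_const 2).mono'
      (hψ.mul (measurable_heatGrad i k)).aestronglyMeasurable
      (ae_of_all _ fun y => hle (heatGrad μ s i k) y)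
  -- On the joint space the noise of the sum is ∑ λ_i Z_i; the score identity is applied to each
  -- block separately.
  have h3 : ∫ ω, a (blockSum lam (X ω) + √s • blockSum lam (Z ω)) * blockSum lam (Z ω) () k ∂P =
      -√s * ∫ y, ψ y * ∑ i, lam i * heatGrad μ s i k y := by
    have h4 : ∀ ω, a (blockSum lam (X ω) + √s • blockSum lam (Z ω)) * blockSum lam (Z ω) () k =
        ∑ i, lam i * (ψ (X ω + √s • Z ω) * Z ω i k) := fun ω => by
      rw [blockSum_coord, Finset.mul_sum, hψY]
      exact Finset.sum_congr rfl fun i _ => by ring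
    have h5 : ∀ y, ψ y * ∑ i, lam i * heatGrad μ s i k y =
        ∑ i, lam i * (ψ y * heatGrad μ s i k y) := fun y => by
      rw [Finset.mul_sum]
      exact Finset.sum_congr rfl fun i _ => by ring
    simp only [h4, h5]
    rw [integral_finsetSum _ fun i _ => (h2 i).1.const_mul _,
      integral_finsetSum _ fun i _ => (hiG i).const_mul _, Finset.mul_sum]
    refine Finset.sum_congr rfl fun i _ => ?_
    rw [integral_const_mul, (h2 i).2, integral_const_mul]
    ring
  rw [h1] at h3
  have h6 : ∫ u, heatGrad ν s () k u ^ 2 / heatFlow ν s u =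
      ∫ y, ψ y * ∑ i, lam i * heatGrad μ s i k y :=
    mul_left_cancel₀ (neg_ne_zero.2 hr.ne') h3
  have hB := integrable_sq_sum_heatGrad_div (μ := μ) lam hs k
  have h7 : ∫ y, ψ y * ∑ i, lam i * heatGrad μ s i k y ≤
      ∫ y, (heatFlow μ s y * ψ y ^ 2 +
        (∑ i, lam i * heatGrad μ s i k y) ^ 2 / heatFlow μ s y) / 2 := by
    refine (le_abs_self _).trans ?_
    exact norm_integral_le_of_norm_le (f := fun y => ψ y * ∑ i, lam i * heatGrad μ s i k y)
      ((hψ2.add hB).div_const 2)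
      (ae_of_all _ fun y => hle (fun y => ∑ i, lam i * heatGrad μ s i k y) y)
  rw [integral_div, integral_add hψ2 hB, hA, ← h6] at h7
  linarith

/-- The **Blachman-Stam inequality** for Gaussian perturbations. -/
theorem heatFisher_blockSum_le (lam : ι → ℝ) (hX : Measurable X) (hZ : Measurable Z)
    (hXZ : IndepFun X Z P) (hZ_law : P.map Z = blockGaussian ι d)
    (hsum : P.map (fun ω => blockSum lam (Z ω)) = blockGaussian Unit d) {s : ℝ} (hs : 0 < s) :
    heatFisher (P.map fun ω => blockSum lam (X ω)) s ≤
      ∑ i, ∑ j, lam i * lam j * heatFisherMatrix (P.map X) s i j := by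
  have hTX : Measurable fun ω => blockSum lam (X ω) := by fun_prop
  have hp1 : IsProbabilityMeasure (P.map X) := Measure.isProbabilityMeasure_map hX.aemeasurable
  have hp2 : IsProbabilityMeasure (P.map fun ω => blockSum lam (X ω)) :=
    Measure.isProbabilityMeasure_map hTX.aemeasurable
  rw [← sum_integral_sq_sum_heatGrad_div lam hs, heatFisher]
  simp only [Fintype.sum_unique]
  rw [integral_finsetSum _ fun k _ => integrable_sq_heatGrad_div hs _ k]
  exact Finset.sum_le_sum fun k _ =>
    integral_sq_heatGrad_blockSum_le lam hX hZ hXZ hZ_law hsum hs k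

end BlachmanStam

/-! ### The Ornstein-Uhlenbeck flow of a block vector -/

section BlockFlow

variable {Ω : Type*} {ι : Type*} {d : ℕ}

/-- `e^{-t} X + √(1 - e^{-2t}) Z`. -/
noncomputable def blockOU (X Z : Ω → ι → EuclideanSpace ℝ (Fin d)) (t : ℝ) (ω : Ω) :
    ι → EuclideanSpace ℝ (Fin d) :=
  Real.exp (-t) • X ω + √(1 - Real.exp (-2 * t)) • Z ω

theorem blockOU_zero (X Z : Ω → ι → EuclideanSpace ℝ (Fin d)) : blockOU X Z 0 = X := by
  funext ω
  simp [blockOU]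

theorem exp_two_mul_sub_one_pos {t : ℝ} (ht : 0 < t) : 0 < Real.exp (2 * t) - 1 := by
  have := Real.one_lt_exp_iff.2 (by linarith : 0 < 2 * t)
  linarith

/-- The time change: the Ornstein-Uhlenbeck flow at t is e^{-t} times the heat flow at e^{2t} − 1.
-/
theorem exp_neg_sq_mul (t : ℝ) :
    Real.exp (-t) ^ 2 * (Real.exp (2 * t) - 1) = 1 - Real.exp (-2 * t) := by
  rw [← Real.exp_nat_mul, mul_sub, ← Real.exp_add, mul_one]
  congr 2
  · rw [Real.exp_eq_one_iff]
    push_cast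
    ring
  · push_cast
    ring

variable [MeasurableSpace Ω] {P : Measure Ω} [IsProbabilityMeasure P]
  {X Z : Ω → ι → EuclideanSpace ℝ (Fin d)}

theorem isProbabilityMeasure_map_smul (hX : Measurable X) (c : ℝ) :
    IsProbabilityMeasure ((P.map X).map fun x => c • x) := by
  have := Measure.isProbabilityMeasure_map (μ := P) hX.aemeasurable
  exact Measure.isProbabilityMeasure_map (by fun_prop)

theorem measurable_blockOU (hX : Measurable X) (hZ : Measurable Z) (t : ℝ) :
    Measurable (blockOU X Z t) := by
  unfold blockOU
  fun_prop

variable [Fintype ι]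

/-- The variance is left in the factored form c²·s, which is the form the scaling lemmas for the
heat flow expect. -/
theorem map_blockOU_eq (hX : Measurable X) (hZ : Measurable Z) (hXZ : IndepFun X Z P)
    (hZ_law : P.map Z = blockGaussian ι d) {t : ℝ} (ht : 0 < t) :
    P.map (blockOU X Z t) = volume.withDensity fun x => ENNReal.ofReal
      (heatFlow ((P.map X).map fun x => Real.exp (-t) • x)
        (Real.exp (-t) ^ 2 * (Real.exp (2 * t) - 1)) x) := by
  have hs : 0 < 1 - Real.exp (-2 * t) := by
    rw [← exp_neg_sq_mul]
    exact mul_pos (by positivity) (exp_two_mul_sub_one_pos ht)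
  have hm : Measurable fun x : ι → EuclideanSpace ℝ (Fin d) => Real.exp (-t) • x := by fun_prop
  rw [exp_neg_sq_mul, Measure.map_map hm hX]
  exact map_add_sqrt_smul_eq (hm.comp hX) hZ (hXZ.comp hm measurable_id) hZ_law hs

theorem exp_neg_sq_mul_pos {t : ℝ} (ht : 0 < t) :
    0 < Real.exp (-t) ^ 2 * (Real.exp (2 * t) - 1) :=
  mul_pos (by positivity) (exp_two_mul_sub_one_pos ht)

theorem integrable_normSq_map_smul {μ : Measure (ι → EuclideanSpace ℝ (Fin d))}
    (hμ : Integrable normSq μ) (c : ℝ) : Integrable normSq (μ.map fun x => c • x) := by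
  refine (integrable_map_measure measurable_normSq.aestronglyMeasurable (by fun_prop)).2 ?_
  exact (hμ.const_mul (c ^ 2)).congr (ae_of_all _ fun x => (normSq_smul c x).symm)

theorem hasFiniteEntropy_blockOU (hX : Measurable X) (hZ : Measurable Z) (hXZ : IndepFun X Z P)
    (hZ_law : P.map Z = blockGaussian ι d) (hX2 : Integrable normSq (P.map X)) {t : ℝ}
    (ht : 0 < t) : HasFiniteEntropy P (blockOU X Z t) :=
  have := isProbabilityMeasure_map_smul (P := P) hX (Real.exp (-t))
  hasFiniteEntropy_of_heatFlow (exp_neg_sq_mul_pos ht) (integrable_normSq_map_smul hX2 _)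
    (map_blockOU_eq hX hZ hXZ hZ_law ht)

theorem entropy_blockOU (hX : Measurable X) (hZ : Measurable Z) (hXZ : IndepFun X Z P)
    (hZ_law : P.map Z = blockGaussian ι d) (hX2 : Integrable normSq (P.map X)) {t : ℝ}
    (ht : 0 < t) :
    entropy P (blockOU X Z t) = heatEntropy (P.map X) (Real.exp (2 * t) - 1) - blockDim ι d * t := by
  have := isProbabilityMeasure_map_smul (P := P) hX (Real.exp (-t))
  have := Measure.isProbabilityMeasure_map (μ := P) hX.aemeasurable
  rw [entropy_eq_heatEntropy (exp_neg_sq_mul_pos ht) (map_blockOU_eq hX hZ hXZ hZ_law ht),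
    heatEntropy_map_smul (Real.exp_pos _) (exp_two_mul_sub_one_pos ht) hX2, Real.log_exp]
  ring

/-! ### Fisher information along the Ornstein-Uhlenbeck flow -/

section Fisher

variable [DecidableEq ι]

theorem hasFisherMatrix_blockOU (hX : Measurable X) (hZ : Measurable Z) (hXZ : IndepFun X Z P)
    (hZ_law : P.map Z = blockGaussian ι d) {t : ℝ} (ht : 0 < t) :
    HasFisherMatrix P (blockOU X Z t) :=
  have := isProbabilityMeasure_map_smul (P := P) hX (Real.exp (-t))
  hasFisherMatrix_of_heatFlow (measurable_blockOU hX hZ t) (exp_neg_sq_mul_pos ht)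
    (map_blockOU_eq hX hZ hXZ hZ_law ht)

theorem hasFisherInfo_blockOU (hX : Measurable X) (hZ : Measurable Z) (hXZ : IndepFun X Z P)
    (hZ_law : P.map Z = blockGaussian ι d) {t : ℝ} (ht : 0 < t) :
    HasFisherInfo P (blockOU X Z t) :=
  have := isProbabilityMeasure_map_smul (P := P) hX (Real.exp (-t))
  hasFisherInfo_of_heatFlow (exp_neg_sq_mul_pos ht) (map_blockOU_eq hX hZ hXZ hZ_law ht)

theorem exp_neg_sq_inv (t : ℝ) : (Real.exp (-t) ^ 2)⁻¹ = Real.exp (2 * t) := by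
  rw [← Real.exp_nat_mul, ← Real.exp_neg]
  congr 1
  push_cast
  ring

theorem fisherMatrix_blockOU (hX : Measurable X) (hZ : Measurable Z) (hXZ : IndepFun X Z P)
    (hZ_law : P.map Z = blockGaussian ι d) {t : ℝ} (ht : 0 < t) (i j : ι) :
    fisherMatrix P (blockOU X Z t) i j =
      Real.exp (2 * t) * heatFisherMatrix (P.map X) (Real.exp (2 * t) - 1) i j := by
  have := isProbabilityMeasure_map_smul (P := P) hX (Real.exp (-t))
  have := Measure.isProbabilityMeasure_map (μ := P) hX.aemeasurable
  rw [fisherMatrix_eq (measurable_blockOU hX hZ t) (exp_neg_sq_mul_pos ht)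
    (map_blockOU_eq hX hZ hXZ hZ_law ht), heatFisherMatrix_map_smul (Real.exp_pos _)
    (exp_two_mul_sub_one_pos ht), exp_neg_sq_inv]

theorem fisherInfo_blockOU (hX : Measurable X) (hZ : Measurable Z) (hXZ : IndepFun X Z P)
    (hZ_law : P.map Z = blockGaussian ι d) {t : ℝ} (ht : 0 < t) :
    fisherInfo P (blockOU X Z t) =
      Real.exp (2 * t) * heatFisher (P.map X) (Real.exp (2 * t) - 1) := by
  have := isProbabilityMeasure_map_smul (P := P) hX (Real.exp (-t))
  have := Measure.isProbabilityMeasure_map (μ := P) hX.aemeasurable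
  rw [fisherInfo_eq (exp_neg_sq_mul_pos ht) (map_blockOU_eq hX hZ hXZ hZ_law ht),
    heatFisher_eq_sum (exp_neg_sq_mul_pos ht), heatFisher_eq_sum (exp_two_mul_sub_one_pos ht),
    Finset.mul_sum]
  exact Finset.sum_congr rfl fun i _ => by
    rw [heatFisherMatrix_map_smul (Real.exp_pos _) (exp_two_mul_sub_one_pos ht), exp_neg_sq_inv]

end Fisher

/-- De Bruijn's identity along the Ornstein-Uhlenbeck flow, in integrated form. -/
theorem entropy_blockOU_eq_add_integral (hX : Measurable X) (hZ : Measurable Z)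
    (hXZ : IndepFun X Z P) (hZ_law : P.map Z = blockGaussian ι d)
    (hX2 : Integrable normSq (P.map X)) (hXe : HasFiniteEntropy P X) {t : ℝ} (ht : 0 ≤ t) :
    IntervalIntegrable
      (fun s => Real.exp (2 * s) * heatFisher (P.map X) (Real.exp (2 * s) - 1)) volume 0 t ∧
    entropy P (blockOU X Z t) = entropy P X + (∫ s in (0 : ℝ)..t,
      Real.exp (2 * s) * heatFisher (P.map X) (Real.exp (2 * s) - 1)) - blockDim ι d * t := by
  rcases ht.eq_or_lt with rfl | ht
  · simp [blockOU_zero]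
  have := Measure.isProbabilityMeasure_map (μ := P) hX.aemeasurable
  obtain ⟨h1, h2⟩ := integral_heatFisher_exp hX2 (measurable_density P X)
    (fun _ => ENNReal.toReal_nonneg) (map_eq_withDensity_density hXe.1) hXe.2 ht
  refine ⟨h1, ?_⟩
  rw [h2, entropy_blockOU hX hZ hXZ hZ_law hX2 ht, entropy]
  ring

/-- The entries are dominated by the trace, which de Bruijn's identity shows to be integrable up to
time 0. -/
theorem intervalIntegrable_heatFisherMatrix (hX : Measurable X)
    (hX2 : Integrable normSq (P.map X)) (hXe : HasFiniteEntropy P X) {t : ℝ} (ht : 0 ≤ t)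
    (i j : ι) :
    IntervalIntegrable
      (fun s => Real.exp (2 * s) * heatFisherMatrix (P.map X) (Real.exp (2 * s) - 1) i j)
      volume 0 t := by
  rcases ht.eq_or_lt with rfl | ht
  · simp
  have := Measure.isProbabilityMeasure_map (μ := P) hX.aemeasurable
  obtain ⟨h1, -⟩ := integral_heatFisher_exp hX2 (measurable_density P X)
    (fun _ => ENNReal.toReal_nonneg) (map_eq_withDensity_density hXe.1) hXe.2 ht
  refine h1.mono_fun ?_ ?_
  · have hm : Measurable fun s => Real.exp (2 * s) *
        heatFisherMatrix (P.map X) (Real.exp (2 * s) - 1) i j := by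
      refine Measurable.mul (by fun_prop) ((measurable_heatFisherMatrix i j).comp ?_)
      fun_prop
    exact hm.aestronglyMeasurable
  · refine (ae_restrict_iff' measurableSet_uIoc).2 (ae_of_all _ fun s hs => ?_)
    rw [Set.uIoc_of_le ht.le] at hs
    have hp := exp_two_mul_sub_one_pos hs.1
    simp only [norm_mul, Real.norm_eq_abs]
    refine mul_le_mul_of_nonneg_left ?_ (abs_nonneg _)
    rw [abs_of_nonneg (heatFisher_nonneg hp)]
    exact abs_heatFisherMatrix_le hp i j

/-- The entropy along the flow converges to the Gaussian entropy. -/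
theorem tendsto_entropy_blockOU (hX : Measurable X) (hZ : Measurable Z) (hXZ : IndepFun X Z P)
    (hZ_law : P.map Z = blockGaussian ι d) (hX2 : Integrable normSq (P.map X)) :
    Tendsto (fun t => entropy P (blockOU X Z t)) atTop
      (𝓝 (blockDim ι d * (Real.log (2 * Real.pi) / 2 + 1 / 2))) := by
  have := Measure.isProbabilityMeasure_map (μ := P) hX.aemeasurable
  obtain ⟨m, hm⟩ : ∃ m, m = ∫ x, normSq x ∂(P.map X) := ⟨_, rfl⟩
  have hm0 : 0 ≤ m := hm ▸ integral_nonneg normSq_nonneg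
  obtain ⟨N, hN⟩ : ∃ N : ℝ, N = blockDim ι d := ⟨_, rfl⟩
  have hN0 : 0 ≤ N := hN ▸ Nat.cast_nonneg _
  have he1 : Tendsto (fun t : ℝ => Real.exp (-t)) atTop (𝓝 0) := Real.tendsto_exp_neg_atTop_nhds_zero
  have he2 : Tendsto (fun t : ℝ => Real.exp (-2 * t)) atTop (𝓝 0) := by
    have := he1.mul he1
    simp only [← Real.exp_add, mul_zero] at this
    exact this.congr fun t => by ring_nf
  have hlow : Tendsto (fun t : ℝ => N / 2 * (Real.log (2 * Real.pi) +
      Real.log (1 - Real.exp (-2 * t))) + N / 2) atTop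
      (𝓝 (N * (Real.log (2 * Real.pi) / 2 + 1 / 2))) := by
    have h1 : Tendsto (fun t : ℝ => Real.log (1 - Real.exp (-2 * t))) atTop (𝓝 0) := by
      have := (tendsto_const_nhds (x := (1 : ℝ))).sub he2
      rw [sub_zero] at this
      simpa using this.log one_ne_zero
    convert ((h1.const_add (Real.log (2 * Real.pi))).const_mul (N / 2)).add_const (N / 2) using 2
    ring
  have hupp : Tendsto (fun t : ℝ => N / 2 * Real.log (2 * Real.pi) + (m / 2 * Real.exp (-2 * t) +
      (m + N) / 2 * Real.exp (-t) + N / 2)) atTop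
      (𝓝 (N * (Real.log (2 * Real.pi) / 2 + 1 / 2))) := by
    convert (((he2.const_mul (m / 2)).add (he1.const_mul ((m + N) / 2))).add_const (N / 2)).const_add
      (N / 2 * Real.log (2 * Real.pi)) using 2
    ring
  rw [← hN]
  have hent : ∀ t : ℝ, 0 < t → entropy P (blockOU X Z t) =
      heatEntropy (P.map X) (Real.exp (2 * t) - 1) - N * t := fun t ht => by
    rw [hN, entropy_blockOU hX hZ hXZ hZ_law hX2 ht]
  refine tendsto_of_tendsto_of_tendsto_of_le_of_le' hlow hupp ?_ ?_
  · filter_upwards [eventually_gt_atTop 0] with t ht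
    have hs := exp_two_mul_sub_one_pos ht
    have h := le_heatEntropy hs hX2
    rw [← hN, Real.log_mul (by positivity) hs.ne'] at h
    have hl : Real.log (1 - Real.exp (-2 * t)) = -(2 * t) + Real.log (Real.exp (2 * t) - 1) := by
      rw [← exp_neg_sq_mul, Real.log_mul (by positivity) hs.ne', Real.log_pow, Real.log_exp]
      push_cast
      ring
    rw [hent t ht, hl]
    linarith
  · filter_upwards [eventually_gt_atTop 0] with t ht
    have hs := exp_two_mul_sub_one_pos ht
    -- The comparison variance r = e^{2t} makes log r cancel the drift N·t exactly and leaves a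
    -- moment term that tends to N/2.
    have h := heatEntropy_le_of_moment hs (Real.exp_pos (2 * t)) hX2
    rw [← hN, ← hm, Real.log_mul (by positivity) (Real.exp_pos _).ne', Real.log_exp] at h
    have hsq : √(Real.exp (2 * t) - 1) ≤ Real.exp t := by
      rw [Real.sqrt_le_left (Real.exp_pos _).le, ← Real.exp_nat_mul]
      push_cast
      linarith
    have hfrac : (m + √(Real.exp (2 * t) - 1) * (m + N) + (Real.exp (2 * t) - 1) * N) /
        (2 * Real.exp (2 * t)) ≤
        m / 2 * Real.exp (-2 * t) + (m + N) / 2 * Real.exp (-t) + N / 2 := by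
      rw [div_le_iff₀ (by positivity)]
      have e1 : Real.exp (-2 * t) * Real.exp (2 * t) = 1 := by
        rw [← Real.exp_add, neg_mul, neg_add_cancel, Real.exp_zero]
      have e2 : Real.exp (-t) * Real.exp (2 * t) = Real.exp t := by
        rw [← Real.exp_add]
        congr 1
        ring
      have h3 : (m / 2 * Real.exp (-2 * t) + (m + N) / 2 * Real.exp (-t) + N / 2) *
          (2 * Real.exp (2 * t)) = m + (m + N) * Real.exp t + N * Real.exp (2 * t) := by
        linear_combination m * e1 + (m + N) * e2
      rw [h3]
      have := mul_le_mul_of_nonneg_right hsq (add_nonneg hm0 hN0)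
      linarith
    rw [hent t ht]
    linarith

end BlockFlow

/-! ### The joint vector, its subvectors and the weighted sum -/

section Subvectors

variable {Ω : Type*} {n d : ℕ} {X Z : Fin n → Ω → EuclideanSpace ℝ (Fin d)}

theorem blockDim_unit : (blockDim Unit d : ℝ) = d := by
  simp [blockDim]

theorem blockDim_ne (i : Fin n) :
    (blockDim {j : Fin n // j ≠ i} d : ℝ) = blockDim (Fin n) d - d := by
  -- The index i shows that n is positive, so the natural subtraction n − 1 casts correctly.
  have hn : 1 ≤ n := i.pos
  have : Fintype.card {j : Fin n // j ≠ i} = n - 1 := by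
    simp
  rw [blockDim, blockDim, this, Fintype.card_fin]
  push_cast [hn]
  ring

theorem blockSum_smul {ι : Type*} [Fintype ι] (lam : ι → ℝ) (c : ℝ)
    (x : ι → EuclideanSpace ℝ (Fin d)) : blockSum lam (c • x) = c • blockSum lam x := by
  funext j
  simp only [blockSum, Pi.smul_apply, Finset.smul_sum]
  exact Finset.sum_congr rfl fun i _ => smul_comm _ _ _

theorem joint_ouFlow (t : ℝ) : joint (ouFlow X Z t) = blockOU (joint X) (joint Z) t := rfl

theorem others_ouFlow (t : ℝ) (i : Fin n) :
    others (ouFlow X Z t) i = blockOU (others X i) (others Z i) t := rfl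

theorem blockSum_joint_ouFlow (lam : Fin n → ℝ) (t : ℝ) :
    (fun ω => blockSum lam (joint (ouFlow X Z t) ω)) =
      blockOU (fun ω => blockSum lam (joint X ω)) (fun ω => blockSum lam (joint Z ω)) t := by
  funext ω
  rw [joint_ouFlow]
  simp only [blockOU, blockSum_add_smul, blockSum_smul]

variable [MeasurableSpace Ω] {P : Measure Ω}

theorem measurable_joint (hX : ∀ i, Measurable (X i)) : Measurable (joint X) :=
  measurable_pi_lambda _ hX

theorem measurable_others (hX : ∀ i, Measurable (X i)) (i : Fin n) : Measurable (others X i) :=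
  measurable_pi_lambda _ fun j => hX j

theorem measurable_blockSum_joint (hX : ∀ i, Measurable (X i)) (lam : Fin n → ℝ) :
    Measurable fun ω => blockSum lam (joint X ω) :=
  (measurable_blockSum lam).comp (measurable_joint hX)

/-- Splitting off the `i`-th block. -/
def splitBlock (α : Type*) [MeasurableSpace α] (i : Fin n) :
    (Fin n → α) ≃ᵐ α × ({j : Fin n // j ≠ i} → α) :=
  (MeasurableEquiv.piEquivPiSubtypeProd (fun _ => α) (· = i)).trans
    ((MeasurableEquiv.funUnique {j : Fin n // j = i} α).prodCongr (MeasurableEquiv.refl _))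

theorem measurePreserving_splitBlock (α : Type*) [MeasureSpace α]
    [SigmaFinite (volume : Measure α)] (i : Fin n) : MeasurePreserving (splitBlock α i) := by
  have h1 : MeasurePreserving (MeasurableEquiv.funUnique {j : Fin n // j = i} α)
      (Measure.pi fun _ => volume) volume := by
    convert measurePreserving_funUnique (volume : Measure α) {j : Fin n // j = i}
  have h2 : MeasurePreserving (MeasurableEquiv.refl ({j : Fin n // j ≠ i} → α))
      (Measure.pi fun _ => volume) (Measure.pi fun _ => volume) := MeasurePreserving.id _
  have h3 := measurePreserving_piEquivPiSubtypeProd (fun _ : Fin n => (volume : Measure α)) (· = i)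
  refine (h1.prod h2).comp (?_ : MeasurePreserving _ _ _)
  convert h3 <;> rfl

/-- Moving the block i to the front is a volume preserving rearrangement of coordinates, so the pair
has the entropy of the joint vector. -/
theorem condEntropy_eq [IsFiniteMeasure P] (hX : ∀ i, Measurable (X i))
    (hXe : HasFiniteEntropy P (joint X)) (i : Fin n) :
    condEntropy P (X i) (others X i) = entropy P (joint X) - entropy P (others X i) := by
  rw [condEntropy, ← (entropy_comp_equiv (splitBlock _ i) (measurePreserving_splitBlock _ i)
    (measurable_joint hX) hXe).2]
  rfl

/-- Viewing the weighted sum as a vector with one block, indexed by `Unit`, lets the block vector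
results apply to it. -/
theorem hasFiniteEntropy_blockSum [IsFiniteMeasure P] {lam : Fin n → ℝ}
    (hX : ∀ i, Measurable (X i)) (hXe : HasFiniteEntropy P (weightedSum lam X)) :
    HasFiniteEntropy P fun ω => blockSum lam (joint X ω) := by
  have hm : Measurable (weightedSum lam X) := by
    unfold weightedSum
    fun_prop
  exact (entropy_comp_equiv (MeasurableEquiv.funUnique Unit (EuclideanSpace ℝ (Fin d))).symm
    ((volume_preserving_funUnique Unit (EuclideanSpace ℝ (Fin d))).symm _) hm hXe).1

theorem entropy_weightedSum [IsFiniteMeasure P] {lam : Fin n → ℝ} (hX : ∀ i, Measurable (X i))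
    (hXe : HasFiniteEntropy P fun ω => blockSum lam (joint X ω)) :
    HasFiniteEntropy P (weightedSum lam X) ∧
      entropy P (weightedSum lam X) = entropy P fun ω => blockSum lam (joint X ω) :=
  entropy_comp_equiv (MeasurableEquiv.funUnique Unit (EuclideanSpace ℝ (Fin d)))
    (volume_preserving_funUnique Unit (EuclideanSpace ℝ (Fin d)))
    (measurable_blockSum_joint hX lam) hXe

theorem sum_mul_condEntropy [IsFiniteMeasure P] {lam : Fin n → ℝ}
    (hlam_sum : ∑ i, lam i ^ 2 = 1) (hX : ∀ i, Measurable (X i))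
    (hXe : HasFiniteEntropy P (joint X)) :
    ∑ i, lam i ^ 2 * condEntropy P (X i) (others X i) =
      entropy P (joint X) - ∑ i, lam i ^ 2 * entropy P (others X i) := by
  simp only [condEntropy_eq hX hXe, mul_sub, Finset.sum_sub_distrib, ← Finset.sum_mul, hlam_sum,
    one_mul]

/-- Since the weights λ_i² sum to 1, the n copies of the joint entropy merge into one. -/
theorem entropyGap_eq [IsFiniteMeasure P] {lam : Fin n → ℝ} (hlam_sum : ∑ i, lam i ^ 2 = 1)
    (hX : ∀ i, Measurable (X i)) (hXe : HasFiniteEntropy P (joint X))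
    (hXs : HasFiniteEntropy P fun ω => blockSum lam (joint X ω)) :
    entropyGap P lam X = entropy P (fun ω => blockSum lam (joint X ω)) - entropy P (joint X) +
      ∑ i, lam i ^ 2 * entropy P (others X i) := by
  rw [entropyGap, sum_mul_condEntropy hlam_sum hX hXe, (entropy_weightedSum hX hXs).2]
  ring

end Subvectors

/-! ### Laws of the noise vectors -/

section Noise

variable {Ω : Type*} [MeasurableSpace Ω] {P : Measure Ω} {n d : ℕ}
  {X Z : Fin n → Ω → EuclideanSpace ℝ (Fin d)}

theorem integrable_normSq_map {ι : Type*} [Fintype ι] {W : ι → Ω → EuclideanSpace ℝ (Fin d)}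
    (hW : ∀ i, Measurable (W i)) (hW2 : ∀ i, MemLp (W i) 2 P) :
    Integrable normSq (P.map fun ω i => W i ω) := by
  refine (integrable_map_measure measurable_normSq.aestronglyMeasurable
    (measurable_pi_lambda _ hW).aemeasurable).2 ?_
  exact integrable_finsetSum _ fun i _ => (hW2 i).integrable_norm_pow two_ne_zero

theorem integrable_normSq_blockSum (hX : ∀ i, Measurable (X i)) (hX2 : ∀ i, MemLp (X i) 2 P)
    (lam : Fin n → ℝ) : Integrable normSq (P.map fun ω => blockSum lam (joint X ω)) :=
  integrable_normSq_map (W := fun (_ : Unit) ω => ∑ i, lam i • X i ω) (fun _ => by fun_prop)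
    fun _ => memLp_finsetSum _ fun i _ => (hX2 i).const_smul (lam i)

variable [IsProbabilityMeasure P]

theorem map_pi_eq_blockGaussian {ι : Type*} [Fintype ι] {W : ι → Ω → EuclideanSpace ℝ (Fin d)}
    (hW : ∀ i, Measurable (W i)) (hW_indep : iIndepFun W P)
    (hW_law : ∀ i, P.map (W i) = stdGaussian (EuclideanSpace ℝ (Fin d))) :
    P.map (fun ω i => W i ω) = blockGaussian ι d := by
  rw [(iIndepFun_iff_map_fun_eq_pi_map fun i => (hW i).aemeasurable).1 hW_indep, blockGaussian]
  simp only [hW_law]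

/-- In the characteristic function the exponents −λ_i²|u|²/2 add up to −|u|²/2. -/
theorem map_weightedSum_eq_stdGaussian {ι : Type*} [Fintype ι]
    {W : ι → Ω → EuclideanSpace ℝ (Fin d)} {lam : ι → ℝ} (hlam_sum : ∑ i, lam i ^ 2 = 1)
    (hW : ∀ i, Measurable (W i)) (hW_indep : iIndepFun W P)
    (hW_law : ∀ i, P.map (W i) = stdGaussian (EuclideanSpace ℝ (Fin d))) :
    P.map (fun ω => ∑ i, lam i • W i ω) = stdGaussian (EuclideanSpace ℝ (Fin d)) := by
  have hm : ∀ i, Measurable fun ω => lam i • W i ω := fun i => (hW i).const_smul (lam i)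
  have : IsProbabilityMeasure (P.map fun ω => ∑ i, lam i • W i ω) :=
    Measure.isProbabilityMeasure_map (by fun_prop)
  have hind : iIndepFun (fun i ω => lam i • W i ω) P :=
    hW_indep.comp (fun i x => lam i • x) fun i => measurable_const_smul (lam i)
  refine Measure.ext_of_charFun ?_
  rw [hind.charFun_map_fun_sum_eq_prod fun i => (hm i).aemeasurable]
  ext u
  rw [Finset.prod_apply]
  simp only [charFun_map_smul_comp (hW _).aemeasurable, hW_law, charFun_stdGaussian,
    ← Complex.exp_sum]
  congr 1
  have h : (∑ i, ((lam i : ℂ)) ^ 2) = 1 := by exact_mod_cast congrArg ((↑) : ℝ → ℂ) hlam_sum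
  simp only [norm_smul, Complex.ofReal_mul, mul_pow]
  rw [← Finset.sum_div, Finset.sum_neg_distrib, ← Finset.sum_mul]
  simp only [← Complex.ofReal_pow, Real.norm_eq_abs, sq_abs]
  simp only [Complex.ofReal_pow, h, one_mul]

theorem map_blockSum_joint (hZ : ∀ i, Measurable (Z i)) {lam : Fin n → ℝ}
    (hlam_sum : ∑ i, lam i ^ 2 = 1) (hZ_indep : iIndepFun Z P)
    (hZ_law : ∀ i, P.map (Z i) = stdGaussian (EuclideanSpace ℝ (Fin d))) :
    P.map (fun ω => blockSum lam (joint Z ω)) = blockGaussian Unit d := by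
  have h := ((measurePreserving_funUnique (stdGaussian (EuclideanSpace ℝ (Fin d))) Unit).symm
    (MeasurableEquiv.funUnique Unit (EuclideanSpace ℝ (Fin d)))).map_eq
  rw [← map_weightedSum_eq_stdGaussian hlam_sum hZ hZ_indep hZ_law,
    Measure.map_map (MeasurableEquiv.measurable _) (by fun_prop)] at h
  rw [map_weightedSum_eq_stdGaussian hlam_sum hZ hZ_indep hZ_law] at h
  exact h

end Noise

/-! ### The entropy gap along the Ornstein-Uhlenbeck flow -/

theorem intervalIntegrable_fun_sum {ι : Type*} [Fintype ι] {f : ι → ℝ → ℝ} {a b : ℝ}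
    (h : ∀ i, IntervalIntegrable (f i) volume a b) :
    IntervalIntegrable (fun s => ∑ i, f i s) volume a b := by
  have := IntervalIntegrable.sum Finset.univ fun i _ => h i
  rwa [Finset.sum_fn] at this

section Gap

variable {Ω : Type*} {n d : ℕ} {X Z : Fin n → Ω → EuclideanSpace ℝ (Fin d)} {lam : Fin n → ℝ}

theorem ouFlow_zero (X Z : Fin n → Ω → EuclideanSpace ℝ (Fin d)) : ouFlow X Z 0 = X := by
  funext i ω
  simp [ouFlow]

variable [MeasurableSpace Ω] {P : Measure Ω}

theorem measurable_ouFlow (hX : ∀ i, Measurable (X i)) (hZ : ∀ i, Measurable (Z i)) (t : ℝ)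
    (i : Fin n) : Measurable (ouFlow X Z t i) := by
  unfold ouFlow
  fun_prop

theorem indepFun_others (hXZ : IndepFun (joint X) (joint Z) P) (i : Fin n) :
    IndepFun (others X i) (others Z i) P := by
  have h : Measurable fun (x : Fin n → EuclideanSpace ℝ (Fin d)) (j : {j : Fin n // j ≠ i}) =>
      x j := measurable_pi_lambda _ fun j => measurable_pi_apply _
  exact hXZ.comp h h

theorem indepFun_blockSum (hXZ : IndepFun (joint X) (joint Z) P) (lam : Fin n → ℝ) :
    IndepFun (fun ω => blockSum lam (joint X ω)) (fun ω => blockSum lam (joint Z ω)) P :=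
  hXZ.comp (measurable_blockSum lam) (measurable_blockSum lam)

theorem integrable_normSq_joint (hX : ∀ i, Measurable (X i)) (hX2 : ∀ i, MemLp (X i) 2 P) :
    Integrable normSq (P.map (joint X)) :=
  integrable_normSq_map hX hX2

theorem integrable_normSq_others (hX : ∀ i, Measurable (X i)) (hX2 : ∀ i, MemLp (X i) 2 P)
    (i : Fin n) : Integrable normSq (P.map (others X i)) :=
  integrable_normSq_map (W := fun j : {j : Fin n // j ≠ i} => X j) (fun j => hX j) fun j => hX2 j

variable [IsProbabilityMeasure P]

theorem map_joint_eq_blockGaussian (hZ : ∀ i, Measurable (Z i)) (hZ_indep : iIndepFun Z P)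
    (hZ_law : ∀ i, P.map (Z i) = stdGaussian (EuclideanSpace ℝ (Fin d))) :
    P.map (joint Z) = blockGaussian (Fin n) d :=
  map_pi_eq_blockGaussian hZ hZ_indep hZ_law

theorem map_others_eq_blockGaussian (hZ : ∀ i, Measurable (Z i)) (hZ_indep : iIndepFun Z P)
    (hZ_law : ∀ i, P.map (Z i) = stdGaussian (EuclideanSpace ℝ (Fin d))) (i : Fin n) :
    P.map (others Z i) = blockGaussian {j : Fin n // j ≠ i} d :=
  map_pi_eq_blockGaussian (W := fun j : {j : Fin n // j ≠ i} => Z j) (fun j => hZ j)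
    (hZ_indep.precomp Subtype.val_injective) fun j => hZ_law j

theorem hasFiniteEntropy_ouFlow (hlam_sum : ∑ i, lam i ^ 2 = 1) (hX : ∀ i, Measurable (X i))
    (hZ : ∀ i, Measurable (Z i)) (hX2 : ∀ i, MemLp (X i) 2 P)
    (hXj : HasFiniteEntropy P (joint X)) (hXo : ∀ i, HasFiniteEntropy P (others X i))
    (hXs : HasFiniteEntropy P fun ω => blockSum lam (joint X ω))
    (hZ_law : ∀ i, P.map (Z i) = stdGaussian (EuclideanSpace ℝ (Fin d)))
    (hZ_indep : iIndepFun Z P) (hXZ : IndepFun (joint X) (joint Z) P) {t : ℝ} (ht : 0 ≤ t) :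
    HasFiniteEntropy P (joint (ouFlow X Z t)) ∧
    (∀ i, HasFiniteEntropy P (others (ouFlow X Z t) i)) ∧
    HasFiniteEntropy P fun ω => blockSum lam (joint (ouFlow X Z t) ω) := by
  rcases ht.eq_or_lt with rfl | ht
  · rw [ouFlow_zero]
    exact ⟨hXj, hXo, hXs⟩
  refine ⟨?_, fun i => ?_, ?_⟩
  · exact hasFiniteEntropy_blockOU (measurable_joint hX) (measurable_joint hZ) hXZ
      (map_joint_eq_blockGaussian hZ hZ_indep hZ_law) (integrable_normSq_joint hX hX2) ht
  · exact hasFiniteEntropy_blockOU (measurable_others hX i) (measurable_others hZ i)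
      (indepFun_others hXZ i) (map_others_eq_blockGaussian hZ hZ_indep hZ_law i)
      (integrable_normSq_others hX hX2 i) ht
  · rw [blockSum_joint_ouFlow]
    exact hasFiniteEntropy_blockOU (measurable_blockSum_joint hX lam)
      (measurable_blockSum_joint hZ lam) (indepFun_blockSum hXZ lam)
      (map_blockSum_joint hZ hlam_sum hZ_indep hZ_law) (integrable_normSq_blockSum hX hX2 lam) ht

theorem errorRate_ouFlow (hX : ∀ i, Measurable (X i)) (hZ : ∀ i, Measurable (Z i))
    (hZ_law : ∀ i, P.map (Z i) = stdGaussian (EuclideanSpace ℝ (Fin d)))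
    (hZ_indep : iIndepFun Z P) (hXZ : IndepFun (joint X) (joint Z) P) {s : ℝ} (hs : 0 < s) :
    errorRate P lam (ouFlow X Z s) =
      ∑ i, ∑ j, lam i * lam j *
        (Real.exp (2 * s) * heatFisherMatrix (P.map (joint X)) (Real.exp (2 * s) - 1) i j) -
      Real.exp (2 * s) * heatFisher (P.map (joint X)) (Real.exp (2 * s) - 1) +
      ∑ i, lam i ^ 2 *
        (Real.exp (2 * s) * heatFisher (P.map (others X i)) (Real.exp (2 * s) - 1)) := by
  have := Measure.isProbabilityMeasure_map (μ := P) (measurable_joint hX).aemeasurable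
  have h1 := fisherMatrix_blockOU (measurable_joint hX) (measurable_joint hZ) hXZ
    (map_joint_eq_blockGaussian hZ hZ_indep hZ_law) hs
  have h2 := fun i => fisherInfo_blockOU (measurable_others hX i) (measurable_others hZ i)
    (indepFun_others hXZ i) (map_others_eq_blockGaussian hZ hZ_indep hZ_law i) hs
  simp only [errorRate, joint_ouFlow, others_ouFlow, h1, h2, ← Finset.mul_sum,
    heatFisher_eq_sum (μ := P.map (joint X)) (exp_two_mul_sub_one_pos hs)]

theorem intervalIntegrable_sum_sum_heatFisherMatrix (hX : ∀ i, Measurable (X i))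
    (hX2 : ∀ i, MemLp (X i) 2 P) (hXj : HasFiniteEntropy P (joint X)) {t : ℝ} (ht : 0 ≤ t) :
    IntervalIntegrable (fun s => ∑ i, ∑ j, lam i * lam j *
      (Real.exp (2 * s) * heatFisherMatrix (P.map (joint X)) (Real.exp (2 * s) - 1) i j))
      volume 0 t := by
  refine intervalIntegrable_fun_sum fun i => intervalIntegrable_fun_sum fun j => ?_
  exact (intervalIntegrable_heatFisherMatrix (measurable_joint hX)
    (integrable_normSq_joint hX hX2) hXj ht i j).const_mul _

theorem entropyGap_ouFlow_le (hlam_sum : ∑ i, lam i ^ 2 = 1) (hX : ∀ i, Measurable (X i))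
    (hZ : ∀ i, Measurable (Z i)) (hX2 : ∀ i, MemLp (X i) 2 P)
    (hXj : HasFiniteEntropy P (joint X)) (hXo : ∀ i, HasFiniteEntropy P (others X i))
    (hXs : HasFiniteEntropy P fun ω => blockSum lam (joint X ω))
    (hZ_law : ∀ i, P.map (Z i) = stdGaussian (EuclideanSpace ℝ (Fin d)))
    (hZ_indep : iIndepFun Z P) (hXZ : IndepFun (joint X) (joint Z) P) {t : ℝ} (ht : 0 ≤ t) :
    IntervalIntegrable (fun s => errorRate P lam (ouFlow X Z s)) volume 0 t ∧
    entropyGap P lam (ouFlow X Z t) ≤ entropyGap P lam X + errorTerm P lam X Z t := by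
  obtain ⟨hFj, hEj⟩ := entropy_blockOU_eq_add_integral (measurable_joint hX) (measurable_joint hZ)
    hXZ (map_joint_eq_blockGaussian hZ hZ_indep hZ_law) (integrable_normSq_joint hX hX2) hXj ht
  have hO := fun i => entropy_blockOU_eq_add_integral (measurable_others hX i)
    (measurable_others hZ i) (indepFun_others hXZ i)
    (map_others_eq_blockGaussian hZ hZ_indep hZ_law i) (integrable_normSq_others hX hX2 i)
    (hXo i) ht
  obtain ⟨hFs, hEs⟩ := entropy_blockOU_eq_add_integral
    (measurable_blockSum_joint hX lam)
    (measurable_blockSum_joint hZ lam) (indepFun_blockSum hXZ lam)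
    (map_blockSum_joint hZ hlam_sum hZ_indep hZ_law) (integrable_normSq_blockSum hX hX2 lam) hXs ht
  have hM := intervalIntegrable_sum_sum_heatFisherMatrix (lam := lam) hX hX2 hXj ht
  have hFo : IntervalIntegrable (fun s => ∑ i, lam i ^ 2 * (Real.exp (2 * s) *
      heatFisher (P.map (others X i)) (Real.exp (2 * s) - 1))) volume 0 t :=
    intervalIntegrable_fun_sum fun i => (hO i).1.const_mul _
  -- The formulas for the Fisher informations hold for s > 0, which is all that the half-open
  -- interval (0, t] asks for.
  have hrate : ∀ s ∈ Set.uIoc 0 t, _ = errorRate P lam (ouFlow X Z s) := fun s hs =>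
    (errorRate_ouFlow (lam := lam) hX hZ hZ_law hZ_indep hXZ
      (Set.uIoc_of_le ht ▸ hs : s ∈ Set.Ioc 0 t).1).symm
  refine ⟨((hM.sub hFj).add hFo).congr hrate, ?_⟩
  -- The only inequality in the argument: Blachman-Stam at each time s > 0. All other terms are
  -- matched exactly.
  have hle : ∫ s in (0 : ℝ)..t, Real.exp (2 * s) *
      heatFisher (P.map fun ω => blockSum lam (joint X ω)) (Real.exp (2 * s) - 1) ≤
      ∫ s in (0 : ℝ)..t, ∑ i, ∑ j, lam i * lam j *
        (Real.exp (2 * s) * heatFisherMatrix (P.map (joint X)) (Real.exp (2 * s) - 1) i j) := by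
    refine intervalIntegral.integral_mono_on_of_le_Ioo ht hFs hM fun s hs => ?_
    have h := heatFisher_blockSum_le lam (measurable_joint hX) (measurable_joint hZ) hXZ
      (map_joint_eq_blockGaussian hZ hZ_indep hZ_law)
      (map_blockSum_joint hZ hlam_sum hZ_indep hZ_law) (exp_two_mul_sub_one_pos hs.1)
    refine (mul_le_mul_of_nonneg_left h (Real.exp_pos (2 * s)).le).trans_eq ?_
    simp only [Finset.mul_sum]
    exact Finset.sum_congr rfl fun i _ => Finset.sum_congr rfl fun j _ => by ring
  have hterm : errorTerm P lam X Z t =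
      (∫ s in (0 : ℝ)..t, ∑ i, ∑ j, lam i * lam j *
        (Real.exp (2 * s) * heatFisherMatrix (P.map (joint X)) (Real.exp (2 * s) - 1) i j)) -
      (∫ s in (0 : ℝ)..t, Real.exp (2 * s) *
        heatFisher (P.map (joint X)) (Real.exp (2 * s) - 1)) +
      ∑ i, lam i ^ 2 * ∫ s in (0 : ℝ)..t, Real.exp (2 * s) *
        heatFisher (P.map (others X i)) (Real.exp (2 * s) - 1) := by
    rw [errorTerm, ← intervalIntegral.integral_congr_ae (ae_of_all _ hrate),
      intervalIntegral.integral_add (hM.sub hFj) hFo, intervalIntegral.integral_sub hM hFj,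
      intervalIntegral.integral_finsetSum fun i _ => (hO i).1.const_mul _]
    simp only [intervalIntegral.integral_const_mul]
  have hfin := hasFiniteEntropy_ouFlow hlam_sum hX hZ hX2 hXj hXo hXs hZ_law hZ_indep hXZ ht
  -- The drift terms N·t of the subvectors sum to (nd − d)t, which cancels those of the joint vector
  -- and of the weighted sum.
  have hdim : ∑ i : Fin n, lam i ^ 2 * ((blockDim {j : Fin n // j ≠ i} d : ℝ) * t) =
      (blockDim (Fin n) d - d) * t := by
    simp only [blockDim_ne, ← Finset.sum_mul, hlam_sum, one_mul]
  rw [entropyGap_eq hlam_sum (measurable_ouFlow hX hZ t) hfin.1 hfin.2.2,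
    entropyGap_eq hlam_sum hX hXj hXs, blockSum_joint_ouFlow, hEs, joint_ouFlow, hEj]
  simp only [others_ouFlow, (hO _).2, mul_sub, mul_add, Finset.sum_sub_distrib,
    Finset.sum_add_distrib, hdim, hterm, blockDim_unit]
  linarith

theorem tendsto_entropyGap_ouFlow (hlam_sum : ∑ i, lam i ^ 2 = 1) (hX : ∀ i, Measurable (X i))
    (hZ : ∀ i, Measurable (Z i)) (hX2 : ∀ i, MemLp (X i) 2 P)
    (hXj : HasFiniteEntropy P (joint X)) (hXo : ∀ i, HasFiniteEntropy P (others X i))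
    (hXs : HasFiniteEntropy P fun ω => blockSum lam (joint X ω))
    (hZ_law : ∀ i, P.map (Z i) = stdGaussian (EuclideanSpace ℝ (Fin d)))
    (hZ_indep : iIndepFun Z P) (hXZ : IndepFun (joint X) (joint Z) P) :
    Tendsto (fun t => entropyGap P lam (ouFlow X Z t)) atTop (𝓝 0) := by
  have hj := tendsto_entropy_blockOU (measurable_joint hX) (measurable_joint hZ)
    hXZ (map_joint_eq_blockGaussian hZ hZ_indep hZ_law) (integrable_normSq_joint hX hX2)
  have ho := fun i => tendsto_entropy_blockOU (measurable_others hX i)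
    (measurable_others hZ i) (indepFun_others hXZ i)
    (map_others_eq_blockGaussian hZ hZ_indep hZ_law i) (integrable_normSq_others hX hX2 i)
  have hs := tendsto_entropy_blockOU
    (measurable_blockSum_joint hX lam)
    (measurable_blockSum_joint hZ lam) (indepFun_blockSum hXZ lam)
    (map_blockSum_joint hZ hlam_sum hZ_indep hZ_law) (integrable_normSq_blockSum hX hX2 lam)
  have h := (hs.sub hj).add (tendsto_finsetSum Finset.univ fun i _ => (ho i).const_mul (lam i ^ 2))
  simp only [blockDim_ne, ← Finset.sum_mul, hlam_sum, one_mul, blockDim_unit] at h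
  -- The Gaussian entropies are proportional to the dimension, so the limits cancel as d − nd + (n −
  -- 1)d = 0.
  have h0 : ∀ c : ℝ, d * c - blockDim (Fin n) d * c + (blockDim (Fin n) d - d) * c = 0 :=
    fun c => by ring
  rw [h0] at h
  refine h.congr' ?_
  filter_upwards [eventually_ge_atTop 0] with t ht
  have hfin := hasFiniteEntropy_ouFlow hlam_sum hX hZ hX2 hXj hXo hXs hZ_law hZ_indep hXZ ht
  rw [entropyGap_eq hlam_sum (measurable_ouFlow hX hZ t) hfin.1 hfin.2.2, blockSum_joint_ouFlow]
  rfl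

end Gap

/-! ### Passage to the limit in the extended reals -/

theorem neg_le_limsup_coe {g S : ℝ → ℝ} {a : ℝ} (hg : Tendsto g atTop (𝓝 0))
    (hS : ∀ t, 0 ≤ t → g t ≤ a + S t) :
    ((-a : ℝ) : EReal) ≤ limsup (fun t => (S t : EReal)) atTop := by
  -- The lower bound g − a converges, so its limsup is its limit; in `EReal` no boundedness of S is
  -- required for the comparison.
  have h1 : Tendsto (fun t => ((g t - a : ℝ) : EReal)) atTop (𝓝 ((-a : ℝ) : EReal)) := by
    have := hg.sub_const a
    rw [zero_sub] at this
    exact (continuous_coe_real_ereal.tendsto _).comp this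
  rw [← h1.limsup_eq]
  refine limsup_le_limsup ?_
  filter_upwards [eventually_ge_atTop 0] with t ht
  have := hS t ht
  exact EReal.coe_le_coe_iff.2 (by linarith)

/-- Rearrangement with L possibly infinite. Since A and B are real, no indeterminate expression
occurs. -/
theorem coe_sub_le_of_neg_le {A B : ℝ} {L : EReal} (h : ((-(B - A) : ℝ) : EReal) ≤ L) :
    (A : EReal) - L ≤ B := by
  refine EReal.sub_le_of_le_add ?_
  calc (A : EReal) = (B : EReal) + ((-(B - A) : ℝ) : EReal) := by
        rw [← EReal.coe_add]
        congr 1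
        ring
    _ ≤ B + L := by gcongr

end CondEPI

theorem mainTheorem5 {Ω : Type*} [MeasurableSpace Ω]
    (P : MeasureTheory.Measure Ω) [MeasureTheory.IsProbabilityMeasure P] {n d : ℕ}
    (X Z : Fin n → Ω → EuclideanSpace ℝ (Fin d)) (lam : Fin n → ℝ)
    (hlam : ∀ i, lam i ∈ Set.Ioo (0 : ℝ) 1) (hlam_sum : ∑ i, lam i ^ 2 = 1)
    (hX : ∀ i, Measurable (X i)) (hZ : ∀ i, Measurable (Z i))
    -- finite second moments and finite entropies of the `X`-vectors that occur
    (hX_mom : ∀ i, MeasureTheory.MemLp (X i) 2 P)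
    (hX_joint : CondEPI.HasFiniteEntropy P (CondEPI.joint X))
    (hX_others : ∀ i, CondEPI.HasFiniteEntropy P (CondEPI.others X i))
    (hX_sum : CondEPI.HasFiniteEntropy P (CondEPI.weightedSum lam X))
    -- independent standard Gaussian vectors, jointly independent of `(X_1, …, X_n)`
    (hZ_law : ∀ i, P.map (Z i) = ProbabilityTheory.stdGaussian (EuclideanSpace ℝ (Fin d)))
    (hZ_indep : ProbabilityTheory.iIndepFun Z P)
    (hXZ_indep : ProbabilityTheory.IndepFun (CondEPI.joint X) (CondEPI.joint Z) P) :
    -- the entropies along the flow are well defined and finite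
    (∀ t : ℝ, 0 ≤ t →
      CondEPI.HasFiniteEntropy P (CondEPI.joint (CondEPI.ouFlow X Z t)) ∧
      (∀ i, CondEPI.HasFiniteEntropy P (CondEPI.others (CondEPI.ouFlow X Z t) i)) ∧
      CondEPI.HasFiniteEntropy P (CondEPI.weightedSum lam (CondEPI.ouFlow X Z t))) ∧
    -- the Fisher informations along the flow are well defined and finite
    (∀ s : ℝ, 0 < s →
      CondEPI.HasFisherMatrix P (CondEPI.joint (CondEPI.ouFlow X Z s)) ∧
      ∀ i, CondEPI.HasFisherInfo P (CondEPI.others (CondEPI.ouFlow X Z s) i)) ∧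
    -- the integral `S_t` converges, and the monotonicity inequality holds
    (∀ t : ℝ, 0 ≤ t →
      IntervalIntegrable (fun s => CondEPI.errorRate P lam (CondEPI.ouFlow X Z s))
        MeasureTheory.volume 0 t ∧
      CondEPI.entropyGap P lam (CondEPI.ouFlow X Z t) ≤
        CondEPI.entropyGap P lam X + CondEPI.errorTerm P lam X Z t) ∧
    -- the linearized conditional entropy power inequality
    ((∑ i, lam i ^ 2 * CondEPI.condEntropy P (X i) (CondEPI.others X i) : ℝ) : EReal)
        - Filter.limsup (fun t : ℝ => ((CondEPI.errorTerm P lam X Z t : ℝ) : EReal)) Filter.atTop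
      ≤ ((CondEPI.entropy P (CondEPI.weightedSum lam X) : ℝ) : EReal) := by
  have hXs := CondEPI.hasFiniteEntropy_blockSum hX hX_sum
  have hfin := fun (t : ℝ) (ht : 0 ≤ t) => CondEPI.hasFiniteEntropy_ouFlow hlam_sum hX hZ hX_mom
    hX_joint hX_others hXs hZ_law hZ_indep hXZ_indep ht
  have hgap := fun (t : ℝ) (ht : 0 ≤ t) => CondEPI.entropyGap_ouFlow_le hlam_sum hX hZ hX_mom
    hX_joint hX_others hXs hZ_law hZ_indep hXZ_indep ht
  refine ⟨fun t ht => ⟨(hfin t ht).1, (hfin t ht).2.1, (CondEPI.entropy_weightedSum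
    (CondEPI.measurable_ouFlow hX hZ t) (hfin t ht).2.2).1⟩, fun s hs => ⟨?_, fun i => ?_⟩,
    hgap, ?_⟩
  · exact CondEPI.hasFisherMatrix_blockOU (CondEPI.measurable_joint hX)
      (CondEPI.measurable_joint hZ) hXZ_indep
      (CondEPI.map_joint_eq_blockGaussian hZ hZ_indep hZ_law) hs
  · exact CondEPI.hasFisherInfo_blockOU (CondEPI.measurable_others hX i)
      (CondEPI.measurable_others hZ i) (CondEPI.indepFun_others hXZ_indep i)
      (CondEPI.map_others_eq_blockGaussian hZ hZ_indep hZ_law i) hs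
  -- By definition the initial gap is B − A, with B the entropy of the weighted sum and A the
  -- weighted sum of conditional entropies.
  · exact CondEPI.coe_sub_le_of_neg_le (CondEPI.neg_le_limsup_coe
      (CondEPI.tendsto_entropyGap_ouFlow hlam_sum hX hZ hX_mom hX_joint hX_others hXs hZ_law
        hZ_indep hXZ_indep) fun t ht => (hgap t ht).2)
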